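/- Let $n\ge 1$ and $[\pm n]=\{1,\dots,n,-1,\dots,-n\}$. A set partition of type $C_n$ is a set partition of $[\pm n]$ such that $B$ is a block if and only if $-B$ is a block, and such that at most one block $B$ satisfies $B=-B$. Its arcs are the pairs $(i,j)$ of consecutive elements of a block with respect to the nesting order $1<2<\dots<n<-n<\dots<-2<-1$. Consider the bottom-aligned polyomino with $n$ columns of heights $2n-1,2n-2,\dots,n$ (from left to right), whose columns are labelled $1,\dots,n$. It is called the nesting polyomino if its rows are labelled, from top to bottom, $2,3,\dots,n,-n,\dots,-2,-1$, and the crossing polyomino if its rows are labelled $2,3,\dots,n,-1,-2,\dots,-n$. The filling of the nesting (resp. crossing) polyomino corresponding to a type $C_n$ set partition has a $1$ in the box in column $i$ and row labelled $j$ if $(i,j)$ is an arc, and a $0$ otherwise. A north-east chain in a $0$-$1$-filling is a set of boxes containing ones such that, of any two of them, one lies strictly to the right of and strictly above the other. For $1\le m\le 2n-1$, let corner $m$ be the top-right corner of the box in column $k$ and $k$-th row from the top if $m=2k-1$, and the bottom-right corner of that box if $m=2k$. The integer partition labelling a corner is the partition such that for every $k$ the sum of its first $k$ parts is the maximal cardinality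 of a union of $k$ north-east chains in the rectangular region of the polyomino to the left of and below the corner. This gives a sequence $(\lambda_1,\dots,\lambda_{2n-1})$ of integer partitions labelling the corners along the border of the upper half of the polyomino from top to bottom. With $\lambda_0=\emptyset$, such a sequence is called vacillating if, whenever the indices lie between $0$ and $2n-1$, - $\lambda_{2k-1}=\lambda_{2k}$, or $\lambda_{2k-1}$ is obtained from $\lambda_{2k}$ by adding one to some part (possibly to a part $0$), and - $\lambda_{2k+1}=\lambda_{2k}$, or $\lambda_{2k+1}$ is obtained from $\lambda_{2k}$ by adding one to some part (possibly to a part $0$). Proposition. (a) The map from type $C_n$ set partitions to fillings of the nesting polyomino is injective. Every filling in its image has a unique labelling $(\lambda_1,\dots,\lambda_{2n-1})$, and sending a filling to its labelling is a bijection from the $0$-$1$-fillings of the nesting polyomino that correspond to type $C_n$ set partitions onto the vacillating sequences of integer partitions for which $\lambda_{2n-1}$ has at most one column of odd length. (b) The map from type $C_n$ set partitions to fillings of the crossing polyomino is injective. Every filling in its image has a unique labelling $(\lambda_1,\dots,\lambda_{2n-1})$, and sending a filling to its labelling is a bijection from the $0$-$1$-fillings of the crossing polyomino that correspond to type $C_n$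 set partitions onto the vacillating sequences of integer partitions for which $\lambda_{2n-1}$ has at most one odd part. -/

import Mathlib

/-- The finite set `[±n] = {1, …, n, -1, …, -n}` of integers. -/
noncomputable def signedSet (n : ℕ) : Finset ℤ := (Finset.Icc (-(n : ℤ)) n).erase 0

/-- The set `-B`. -/
def negSet (B : Finset ℤ) : Finset ℤ := B.image (fun x => -x)

/-- Set partitions of type `C_n`: set partitions of `[±n]` such that `B` is a block if and only
if `-B` is a block, and with at most one block `B` (the zero block) such that `B = -B`. -/
def TypeCPartition (n : ℕ) : Type :=
  {P : Finpartition (signedSet n) //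
    (∀ B : Finset ℤ, B ∈ P.parts ↔ negSet B ∈ P.parts) ∧
    (∀ B ∈ P.parts, ∀ B' ∈ P.parts, B = negSet B → B' = negSet B' → B = B')}

/-- The position of an element of `[±n]` in the nesting order
`1 < 2 < … < n < -n < … < -2 < -1`. -/
def nestingPos (n : ℕ) (x : ℤ) : ℤ := if 0 < x then x else 2 * (n : ℤ) + 1 + x

/-- `(i, j)` is an arc of the partition: `i` and `j` are consecutive elements, in the nesting
order, of some block. The nesting diagram and the crossing diagram have the same arcs. -/
def IsArc {n : ℕ} (P : TypeCPartition n) (i j : ℤ) : Prop :=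
  ∃ B ∈ P.1.parts, i ∈ B ∧ j ∈ B ∧ nestingPos n i < nestingPos n j ∧
    ∀ k ∈ B, ¬ (nestingPos n i < nestingPos n k ∧ nestingPos n k < nestingPos n j)

/-- The boxes `(c, r)` (column `c`, counted from the left, row `r`, counted from the top, both
starting with `1`) of the bottom-aligned polyomino with `n` columns of heights
`2n-1, 2n-2, …, n`: column `c` occupies the rows `c, …, 2n-1`. This is the shape of both the
nesting and the crossing polyomino. -/
def boxes (n : ℕ) : Finset (ℕ × ℕ) :=
  (Finset.Icc 1 n ×ˢ Finset.Icc 1 (2 * n - 1)).filter (fun p => p.1 ≤ p.2)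

/-- `0`-`1`-fillings of the polyomino. -/
abbrev Filling (n : ℕ) : Type := boxes n → Fin 2

/-- The row labels of the nesting polyomino, from top to bottom `2, 3, …, n, -n, …, -2, -1`. -/
def nestingRow (n : ℕ) (r : ℕ) : ℤ := if r < n then (r : ℤ) + 1 else (r : ℤ) - 2 * (n : ℤ)

/-- The row labels of the crossing polyomino, from top to bottom `2, 3, …, n, -1, -2, …, -n`. -/
def crossingRow (n : ℕ) (r : ℕ) : ℤ := if r < n then (r : ℤ) + 1 else (n : ℤ) - 1 - (r : ℤ)

open Classical in
/-- The filling of the nesting polyomino that corresponds to a type `C_n` set partition: ones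
in the boxes that correspond to arcs, zeros elsewhere. -/
noncomputable def nestingFilling (n : ℕ) (P : TypeCPartition n) : Filling n :=
  fun b => if IsArc P (b.1.1 : ℤ) (nestingRow n b.1.2) then 1 else 0

open Classical in
/-- The filling of the crossing polyomino that corresponds to a type `C_n` set partition. -/
noncomputable def crossingFilling (n : ℕ) (P : TypeCPartition n) : Filling n :=
  fun b => if IsArc P (b.1.1 : ℤ) (crossingRow n b.1.2) then 1 else 0

/-- A set of boxes is a north-east chain if of any two distinct boxes in it one is strictly to
the right of and strictly above the other (row numbers increase downwards). -/
def IsNEChain (T : Finset (ℕ × ℕ)) : Prop :=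
  IsChain (fun p q : ℕ × ℕ => p.1 < q.1 ∧ q.2 < p.2) (T : Set (ℕ × ℕ))

/-- `T` is a union of `k` (possibly empty) north-east chains. -/
def IsUnionOfNEChains (k : ℕ) (T : Finset (ℕ × ℕ)) : Prop :=
  ∃ C : Fin k → Finset (ℕ × ℕ), (∀ i, IsNEChain (C i)) ∧ T = Finset.univ.biUnion C

/-- The boxes containing ones in the rectangular region consisting of the columns `1, …, c` and
the rows `r, r+1, …, 2n-1`. -/
def onesInRegion {n : ℕ} (F : Filling n) (c r : ℕ) : Set (ℕ × ℕ) :=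
  {p | p.1 ≤ c ∧ r ≤ p.2 ∧ ∃ h : p ∈ boxes n, F ⟨p, h⟩ = 1}

/-- `μ` is the integer partition attached to the set `S` of boxes: for all `k` the sum of the
first `k` parts of `μ` is the maximal cardinality of a union of `k` north-east chains in `S`. -/
def IsChainShape (S : Set (ℕ × ℕ)) (μ : YoungDiagram) : Prop :=
  ∀ k : ℕ, IsGreatest
    {m : ℕ | ∃ T : Finset (ℕ × ℕ), (T : Set (ℕ × ℕ)) ⊆ S ∧ IsUnionOfNEChains k T ∧ T.card = m}
    (∑ i ∈ Finset.range k, μ.rowLen i)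

/-- Sequences `(λ_1, λ_2, …, λ_{2n-1})` of integer partitions. -/
abbrev PartitionSeq (n : ℕ) : Type := Finset.Icc 1 (2 * n - 1) → YoungDiagram

/-- The sequence labels the top-right corners along the border of the upper half of the
polyomino, read from top to bottom. The corner with number `2k-1` is the top-right corner of the
box in column `k` and row `k`, the corner with number `2k` is the bottom-right corner of this box.
The region to the left of and below corner `m` thus consists of the columns up to `(m+1)/2` and
the rows from `m/2+1` on (with integer division). -/
def IsBorderLabelling {n : ℕ} (F : Filling n) (L : PartitionSeq n) : Prop :=
  ∀ m, IsChainShape (onesInRegion F ((m.1 + 1) / 2) (m.1 / 2 + 1)) (L m)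

/-- The `m`-th member of a sequence `(λ_1, …, λ_{2n-1})`, with the convention that `λ_0` is the
empty partition. (The value for `m ≥ 2n` is never used.) -/
def PartitionSeq.term {n : ℕ} (L : PartitionSeq n) (m : ℕ) : YoungDiagram :=
  if h : m ∈ Finset.Icc 1 (2 * n - 1) then L ⟨m, h⟩ else ⊥

/-- `μ = ν`, or `μ` is obtained from `ν` by adding one to some part (possibly to a part `0`). -/
def EqOrAddOne (ν μ : YoungDiagram) : Prop :=
  μ = ν ∨ ∃ i : ℕ, ∀ j : ℕ, μ.rowLen j = ν.rowLen j + if j = i then 1 else 0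

/-- Vacillating sequences: `λ_{2k+1}` is equal to `λ_{2k}` or obtained from it by adding one to
some part, and likewise `λ_{2k+1}` and `λ_{2k+2}`, for all indices in the range, with `λ_0 = ∅`. -/
def IsVacillating {n : ℕ} (L : PartitionSeq n) : Prop :=
  ∀ k : ℕ,
    (2 * k + 1 ≤ 2 * n - 1 → EqOrAddOne (L.term (2 * k)) (L.term (2 * k + 1))) ∧
    (2 * k + 2 ≤ 2 * n - 1 → EqOrAddOne (L.term (2 * k + 2)) (L.term (2 * k + 1)))

/-- At most one column of `μ` has odd length. -/
def AtMostOneOddColumn (μ : YoungDiagram) : Prop := {j : ℕ | Odd (μ.colLen j)}.Subsingleton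

/-- At most one part of `μ` is odd. -/
def AtMostOneOddPart (μ : YoungDiagram) : Prop := {i : ℕ | Odd (μ.rowLen i)}.Subsingleton

/-! In a partial permutation the north-east chains are the antichains of the order `SE`. A union of
`k` of them is therefore a set with `k` levels, and the label of a corner is `shape SE` of the
points to its left and below (`isUnionOfNEChains_iff`, `isChainShape_iff`).

These labels form a Fomin growth diagram: around every box they satisfy `LocalRule`, written row by
row with maxima and minima (`localRule_cornerShape`). The rule determines the top-right label from
the entry and the other three labels, and it also determines the entry and the bottom-left label
from the other three. Both the rule and Greene duality (`shape_NE_eq_transpose`) rest on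
inequalities obtained by merging two levelled sets into joint levels and dealing these out
alternately (`exists_alternating_split`), together with the weak duality bound
`maxLevelled_add_maxLevelled_le`.

If `(i, j)` is an arc, so is `(-j, -i)`. Hence type `C_n` partitions correspond to partial
permutations in the polyomino whose lower `n × n` square is symmetric in the diagonal from
bottom-left to top-right, with at most one point on that diagonal because there is at most one zero
block (`isNestingSet_arcSet`, `partitionOfSet`, `arcSet_partitionOfSet`).

Running the rule backwards from a vacillating sequence fills the part above the square and yields
the labels along the top of the square. By symmetry the labels on the right side are the mirror
image of those, so the square is determined too; conversely, prescribing mirror-image labels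
produces a filling that is symmetric by uniqueness (`exists_symmetricSquare`). At a diagonal box the
two off-diagonal labels agree, and then the alternating sum of the parts, which counts the odd
columns, increases by the entry of the box. So the odd columns of the last label count the diagonal
points, which gives (a).

The crossing filling arises from the nesting filling by reversing the rows of the square. This
exchanges `SE` and `NE`, so by Greene duality it transposes the labels along the top of the square,
and odd columns turn into odd parts, which gives (b). -/

namespace GreeneGrowth

/-! ### Unions of antichains: exchange inequalities for their maximal sizes. -/

/-- `T` carries a function to `{0, …, k-1}` that is strictly increasing along `r`; for a transitive
relation this means that `T` is a union of `k` antichains of `r`. -/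
def IsLevelled {α : Type*} (r : α → α → Prop) (k : ℕ) (T : Finset α) : Prop :=
  ∃ f : α → ℕ, (∀ x ∈ T, f x < k) ∧ ∀ x ∈ T, ∀ y ∈ T, r x y → f x < f y

section Levelled

variable {α : Type*} {r : α → α → Prop}

theorem IsLevelled.mono {k l : ℕ} {T U : Finset α} (h : IsLevelled r k T) (hU : U ⊆ T)
    (hk : k ≤ l) : IsLevelled r l U := by
  obtain ⟨f, hf, hm⟩ := h
  exact ⟨f, fun x hx => (hf x (hU hx)).trans_le hk,
    fun x hx y hy => hm x (hU hx) y (hU hy)⟩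

theorem isLevelled_zero {T : Finset α} : IsLevelled r 0 T ↔ T = ∅ := by
  constructor
  · rintro ⟨f, hf, -⟩
    exact Finset.eq_empty_of_forall_notMem fun x hx => Nat.not_lt_zero _ (hf x hx)
  · rintro rfl
    exact ⟨fun _ => 0, by simp, by simp⟩

/-- Two levelled sets can be redistributed evenly: their joint levels are sorted, and taken
alternately. Elements of `Q`, which are maximal, are put into the last joint level. -/
theorem exists_alternating_split [DecidableEq α] (tr : ∀ x y z, r x y → r y z → r x z)
    {A B : Finset α} {k l : ℕ} (hA : IsLevelled r k A) (hB : IsLevelled r l B) (Q : Finset α)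
    (hQ : ∀ q ∈ Q, ∀ y ∈ A ∪ B, ¬ r q y) (hQ1 : ∀ q ∈ Q, q ∉ A ∩ B) :
    ∃ E O : Finset α, E ⊆ A ∪ B ∧ O ⊆ A ∪ B ∧ E.card + O.card = A.card + B.card ∧
      IsLevelled r ((k + l + 1) / 2) E ∧ IsLevelled r ((k + l) / 2) O ∧
      (∀ p, p ∉ Q → p ∉ A ∩ B → (∀ y ∈ A ∪ B, ¬ r y p) → p ∉ O) ∧
      (∀ q ∈ Q, ((k + l) % 2 = 1 → q ∉ O) ∧ ((k + l) % 2 = 0 → q ∉ E)) := by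
  classical
  obtain ⟨f, hf, hfm⟩ := hA
  obtain ⟨g, hg, hgm⟩ := hB
  -- The lowest level that the elements of `A` below `x` allow for `x`, also when `x` lies outside
  -- `A`; the supremum is `0` if there are none. Using this instead of `f` puts minimal elements
  -- into joint level `0`.
  let a : α → ℕ := fun x => (A.filter (fun y => r y x)).sup (fun y => f y + 1)
  let b : α → ℕ := fun x => (B.filter (fun y => r y x)).sup (fun y => g y + 1)
  have a_mono : ∀ x y, r x y → a x ≤ a y := fun x y hxy =>
    Finset.sup_mono fun z hz => by
      simp only [Finset.mem_filter] at hz ⊢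
      exact ⟨hz.1, tr _ _ _ hz.2 hxy⟩
  have b_mono : ∀ x y, r x y → b x ≤ b y := fun x y hxy =>
    Finset.sup_mono fun z hz => by
      simp only [Finset.mem_filter] at hz ⊢
      exact ⟨hz.1, tr _ _ _ hz.2 hxy⟩
  have a_le : ∀ x ∈ A, a x ≤ f x := fun x hx => Finset.sup_le fun y hy => by
    simp only [Finset.mem_filter] at hy
    exact hfm y hy.1 x hx hy.2
  have b_le : ∀ x ∈ B, b x ≤ g x := fun x hx => Finset.sup_le fun y hy => by
    simp only [Finset.mem_filter] at hy
    exact hgm y hy.1 x hx hy.2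
  have lt_a : ∀ x ∈ A, ∀ y, r x y → f x + 1 ≤ a y := fun x hx y hxy =>
    Finset.le_sup (f := fun y => f y + 1) (Finset.mem_filter.2 ⟨hx, hxy⟩)
  have lt_b : ∀ x ∈ B, ∀ y, r x y → g x + 1 ≤ b y := fun x hx y hxy =>
    Finset.le_sup (f := fun y => g y + 1) (Finset.mem_filter.2 ⟨hx, hxy⟩)
  have a_bd : ∀ x, a x ≤ k := fun x => Finset.sup_le fun y hy => hf y (Finset.mem_filter.1 hy).1
  have b_bd : ∀ x, b x ≤ l := fun x => Finset.sup_le fun y hy => hg y (Finset.mem_filter.1 hy).1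
  -- The multiplicity of `x` in the multiset sum of `A` and `B`: `x` occupies the joint levels `L x,
  -- …, L x + w x - 1`.
  let w : α → ℕ := fun x => (if x ∈ A then 1 else 0) + (if x ∈ B then 1 else 0)
  -- The last joint level is `k + l - 1`, so the parity of `k + l` decides which half receives the
  -- elements of `Q`.
  let L : α → ℕ := fun x => if x ∈ Q then k + l - 1 else a x + b x
  have ab_bd : ∀ x, a x + b x + w x ≤ k + l := by
    intro x
    have h1 := a_bd x
    have h2 := b_bd x
    simp only [w]
    split_ifs with hxA hxB hxB
    · have := a_le x hxA; have := hf x hxA; have := b_le x hxB; have := hg x hxB; omega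
    · have := a_le x hxA; have := hf x hxA; omega
    · have := b_le x hxB; have := hg x hxB; omega
    · omega
  have w_pos : ∀ x ∈ A ∪ B, 1 ≤ w x := by
    intro x hx
    simp only [w]
    rcases Finset.mem_union.1 hx with h | h <;> simp [h]
  have w_le : ∀ x, x ∉ A ∩ B → w x ≤ 1 := by
    intro x hx
    simp only [w]
    by_cases h1 : x ∈ A <;> by_cases h2 : x ∈ B <;> simp_all
  have w_two : ∀ x, x ∈ A ∩ B → w x = 2 := by
    intro x hx
    rw [Finset.mem_inter] at hx
    simp [w, hx.1, hx.2]
  have L_bd : ∀ x ∈ A ∪ B, L x + w x ≤ k + l := by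
    intro x hx
    simp only [L]
    split_ifs with hxQ
    · have := w_le x (hQ1 x hxQ); have := ab_bd x; have := w_pos x hx; omega
    · exact ab_bd x
  have L_lt : ∀ x ∈ A ∪ B, ∀ y ∈ A ∪ B, r x y → L x + w x ≤ L y := by
    intro x hx y hy hxy
    have hxQ : x ∉ Q := fun h => hQ x h y hy hxy
    have key : a x + b x + w x ≤ a y + b y := by
      have h1 := a_mono x y hxy
      have h2 := b_mono x y hxy
      simp only [w]
      split_ifs with hxA hxB hxB
      · have := a_le x hxA; have := lt_a x hxA y hxy; have := b_le x hxB
        have := lt_b x hxB y hxy; omega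
      · have := a_le x hxA; have := lt_a x hxA y hxy; omega
      · have := b_le x hxB; have := lt_b x hxB y hxy; omega
      · omega
    simp only [L, if_neg hxQ]
    split_ifs with hyQ
    · have := ab_bd y; have := w_pos y hy; omega
    · exact key
  -- An element of `A ∩ B` occupies two consecutive joint levels, one even and one odd, and goes
  -- into both halves. Rounding `(L x + 1) / 2` and `L x / 2` picks the index of its even,
  -- respectively odd, level.
  refine ⟨(A ∪ B).filter (fun x => x ∈ A ∩ B ∨ L x % 2 = 0),
    (A ∪ B).filter (fun x => x ∈ A ∩ B ∨ L x % 2 = 1), Finset.filter_subset _ _,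
    Finset.filter_subset _ _, ?_, ⟨fun x => (L x + 1) / 2, ?_, ?_⟩, ⟨fun x => L x / 2, ?_, ?_⟩,
    ?_, ?_⟩
  · rw [← Finset.card_union_add_card_inter, ← Finset.card_union_add_card_inter A B]
    congr 2
    · ext x
      simp only [Finset.mem_union, Finset.mem_filter, Finset.mem_inter]
      have := Nat.mod_two_eq_zero_or_one (L x)
      tauto
    · ext x
      simp only [Finset.mem_union, Finset.mem_filter, Finset.mem_inter]
      have : ¬ (L x % 2 = 0 ∧ L x % 2 = 1) := by omega
      tauto
  · intro x hx
    rw [Finset.mem_filter] at hx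
    have h1 := L_bd x hx.1
    have h2 := w_pos x hx.1
    dsimp only
    rcases hx.2 with h | h
    · have := w_two x h; omega
    · omega
  · intro x hx y hy hxy
    rw [Finset.mem_filter] at hx hy
    have h1 := L_lt x hx.1 y hy.1 hxy
    have h2 := w_pos x hx.1
    rcases hx.2 with h | h
    · have := w_two x h; dsimp only; omega
    · dsimp only; omega
  · intro x hx
    rw [Finset.mem_filter] at hx
    have h1 := L_bd x hx.1
    have h2 := w_pos x hx.1
    dsimp only
    rcases hx.2 with h | h
    · have := w_two x h; omega
    · omega
  · intro x hx y hy hxy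
    rw [Finset.mem_filter] at hx hy
    have h1 := L_lt x hx.1 y hy.1 hxy
    have h2 := w_pos x hx.1
    rcases hx.2 with h | h
    · have := w_two x h; dsimp only; omega
    · dsimp only; omega
  · intro p hpQ hp hmin hpO
    rw [Finset.mem_filter] at hpO
    have ha : a p = 0 := by
      apply Nat.le_zero.1
      refine Finset.sup_le fun y hy => ?_
      rw [Finset.mem_filter] at hy
      exact absurd hy.2 (hmin y (Finset.mem_union_left _ hy.1))
    have hb : b p = 0 := by
      apply Nat.le_zero.1
      refine Finset.sup_le fun y hy => ?_
      rw [Finset.mem_filter] at hy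
      exact absurd hy.2 (hmin y (Finset.mem_union_right _ hy.1))
    rcases hpO.2 with h | h
    · exact hp h
    · simp [L, hpQ, ha, hb] at h
  · intro q hq
    have hL : L q = k + l - 1 := by simp [L, hq]
    refine ⟨fun h hqO => ?_, fun h hqE => ?_⟩
    · rw [Finset.mem_filter] at hqO
      rcases hqO.2 with h' | h'
      · exact hQ1 q hq h'
      · omega
    · rw [Finset.mem_filter] at hqE
      have := L_bd q hqE.1
      have := w_pos q hqE.1
      rcases hqE.2 with h' | h'
      · exact hQ1 q hq h'
      · omega

open Classical in
/-- The maximal cardinality of a subset of `S` that is levelled with `k` levels. -/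
noncomputable def maxLevelled (r : α → α → Prop) (k : ℕ) (S : Finset α) : ℕ :=
  (S.powerset.filter (IsLevelled r k)).sup Finset.card

theorem IsLevelled.card_le_maxLevelled {k : ℕ} {S T : Finset α} (h : IsLevelled r k T)
    (hT : T ⊆ S) : T.card ≤ maxLevelled r k S := by
  classical
  exact Finset.le_sup (f := Finset.card) (Finset.mem_filter.2 ⟨Finset.mem_powerset.2 hT, h⟩)

theorem exists_maxLevelled (r : α → α → Prop) (k : ℕ) (S : Finset α) :
    ∃ T ⊆ S, IsLevelled r k T ∧ T.card = maxLevelled r k S := by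
  classical
  have hne : (S.powerset.filter (IsLevelled r k)).Nonempty :=
    ⟨∅, Finset.mem_filter.2 ⟨Finset.empty_mem_powerset S, fun _ => 0, by simp, by simp⟩⟩
  obtain ⟨T, hT, h⟩ := Finset.exists_mem_eq_sup _ hne Finset.card
  rw [Finset.mem_filter, Finset.mem_powerset] at hT
  exact ⟨T, hT.1, hT.2, h.symm⟩

theorem maxLevelled_le_card (k : ℕ) (S : Finset α) : maxLevelled r k S ≤ S.card := by
  obtain ⟨T, hT, -, h⟩ := exists_maxLevelled r k S
  exact h ▸ Finset.card_le_card hT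

theorem maxLevelled_mono {k l : ℕ} {S S' : Finset α} (hk : k ≤ l) (hS : S ⊆ S') :
    maxLevelled r k S ≤ maxLevelled r l S' := by
  obtain ⟨T, hT, hl, h⟩ := exists_maxLevelled r k S
  exact h ▸ (hl.mono subset_rfl hk).card_le_maxLevelled (hT.trans hS)

theorem maxLevelled_zero (S : Finset α) : maxLevelled r 0 S = 0 := by
  obtain ⟨T, -, hl, h⟩ := exists_maxLevelled r 0 S
  rw [← h, isLevelled_zero.1 hl, Finset.card_empty]

/-- `maxLevelled` is concave in the number of levels. -/
theorem maxLevelled_concave [DecidableEq α] (tr : ∀ x y z, r x y → r y z → r x z) (k : ℕ)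
    (S : Finset α) :
    maxLevelled r k S + maxLevelled r (k + 2) S ≤ 2 * maxLevelled r (k + 1) S := by
  obtain ⟨A, hA, hlA, hcA⟩ := exists_maxLevelled r k S
  obtain ⟨B, hB, hlB, hcB⟩ := exists_maxLevelled r (k + 2) S
  obtain ⟨E, O, hE, hO, hc, hlE, hlO, -, -⟩ :=
    exists_alternating_split tr hlA hlB ∅ (by simp) (by simp)
  have hAB := Finset.union_subset hA hB
  have h1 := (hlE.mono subset_rfl (by omega : _ ≤ k + 1)).card_le_maxLevelled (hE.trans hAB)
  have h2 := (hlO.mono subset_rfl (by omega : _ ≤ k + 1)).card_le_maxLevelled (hO.trans hAB)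
  omega

variable [DecidableEq α]

theorem maxLevelled_le_erase_add_one (k : ℕ) (S : Finset α) (p : α) :
    maxLevelled r k S ≤ maxLevelled r k (S.erase p) + 1 := by
  obtain ⟨A, hA, hlA, hcA⟩ := exists_maxLevelled r k S
  have h := (hlA.mono (Finset.erase_subset p A) le_rfl).card_le_maxLevelled
    (Finset.erase_subset_erase p hA)
  have := Finset.pred_card_le_card_erase (s := A) (a := p)
  omega

/-- There are `2k + 1` joint levels, and the minimal element `p` lies on level `0`, hence in the
even half with `k + 1` levels. The odd half avoids `p`. This says that no row of the shape shrinks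
when `p` is put back. -/
theorem maxLevelled_erase_of_minimal (tr : ∀ x y z, r x y → r y z → r x z) (k : ℕ)
    {S : Finset α} {p : α} (hp : ∀ y ∈ S, ¬ r y p) :
    maxLevelled r k S + maxLevelled r (k + 1) (S.erase p) ≤
      maxLevelled r (k + 1) S + maxLevelled r k (S.erase p) := by
  obtain ⟨A, hA, hlA, hcA⟩ := exists_maxLevelled r k S
  obtain ⟨B, hB, hlB, hcB⟩ := exists_maxLevelled r (k + 1) (S.erase p)
  obtain ⟨E, O, hE, hO, hc, hlE, hlO, hmin, -⟩ :=
    exists_alternating_split tr hlA hlB ∅ (by simp) (by simp)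
  have hAB := Finset.union_subset hA (hB.trans (Finset.erase_subset _ _))
  have hpB : p ∉ A ∩ B := fun h => Finset.notMem_erase p S (hB (Finset.mem_inter.1 h).2)
  have hpO := hmin p (by simp) hpB fun y hy => hp y (hAB hy)
  have h1 := (hlE.mono subset_rfl (by omega : _ ≤ k + 1)).card_le_maxLevelled (hE.trans hAB)
  have h2 := (hlO.mono subset_rfl (by omega : _ ≤ k)).card_le_maxLevelled
    (Finset.subset_erase.2 ⟨hO.trans hAB, hpO⟩)
  omega

/-- Same argument with `p` moved to the last joint level `2k`, which is even. -/
theorem maxLevelled_erase_of_maximal (tr : ∀ x y z, r x y → r y z → r x z) (k : ℕ)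
    {S : Finset α} {p : α} (hp : ∀ y ∈ S, ¬ r p y) :
    maxLevelled r k S + maxLevelled r (k + 1) (S.erase p) ≤
      maxLevelled r (k + 1) S + maxLevelled r k (S.erase p) := by
  obtain ⟨A, hA, hlA, hcA⟩ := exists_maxLevelled r k S
  obtain ⟨B, hB, hlB, hcB⟩ := exists_maxLevelled r (k + 1) (S.erase p)
  have hAB := Finset.union_subset hA (hB.trans (Finset.erase_subset _ _))
  have hpB : p ∉ A ∩ B := fun h => Finset.notMem_erase p S (hB (Finset.mem_inter.1 h).2)
  obtain ⟨E, O, hE, hO, hc, hlE, hlO, -, hmax⟩ :=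
    exists_alternating_split tr hlA hlB {p}
      (by simpa using fun y hy => hp y (hAB (Finset.mem_union.2 hy))) (by simpa using hpB)
  have hpO := (hmax p (by simp)).1 (by omega)
  have h1 := (hlE.mono subset_rfl (by omega : _ ≤ k + 1)).card_le_maxLevelled (hE.trans hAB)
  have h2 := (hlO.mono subset_rfl (by omega : _ ≤ k)).card_le_maxLevelled
    (Finset.subset_erase.2 ⟨hO.trans hAB, hpO⟩)
  omega

/-- With `p` on joint level `0` and `q` on joint level `2k`, the odd half avoids both. -/
theorem maxLevelled_erase_minimal_maximal (tr : ∀ x y z, r x y → r y z → r x z) (k : ℕ)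
    {S : Finset α} {p q : α} (hpq : p ≠ q) (hp : ∀ y ∈ S, ¬ r y p) (hq : ∀ y ∈ S, ¬ r q y) :
    maxLevelled r (k + 1) (S.erase q) + maxLevelled r k (S.erase p) ≤
      maxLevelled r (k + 1) S + maxLevelled r k ((S.erase p).erase q) := by
  obtain ⟨A, hA, hlA, hcA⟩ := exists_maxLevelled r (k + 1) (S.erase q)
  obtain ⟨B, hB, hlB, hcB⟩ := exists_maxLevelled r k (S.erase p)
  have hAB := Finset.union_subset (hA.trans (Finset.erase_subset _ _))
    (hB.trans (Finset.erase_subset _ _))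
  have hpB : p ∉ A ∩ B := fun h => Finset.notMem_erase p S (hB (Finset.mem_inter.1 h).2)
  have hqA : q ∉ A ∩ B := fun h => Finset.notMem_erase q S (hA (Finset.mem_inter.1 h).1)
  obtain ⟨E, O, hE, hO, hc, hlE, hlO, hmin, hmax⟩ :=
    exists_alternating_split tr hlA hlB {q}
      (by simpa using fun y hy => hq y (hAB (Finset.mem_union.2 hy))) (by simpa using hqA)
  have hqO := (hmax q (by simp)).1 (by omega)
  have hpO := hmin p (by simpa using hpq) hpB fun y hy => hp y (hAB hy)
  have h1 := (hlE.mono subset_rfl (by omega : _ ≤ k + 1)).card_le_maxLevelled (hE.trans hAB)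
  have h2 := (hlO.mono subset_rfl (by omega : _ ≤ k)).card_le_maxLevelled
    (Finset.subset_erase.2 ⟨Finset.subset_erase.2 ⟨hO.trans hAB, hpO⟩, hqO⟩)
  omega

/-- With `2k` joint levels both maximal elements go to the last, odd level, so the even half avoids
both. -/
theorem maxLevelled_erase_maximal_maximal (tr : ∀ x y z, r x y → r y z → r x z) (k : ℕ)
    {S : Finset α} {p q : α} (hp : ∀ y ∈ S, ¬ r p y) (hq : ∀ y ∈ S, ¬ r q y) :
    maxLevelled r k (S.erase p) + maxLevelled r k (S.erase q) ≤
      maxLevelled r k S + maxLevelled r k ((S.erase p).erase q) := by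
  obtain ⟨A, hA, hlA, hcA⟩ := exists_maxLevelled r k (S.erase p)
  obtain ⟨B, hB, hlB, hcB⟩ := exists_maxLevelled r k (S.erase q)
  have hAB := Finset.union_subset (hA.trans (Finset.erase_subset _ _))
    (hB.trans (Finset.erase_subset _ _))
  have hpA : p ∉ A ∩ B := fun h => Finset.notMem_erase p S (hA (Finset.mem_inter.1 h).1)
  have hqB : q ∉ A ∩ B := fun h => Finset.notMem_erase q S (hB (Finset.mem_inter.1 h).2)
  obtain ⟨E, O, hE, hO, hc, hlE, hlO, -, hmax⟩ :=
    exists_alternating_split tr hlA hlB {p, q}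
      (by
        intro x hx y hy
        rcases Finset.mem_insert.1 hx with rfl | hx
        · exact hp y (hAB hy)
        · rw [Finset.mem_singleton.1 hx]
          exact hq y (hAB hy))
      (by
        intro x hx
        rcases Finset.mem_insert.1 hx with rfl | hx
        · exact hpA
        · rw [Finset.mem_singleton.1 hx]
          exact hqB)
  have hpE := (hmax p (by simp)).2 (by omega)
  have hqE := (hmax q (by simp)).2 (by omega)
  have h1 := (hlO.mono subset_rfl (by omega : _ ≤ k)).card_le_maxLevelled (hO.trans hAB)
  have h2 := (hlE.mono subset_rfl (by omega : _ ≤ k)).card_le_maxLevelled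
    (Finset.subset_erase.2 ⟨Finset.subset_erase.2 ⟨hE.trans hAB, hpE⟩, hqE⟩)
  omega

end Levelled


/-! ### Young diagrams through their row lengths, and one-box extensions. -/

section YoungDiagrams

theorem youngDiagram_ext {μ ν : YoungDiagram} (h : ∀ k, μ.rowLen k = ν.rowLen k) : μ = ν := by
  ext ⟨i, j⟩
  rw [YoungDiagram.mem_cells, YoungDiagram.mem_cells, YoungDiagram.mem_iff_lt_rowLen,
    YoungDiagram.mem_iff_lt_rowLen, h]

theorem le_iff_rowLen {μ ν : YoungDiagram} : μ ≤ ν ↔ ∀ k, μ.rowLen k ≤ ν.rowLen k := by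
  constructor
  · intro h k
    by_contra! hk
    have h1 : (k, ν.rowLen k) ∈ μ := YoungDiagram.mem_iff_lt_rowLen.2 hk
    exact lt_irrefl _ (YoungDiagram.mem_iff_lt_rowLen.1 (h h1))
  · rintro h ⟨i, j⟩ hx
    rw [YoungDiagram.mem_iff_lt_rowLen] at hx ⊢
    exact hx.trans_le (h i)

theorem rowLen_bot (k : ℕ) : (⊥ : YoungDiagram).rowLen k = 0 := by
  by_contra h
  exact YoungDiagram.notMem_bot (k, 0) (YoungDiagram.mem_iff_lt_rowLen.2 (Nat.pos_of_ne_zero h))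

theorem exists_rowLen_eq (f : ℕ → ℕ) (hf : Antitone f) (hN : ∃ N, f N = 0) :
    ∃ μ : YoungDiagram, ∀ k, μ.rowLen k = f k := by
  obtain ⟨N, hN⟩ := hN
  let μ : YoungDiagram :=
    { cells := (Finset.range N ×ˢ Finset.range (f 0)).filter fun x => x.2 < f x.1
      isLowerSet := by
        rintro ⟨a, b⟩ ⟨c, d⟩ ⟨h1, h2⟩ h
        simp only [Finset.coe_filter, Finset.mem_product, Finset.mem_range,
          Set.mem_ofPred_eq] at h h1 h2 ⊢
        have := hf h1
        omega }
  have hmem : ∀ i j, (i, j) ∈ μ ↔ j < f i := by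
    intro i j
    have h1 : (i, j) ∈ μ ↔ (i < N ∧ j < f 0) ∧ j < f i := by
      rw [← YoungDiagram.mem_cells]
      simp [μ]
    rw [h1]
    refine ⟨fun h => h.2, fun h => ⟨⟨?_, h.trans_le (hf (Nat.zero_le i))⟩, h⟩⟩
    by_contra! hi
    have := hf hi
    omega
  refine ⟨μ, fun k => ?_⟩
  have h : ∀ j, j < μ.rowLen k ↔ j < f k := fun j => by
    rw [← YoungDiagram.mem_iff_lt_rowLen, hmem]
  have h1 := h (f k)
  have h2 := h (μ.rowLen k)
  omega

theorem sum_rowLen_eq_card_filter (μ : YoungDiagram) (k : ℕ) :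
    ∑ i ∈ Finset.range k, μ.rowLen i = (μ.cells.filter fun x => x.1 < k).card := by
  rw [Finset.card_eq_sum_card_fiberwise (f := Prod.fst) (t := Finset.range k)]
  · refine Finset.sum_congr rfl fun i hi => ?_
    rw [YoungDiagram.rowLen_eq_card]
    congr 1
    ext ⟨a, b⟩
    simp only [Finset.mem_range] at hi
    simp only [YoungDiagram.mem_row_iff, Finset.mem_filter, YoungDiagram.mem_cells]
    constructor
    · rintro ⟨h1, rfl⟩
      exact ⟨⟨h1, hi⟩, rfl⟩
    · rintro ⟨⟨h1, -⟩, h2⟩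
      exact ⟨h1, h2⟩
  · intro x hx
    simpa using (Finset.mem_filter.1 hx).2

theorem sum_colLen_eq_card_filter (μ : YoungDiagram) (k : ℕ) :
    ∑ i ∈ Finset.range k, μ.colLen i = (μ.cells.filter fun x => x.2 < k).card := by
  simp only [← YoungDiagram.rowLen_transpose]
  rw [sum_rowLen_eq_card_filter]
  refine Finset.card_bij (fun x _ => x.swap) ?_ ?_ ?_
  · rintro ⟨a, b⟩ h
    simpa using h
  · intro x _ y _ h
    exact Prod.swap_injective h
  · rintro ⟨a, b⟩ h
    exact ⟨(b, a), by simpa using h, rfl⟩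

theorem card_transpose (μ : YoungDiagram) : μ.transpose.card = μ.card := by
  refine Finset.card_bij (fun x _ => x.swap) ?_ ?_ ?_
  · rintro ⟨a, b⟩ h
    simpa using h
  · intro x _ y _ h
    exact Prod.swap_injective h
  · rintro ⟨a, b⟩ h
    exact ⟨(b, a), by simpa using h, rfl⟩

theorem rowLen_eq_zero {μ : YoungDiagram} {k : ℕ} (hk : μ.colLen 0 ≤ k) : μ.rowLen k = 0 := by
  by_contra h
  have := YoungDiagram.mem_iff_lt_rowLen.2 (Nat.pos_of_ne_zero h)
  have := YoungDiagram.mem_iff_lt_colLen.1 this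
  omega

theorem sum_rowLen_eq_card {μ : YoungDiagram} {k : ℕ} (hk : μ.colLen 0 ≤ k) :
    ∑ i ∈ Finset.range k, μ.rowLen i = μ.card := by
  rw [sum_rowLen_eq_card_filter]
  congr 1
  refine Finset.filter_true_of_mem ?_
  rintro ⟨i, j⟩ h
  have h0 : (i, 0) ∈ μ := μ.up_left_mem le_rfl (Nat.zero_le j) h
  exact (YoungDiagram.mem_iff_lt_colLen.1 h0).trans_le hk

theorem card_le_of_le {μ ν : YoungDiagram} (h : μ ≤ ν) : μ.card ≤ ν.card :=
  Finset.card_le_card (YoungDiagram.cells_subset_iff.2 h)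

theorem eq_of_le_of_card_le {μ ν : YoungDiagram} (h : μ ≤ ν) (hc : ν.card ≤ μ.card) : μ = ν :=
  YoungDiagram.ext (Finset.eq_of_subset_of_card_le (YoungDiagram.cells_subset_iff.2 h) hc)

/-- A diagram with one more box than a diagram that it contains. -/
theorem exists_row_of_card_eq {μ ν : YoungDiagram} (h : ν ≤ μ) (hc : μ.card = ν.card + 1) :
    ∃ i, ∀ j, μ.rowLen j = ν.rowLen j + if j = i then 1 else 0 := by
  have hle := le_iff_rowLen.1 h
  let N := max (μ.colLen 0) (ν.colLen 0)
  have h1 := sum_rowLen_eq_card (μ := μ) (k := N) (le_max_left _ _)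
  have h2 := sum_rowLen_eq_card (μ := ν) (k := N) (le_max_right _ _)
  have h3 : ∑ i ∈ Finset.range N, (μ.rowLen i - ν.rowLen i) = 1 := by
    rw [Finset.sum_tsub_distrib _ fun i _ => hle i]
    omega
  obtain ⟨i, hi, h4⟩ := Finset.exists_ne_zero_of_sum_ne_zero (h3.trans_ne one_ne_zero)
  have h5 := Finset.add_sum_erase _ (fun i => μ.rowLen i - ν.rowLen i) hi
  refine ⟨i, fun j => ?_⟩
  have := hle j
  split_ifs with hj
  · subst hj
    omega
  · by_cases hjN : j ∈ Finset.range N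
    · have := Finset.single_le_sum (f := fun i => μ.rowLen i - ν.rowLen i)
        (fun _ _ => Nat.zero_le _) (Finset.mem_erase.2 ⟨hj, hjN⟩)
      omega
    · rw [Finset.mem_range, not_lt] at hjN
      rw [rowLen_eq_zero ((le_max_left _ _).trans hjN), rowLen_eq_zero ((le_max_right _ _).trans hjN)]

theorem card_eq_of_row {μ ν : YoungDiagram} {i : ℕ}
    (h : ∀ j, μ.rowLen j = ν.rowLen j + if j = i then 1 else 0) : μ.card = ν.card + 1 := by
  let N := max (i + 1) (max (μ.colLen 0) (ν.colLen 0))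
  rw [← sum_rowLen_eq_card (μ := μ) (k := N) (by simp [N]),
    ← sum_rowLen_eq_card (μ := ν) (k := N) (by simp [N])]
  simp only [h, Finset.sum_add_distrib, Finset.sum_ite_eq', Finset.mem_range]
  rw [if_pos (by simp [N])]

theorem eqOrAddOne_iff {ν μ : YoungDiagram} :
    EqOrAddOne ν μ ↔ ν ≤ μ ∧ μ.card ≤ ν.card + 1 := by
  constructor
  · rintro (rfl | ⟨i, hi⟩)
    · exact ⟨le_rfl, by omega⟩
    · exact ⟨le_iff_rowLen.2 fun k => by rw [hi k]; omega, (card_eq_of_row hi).le⟩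
  · rintro ⟨h1, h2⟩
    by_cases h : μ.card ≤ ν.card
    · exact Or.inl (eq_of_le_of_card_le h1 h).symm
    · exact Or.inr (exists_row_of_card_eq h1 (by omega))

/-- The first `x + 1` rows and the first `ν.rowLen x` columns cover the diagram and overlap in a
full rectangle. So `ν` attains equality in the weak duality bound at this pair. -/
theorem sum_rowLen_add_sum_colLen (ν : YoungDiagram) (x : ℕ) :
    ∑ i ∈ Finset.range (x + 1), ν.rowLen i + ∑ j ∈ Finset.range (ν.rowLen x), ν.colLen j =
      ν.card + (x + 1) * ν.rowLen x := by
  rw [sum_rowLen_eq_card_filter, sum_colLen_eq_card_filter, ← Finset.card_union_add_card_inter]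
  congr 1
  · congr 1
    rw [← Finset.filter_or]
    refine Finset.filter_true_of_mem ?_
    rintro ⟨i, j⟩ h
    by_cases hi : i < x + 1
    · exact Or.inl hi
    · have := ν.rowLen_anti x i (by omega)
      have := YoungDiagram.mem_iff_lt_rowLen.1 ((YoungDiagram.mem_cells _).1 h)
      exact Or.inr (by dsimp only; omega)
  · have : (ν.cells.filter fun y => y.1 < x + 1) ∩ (ν.cells.filter fun y => y.2 < ν.rowLen x) =
        Finset.range (x + 1) ×ˢ Finset.range (ν.rowLen x) := by
      ext ⟨i, j⟩
      simp only [Finset.mem_inter, Finset.mem_filter, YoungDiagram.mem_cells, Finset.mem_product,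
        Finset.mem_range]
      constructor
      · rintro ⟨⟨-, h1⟩, -, h2⟩
        exact ⟨h1, h2⟩
      · rintro ⟨h1, h2⟩
        have := ν.rowLen_anti i x (by omega)
        have : (i, j) ∈ ν := YoungDiagram.mem_iff_lt_rowLen.2 (by omega)
        exact ⟨⟨this, h1⟩, this, h2⟩
    rw [this, Finset.card_product, Finset.card_range, Finset.card_range]

/-- A diagram with one more box than a diagram that it contains. -/
theorem exists_box_of_card_eq {μ ν : YoungDiagram} (h : ν ≤ μ) (hc : μ.card = ν.card + 1) :
    ∃ z, (∀ j, μ.colLen j = ν.colLen j + if j = z then 1 else 0) ∧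
      ∀ j, μ.rowLen j = ν.rowLen j + if j = ν.colLen z then 1 else 0 := by
  obtain ⟨z, hz⟩ := exists_row_of_card_eq (YoungDiagram.transpose_mono h)
    (by rw [card_transpose, card_transpose, hc])
  simp only [YoungDiagram.rowLen_transpose] at hz
  obtain ⟨y, hy⟩ := exists_row_of_card_eq h hc
  have hmem : (ν.colLen z, z) ∈ μ := YoungDiagram.mem_iff_lt_colLen.2 (by rw [hz]; simp)
  have hnot : (ν.colLen z, z) ∉ ν := fun h => lt_irrefl _ (YoungDiagram.mem_iff_lt_colLen.1 h)
  have hyz : ν.colLen z = y := by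
    rw [YoungDiagram.mem_iff_lt_rowLen] at hmem hnot
    rw [hy] at hmem
    by_contra h
    rw [if_neg h] at hmem
    omega
  exact ⟨z, hz, hyz ▸ hy⟩

/-- If two one-box extensions of `ν` satisfy the weak duality inequalities, then the box of the
second one does not lie below the box of the first one. -/
theorem colLen_le_of_weak_duality {l t ν : YoungDiagram} {x z : ℕ}
    (hx : ∀ j, l.rowLen j = ν.rowLen j + if j = x then 1 else 0)
    (hz : ∀ j, t.colLen j = ν.colLen j + if j = z then 1 else 0)
    (hd : ∀ a b, ∑ i ∈ Finset.range a, l.rowLen i + ∑ j ∈ Finset.range b, t.colLen j ≤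
      ν.card + 1 + a * b) : ν.colLen z ≤ x := by
  -- At this pair `ν` is already tight and the box in row `x` uses up the one unit of slack, so
  -- column `z` cannot be among the first `ν.rowLen x` columns.
  have h1 := hd (x + 1) (ν.rowLen x)
  have h2 := sum_rowLen_add_sum_colLen ν x
  simp only [hx, hz, Finset.sum_add_distrib, Finset.sum_ite_eq', Finset.mem_range] at h1
  rw [if_pos (Nat.lt_succ_self x)] at h1
  have h3 : ¬ z < ν.rowLen x := by
    intro h
    rw [if_pos h] at h1
    omega
  rw [← YoungDiagram.mem_iff_lt_rowLen, YoungDiagram.mem_iff_lt_colLen] at h3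
  omega

end YoungDiagrams

/-! ### The Greene shape of a finite strict order. -/

section Shape

variable {α : Type*} {r : α → α → Prop}

theorem maxLevelled_eq_card [IsStrictOrder α r] {k : ℕ} {S : Finset α} (hk : S.card ≤ k) :
    maxLevelled r k S = S.card := by
  classical
  refine le_antisymm (maxLevelled_le_card k S) (IsLevelled.card_le_maxLevelled ?_ subset_rfl)
  -- The number of elements below `x` is a strictly increasing level function.
  refine ⟨fun x => (S.filter fun y => r y x).card, fun x hx => ?_, fun x hx y hy hxy => ?_⟩
  · refine (Finset.card_lt_card ?_).trans_le hk
    exact Finset.filter_ssubset.2 ⟨x, hx, irrefl x⟩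
  · refine Finset.card_lt_card (Finset.ssubset_iff_of_subset ?_ |>.2 ⟨x, ?_, ?_⟩)
    · intro z hz
      simp only [Finset.mem_filter] at hz ⊢
      exact ⟨hz.1, _root_.trans hz.2 hxy⟩
    · simp [hx, hxy]
    · simp [irrefl (r := r) x]

/-- Concavity makes the increments weakly decreasing, and they vanish once `k` reaches the size of
`S`. -/
theorem exists_shape (r : α → α → Prop) [IsStrictOrder α r] (S : Finset α) :
    ∃ μ : YoungDiagram, ∀ k, μ.rowLen k = maxLevelled r (k + 1) S - maxLevelled r k S := by
  classical
  refine exists_rowLen_eq _ (antitone_nat_of_succ_le fun k => ?_) ⟨S.card, ?_⟩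
  · have := maxLevelled_concave (r := r) (fun _ _ _ => _root_.trans) k S
    have h : maxLevelled r (k + 1 + 1) S = maxLevelled r (k + 2) S := rfl
    omega
  · rw [maxLevelled_eq_card le_rfl, maxLevelled_eq_card (Nat.le_succ _), Nat.sub_self]

/-- The partition whose first `k` parts sum up to the maximal size of a union of `k` antichains. -/
noncomputable def shape (r : α → α → Prop) [IsStrictOrder α r] (S : Finset α) : YoungDiagram :=
  (exists_shape r S).choose

variable [IsStrictOrder α r]

theorem sum_rowLen_shape (k : ℕ) (S : Finset α) :
    ∑ i ∈ Finset.range k, (shape r S).rowLen i = maxLevelled r k S := by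
  induction k with
  | zero => simp [maxLevelled_zero]
  | succ k ih =>
    rw [Finset.sum_range_succ, ih, shape, (exists_shape r S).choose_spec k]
    have := maxLevelled_mono (r := r) (Nat.le_succ k) (subset_refl S)
    simp only [Nat.succ_eq_add_one] at this
    omega

theorem rowLen_shape_add (k : ℕ) (S : Finset α) :
    maxLevelled r k S + (shape r S).rowLen k = maxLevelled r (k + 1) S := by
  rw [← sum_rowLen_shape, ← sum_rowLen_shape, Finset.sum_range_succ]

theorem card_shape (S : Finset α) : (shape r S).card = S.card := by
  rw [← sum_rowLen_eq_card (le_max_left _ S.card), sum_rowLen_shape,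
    maxLevelled_eq_card (le_max_right _ _)]

theorem shape_empty : shape r (∅ : Finset α) = ⊥ :=
  (eq_of_le_of_card_le bot_le (by rw [card_shape]; simp)).symm

variable [DecidableEq α]

theorem shape_erase_le {S : Finset α} {p : α}
    (hp : (∀ y ∈ S, ¬ r y p) ∨ (∀ y ∈ S, ¬ r p y)) : shape r (S.erase p) ≤ shape r S := by
  refine le_iff_rowLen.2 fun k => ?_
  have h1 := rowLen_shape_add (r := r) k S
  have h2 := rowLen_shape_add (r := r) k (S.erase p)
  have h3 : maxLevelled r k S + maxLevelled r (k + 1) (S.erase p) ≤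
      maxLevelled r (k + 1) S + maxLevelled r k (S.erase p) := by
    rcases hp with hp | hp
    · exact maxLevelled_erase_of_minimal (fun _ _ _ => _root_.trans) k hp
    · exact maxLevelled_erase_of_maximal (fun _ _ _ => _root_.trans) k hp
  omega

theorem card_shape_erase {S : Finset α} {p : α} (hp : p ∈ S) :
    (shape r S).card = (shape r (S.erase p)).card + 1 := by
  rw [card_shape, card_shape, Finset.card_erase_add_one hp]

/-- Fomin's rule for two extremal elements whose removal leads to different shapes. -/
theorem shape_eq_sup {S : Finset α} {p q : α} (hpS : p ∈ S) (hqS : q ∈ S)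
    (hp : (∀ y ∈ S, ¬ r y p) ∨ (∀ y ∈ S, ¬ r p y)) (hq : (∀ y ∈ S, ¬ r y q) ∨ (∀ y ∈ S, ¬ r q y))
    (hne : shape r (S.erase p) ≠ shape r (S.erase q)) :
    shape r S = shape r (S.erase p) ⊔ shape r (S.erase q) := by
  -- Both shapes have one box less than `shape r S`; being different, they have a join with at least
  -- one box more than either.
  refine (eq_of_le_of_card_le (sup_le (shape_erase_le hp) (shape_erase_le hq)) ?_).symm
  have h1 := card_shape_erase (r := r) hpS
  have h2 := card_shape_erase (r := r) hqS
  by_contra! h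
  have h3 := eq_of_le_of_card_le (le_sup_left : shape r (S.erase p) ≤ _ ⊔ shape r (S.erase q))
    (by omega)
  have h4 := eq_of_le_of_card_le (le_sup_right : shape r (S.erase q) ≤ shape r (S.erase p) ⊔ _)
    (by omega)
  exact hne (h3.trans h4.symm)

end Shape


/-! ### Partial permutations and Greene duality. -/

section Points

/-- `y` lies strictly to the right of and strictly below `x` (rows are counted downwards). -/
def SE (x y : ℕ × ℕ) : Prop := x.1 < y.1 ∧ x.2 < y.2

/-- `y` lies strictly to the right of and strictly above `x`. -/
def NE (x y : ℕ × ℕ) : Prop := x.1 < y.1 ∧ y.2 < x.2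

instance : IsStrictOrder (ℕ × ℕ) SE where
  irrefl _ h := lt_irrefl _ h.1
  trans _ _ _ h h' := ⟨h.1.trans h'.1, h.2.trans h'.2⟩

instance : IsStrictOrder (ℕ × ℕ) NE where
  irrefl _ h := lt_irrefl _ h.1
  trans _ _ _ h h' := ⟨h.1.trans h'.1, h'.2.trans h.2⟩

/-- No two points lie in the same column or in the same row. -/
def IsPartialPerm (S : Finset (ℕ × ℕ)) : Prop :=
  ∀ x ∈ S, ∀ y ∈ S, (x.1 = y.1 → x = y) ∧ (x.2 = y.2 → x = y)

theorem IsPartialPerm.mono {S T : Finset (ℕ × ℕ)} (h : IsPartialPerm S) (hT : T ⊆ S) :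
    IsPartialPerm T := fun x hx y hy => h x (hT hx) y (hT hy)

/-- Two distinct points are comparable either in `SE` or in `NE`, so the pair of levels is injective
on the intersection of a `k`-levelled and an `l`-levelled set. -/
theorem maxLevelled_add_maxLevelled_le {S : Finset (ℕ × ℕ)} (hS : IsPartialPerm S) (k l : ℕ) :
    maxLevelled SE k S + maxLevelled NE l S ≤ S.card + k * l := by
  obtain ⟨A, hA, ⟨f, hf, hfm⟩, hcA⟩ := exists_maxLevelled SE k S
  obtain ⟨B, hB, ⟨g, hg, hgm⟩, hcB⟩ := exists_maxLevelled NE l S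
  rw [← hcA, ← hcB, ← Finset.card_union_add_card_inter]
  refine add_le_add (Finset.card_le_card (Finset.union_subset hA hB)) ?_
  have : (A ∩ B).card ≤ (Finset.range k ×ˢ Finset.range l).card := by
    refine Finset.card_le_card_of_injOn (fun x => (f x, g x)) ?_ ?_
    · intro x hx
      have hx := Finset.mem_inter.1 hx
      simpa using ⟨hf x hx.1, hg x hx.2⟩
    · intro x hx y hy hxy
      have hx := Finset.mem_inter.1 hx
      have hy := Finset.mem_inter.1 hy
      simp only [Prod.mk.injEq] at hxy
      have h1 := hfm x hx.1 y hy.1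
      have h2 := hfm y hy.1 x hx.1
      have h3 := hgm x hx.2 y hy.2
      have h4 := hgm y hy.2 x hx.2
      have h5 := hS x (hA hx.1) y (hA hy.1)
      by_contra hne
      have h6 : x.1 ≠ y.1 := fun h => hne (h5.1 h)
      have h7 : x.2 ≠ y.2 := fun h => hne (h5.2 h)
      unfold SE at h1 h2
      unfold NE at h3 h4
      omega
  simpa using this

/-- The shapes of a partial permutation without its topmost point and without its rightmost point
coincide: description of the shape with respect to both orders. -/
theorem shape_of_erase_eq {S : Finset (ℕ × ℕ)} (hS : IsPartialPerm S) {p q : ℕ × ℕ}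
    (hp : p ∈ S) (hq : q ∈ S) (hpq : p ≠ q) (htop : ∀ y ∈ S, p.2 ≤ y.2)
    (hright : ∀ y ∈ S, y.1 ≤ q.1)
    (h1 : shape NE (S.erase p) = (shape SE (S.erase p)).transpose)
    (h2 : shape NE (S.erase q) = (shape SE (S.erase q)).transpose)
    (h3 : shape NE ((S.erase p).erase q) = (shape SE ((S.erase p).erase q)).transpose)
    (heq : shape SE (S.erase p) = shape SE (S.erase q)) :
    ∃ i, (∀ j, (shape SE (S.erase p)).rowLen j =
        (shape SE ((S.erase p).erase q)).rowLen j + if j = i then 1 else 0) ∧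
      (∀ j, (shape SE S).rowLen j =
        (shape SE (S.erase p)).rowLen j + if j = i + 1 then 1 else 0) ∧
      shape NE S = (shape SE S).transpose := by
  have pSE : ∀ y ∈ S, ¬ SE y p := fun y hy h => by have := htop y hy; have := h.2; omega
  have pNE : ∀ y ∈ S, ¬ NE p y := fun y hy h => by have := htop y hy; have := h.2; omega
  have qSE : ∀ y ∈ S, ¬ SE q y := fun y hy h => by have := hright y hy; have := h.1; omega
  have qNE : ∀ y ∈ S, ¬ NE q y := fun y hy h => by have := hright y hy; have := h.1; omega
  have hq' : q ∈ S.erase p := Finset.mem_erase.2 ⟨hpq.symm, hq⟩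
  obtain ⟨j', hj', hi⟩ := exists_box_of_card_eq
    (shape_erase_le (r := SE) (S := S.erase p) (p := q)
      (Or.inr fun y hy => qSE y (Finset.mem_of_mem_erase hy)))
    (card_shape_erase hq')
  obtain ⟨x, hx⟩ := exists_row_of_card_eq (shape_erase_le (r := SE) (Or.inl pSE))
    (card_shape_erase hp)
  have hle : shape SE (S.erase p) ≤ (shape NE S).transpose := by
    rw [← YoungDiagram.transpose_le_iff, YoungDiagram.transpose_transpose, ← h1]
    exact shape_erase_le (Or.inr pNE)
  have hcard : (shape NE S).transpose.card = (shape SE (S.erase p)).card + 1 := by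
    rw [card_transpose, card_shape, card_shape, Finset.card_erase_add_one hp]
  obtain ⟨z, hz, hy⟩ := exists_box_of_card_eq hle hcard
  -- Here `x` is the row of the new box for `SE`, and `z` is the column of the new box in the
  -- transposed `NE` shape. The inequality here and the next two force both boxes into the row below
  -- that of the box added by `q`.
  have hzx := colLen_le_of_weak_duality hx hz (fun a b => by
    simp only [YoungDiagram.colLen_transpose]
    rw [sum_rowLen_shape, sum_rowLen_shape, ← card_shape_erase hp, card_shape]
    exact maxLevelled_add_maxLevelled_le hS a b)
  -- For `SE` the point `p` is minimal and `q` maximal; the exchange inequality with `i + 1` levels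
  -- yields a gain within the first `i + 2` rows.
  have hxi : x ≤ (shape SE ((S.erase p).erase q)).colLen j' + 1 := by
    set i := (shape SE ((S.erase p).erase q)).colLen j'
    have h := maxLevelled_erase_minimal_maximal (fun _ _ _ => _root_.trans) (i + 1) hpq pSE qSE
    simp only [← sum_rowLen_shape, ← heq] at h
    simp only [hx, Finset.sum_add_distrib, Finset.sum_ite_eq', Finset.mem_range] at h
    conv at h =>
      lhs; rhs
      simp only [hi, Finset.sum_add_distrib, Finset.sum_ite_eq', Finset.mem_range]
    rw [if_pos (Nat.lt_succ_self i)] at h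
    by_contra hcon
    rw [if_neg (by omega)] at h
    omega
  -- For `NE` both points are maximal, and rows of the `NE` shapes are columns of the `SE` shapes.
  have hzj : z ≤ j' := by
    have h := maxLevelled_erase_maximal_maximal (fun _ _ _ => _root_.trans) (j' + 1) pNE qNE
    simp only [← sum_rowLen_shape, h1, h2, h3, ← heq, YoungDiagram.rowLen_transpose] at h
    rw [← YoungDiagram.transpose_transpose (shape NE S)] at h
    simp only [YoungDiagram.rowLen_transpose, hz, hj', Finset.sum_add_distrib,
      Finset.sum_ite_eq', Finset.mem_range] at h
    rw [if_pos (Nat.lt_succ_self j')] at h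
    by_contra hcon
    rw [if_neg (by omega)] at h
    omega
  -- The box in row `i` and column `j'` belongs to the smaller diagram, hence so does the one in row
  -- `i` and column `z ≤ j'`. This closes the chain `i + 1 ≤ colLen z ≤ x ≤ i + 1`.
  have hiz : (shape SE ((S.erase p).erase q)).colLen j' < (shape SE (S.erase p)).colLen z := by
    rw [← YoungDiagram.mem_iff_lt_colLen]
    refine YoungDiagram.up_left_mem _ le_rfl hzj (YoungDiagram.mem_iff_lt_colLen.2 ?_)
    rw [hj', if_pos rfl]
    omega
  have hxeq : x = (shape SE ((S.erase p).erase q)).colLen j' + 1 := by omega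
  have hzeq : (shape SE (S.erase p)).colLen z = x := by omega
  refine ⟨_, hi, hxeq ▸ hx, ?_⟩
  rw [← YoungDiagram.transpose_eq_iff, YoungDiagram.transpose_transpose]
  exact youngDiagram_ext fun k => by rw [hx, hy, hzeq]

/-- An element incomparable to all others can be added to any levelled set on level `0`. -/
theorem maxLevelled_insert_of_forall_not {α : Type*} [DecidableEq α] {r : α → α → Prop}
    [IsStrictOrder α r] {S : Finset α} {p : α} (hp : p ∈ S) (h1 : ∀ y ∈ S, ¬ r y p)
    (h2 : ∀ y ∈ S, ¬ r p y) (k : ℕ) :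
    maxLevelled r (k + 1) S = maxLevelled r (k + 1) (S.erase p) + 1 := by
  refine le_antisymm (maxLevelled_le_erase_add_one _ _ _) ?_
  obtain ⟨A, hA, ⟨f, hf, hfm⟩, hcA⟩ := exists_maxLevelled r (k + 1) (S.erase p)
  have hpA : p ∉ A := fun h => Finset.notMem_erase p S (hA h)
  rw [← hcA, ← Finset.card_insert_of_notMem hpA]
  have hAS := hA.trans (Finset.erase_subset _ _)
  refine IsLevelled.card_le_maxLevelled ⟨fun x => if x = p then 0 else f x, ?_, ?_⟩
    (Finset.insert_subset hp hAS)
  · intro x hx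
    dsimp only
    split_ifs with h
    · omega
    · exact hf x (Finset.mem_of_mem_insert_of_ne hx h)
  · intro x hx y hy hxy
    have hxS := Finset.insert_subset hp hAS hx
    have hyS := Finset.insert_subset hp hAS hy
    have hxp : x ≠ p := fun h => h2 y hyS (h ▸ hxy)
    have hyp : y ≠ p := fun h => h1 x hxS (h ▸ hxy)
    simp only [if_neg hxp, if_neg hyp]
    exact hfm x (Finset.mem_of_mem_insert_of_ne hx hxp) y (Finset.mem_of_mem_insert_of_ne hy hyp) hxy

/-- A point that is both topmost and rightmost adds one to the first part. -/
theorem rowLen_shape_of_corner {S : Finset (ℕ × ℕ)} {p : ℕ × ℕ}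
    (hp : p ∈ S) (htop : ∀ y ∈ S, p.2 ≤ y.2) (hright : ∀ y ∈ S, y.1 ≤ p.1) (j : ℕ) :
    (shape SE S).rowLen j = (shape SE (S.erase p)).rowLen j + if j = 0 then 1 else 0 := by
  have h := maxLevelled_insert_of_forall_not (r := SE) hp
    (fun y hy h => by have := htop y hy; have := h.2; omega)
    (fun y hy h => by have := hright y hy; have := h.1; omega)
  have h1 := rowLen_shape_add (r := SE) j S
  have h2 := rowLen_shape_add (r := SE) j (S.erase p)
  rcases j with _ | j
  · have := h 0
    simp only [maxLevelled_zero] at h1 h2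
    simp only [if_true]
    omega
  · have := h j
    have := h (j + 1)
    simp only [Nat.succ_ne_zero, if_false]
    omega

/-- Greene duality: the shapes with respect to the two orders are conjugate. -/
theorem shape_NE_eq_transpose (S : Finset (ℕ × ℕ)) (hS : IsPartialPerm S) :
    shape NE S = (shape SE S).transpose := by
  induction hn : S.card using Nat.strong_induction_on generalizing S with
  | _ n ih =>
  subst hn
  rcases S.eq_empty_or_nonempty with rfl | hne
  · rw [shape_empty, shape_empty]
    exact (eq_of_le_of_card_le bot_le (by rw [card_transpose])).trans rfl
  obtain ⟨p, hp, htop⟩ := S.exists_min_image Prod.snd hne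
  obtain ⟨q, hq, hright⟩ := S.exists_max_image Prod.fst hne
  have dual : ∀ T ⊂ S, shape NE T = (shape SE T).transpose := fun T hT =>
    ih _ (Finset.card_lt_card hT) T (hS.mono hT.subset) rfl
  have pSE : ∀ y ∈ S, ¬ SE y p := fun y hy h => by have := htop y hy; have := h.2; omega
  have pNE : ∀ y ∈ S, ¬ NE p y := fun y hy h => by have := htop y hy; have := h.2; omega
  have qSE : ∀ y ∈ S, ¬ SE q y := fun y hy h => by have := hright y hy; have := h.1; omega
  have qNE : ∀ y ∈ S, ¬ NE q y := fun y hy h => by have := hright y hy; have := h.1; omega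
  have h1 := dual _ (Finset.erase_ssubset hp)
  have h2 := dual _ (Finset.erase_ssubset hq)
  by_cases hpq : p = q
  · subst hpq
    have hx := rowLen_shape_of_corner hp htop hright
    have hle : shape SE (S.erase p) ≤ (shape NE S).transpose := by
      rw [← YoungDiagram.transpose_le_iff, YoungDiagram.transpose_transpose, ← h1]
      exact shape_erase_le (Or.inr pNE)
    have hcard : (shape NE S).transpose.card = (shape SE (S.erase p)).card + 1 := by
      rw [card_transpose, card_shape, card_shape, Finset.card_erase_add_one hp]
    obtain ⟨z, hz, hy⟩ := exists_box_of_card_eq hle hcard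
    -- The `SE` shape gains a box in row `0`, and weak duality leaves no other row for the
    -- transposed `NE` shape.
    have hzx := colLen_le_of_weak_duality hx hz (fun a b => by
      simp only [YoungDiagram.colLen_transpose]
      rw [sum_rowLen_shape, sum_rowLen_shape, ← card_shape_erase hp, card_shape]
      exact maxLevelled_add_maxLevelled_le hS a b)
    rw [← YoungDiagram.transpose_eq_iff, YoungDiagram.transpose_transpose]
    exact youngDiagram_ext fun k => by rw [hx, hy, Nat.le_zero.1 hzx]
  · have h3 := dual ((S.erase p).erase q)
      ((Finset.erase_subset _ _).trans_ssubset (Finset.erase_ssubset hp))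
    by_cases heq : shape SE (S.erase p) = shape SE (S.erase q)
    · obtain ⟨i, -, -, h⟩ := shape_of_erase_eq hS hp hq hpq htop hright h1 h2 h3 heq
      exact h
    -- In both orders the shape is the join of the two smaller ones, and transposition preserves
    -- joins.
    · rw [shape_eq_sup hp hq (Or.inl pSE) (Or.inr qSE) heq,
        shape_eq_sup hp hq (Or.inr pNE) (Or.inr qNE)
          (by rw [h1, h2]; exact fun h => heq (YoungDiagram.transpose_eq_iff.1 h)), h1, h2]
      exact (map_sup YoungDiagram.transposeOrderIso _ _).symm

end Points

/-! ### The local rule of growth diagrams. -/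

section LocalRule

/-- The local rule relating the partitions at the corners of a box: `ρ` bottom-left, `μ` top-left,
`ν` bottom-right and `l` top-right, for a box containing `a`. -/
def LocalRule (a : ℕ) (ρ μ ν l : YoungDiagram) : Prop :=
  l.rowLen 0 = a + max (μ.rowLen 0) (ν.rowLen 0) ∧
    ∀ k, l.rowLen (k + 1) + ρ.rowLen k =
      max (μ.rowLen (k + 1)) (ν.rowLen (k + 1)) + min (μ.rowLen k) (ν.rowLen k)

theorem LocalRule.swap {a : ℕ} {ρ μ ν l : YoungDiagram} (h : LocalRule a ρ μ ν l) :
    LocalRule a ρ ν μ l := by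
  refine ⟨by rw [h.1, max_comm], fun k => ?_⟩
  rw [h.2, max_comm, min_comm]

theorem LocalRule.eq_top {a : ℕ} {ρ μ ν l l' : YoungDiagram} (h : LocalRule a ρ μ ν l)
    (h' : LocalRule a ρ μ ν l') : l = l' := by
  refine youngDiagram_ext fun k => ?_
  rcases k with _ | k
  · rw [h.1, h'.1]
  · have := h.2 k
    have := h'.2 k
    omega

theorem LocalRule.eq_bot {a a' : ℕ} {ρ ρ' μ ν l : YoungDiagram} (h : LocalRule a ρ μ ν l)
    (h' : LocalRule a' ρ' μ ν l) : a = a' ∧ ρ = ρ' := by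
  refine ⟨?_, youngDiagram_ext fun k => ?_⟩
  · have := h.1
    have := h'.1
    omega
  · have := h.2 k
    have := h'.2 k
    omega

theorem localRule_of_eq {ρ l : YoungDiagram} (h : ρ ≤ l) : LocalRule 0 ρ l ρ l := by
  rw [le_iff_rowLen] at h
  refine ⟨?_, fun k => ?_⟩
  · have := h 0
    omega
  · have := h k
    have := h (k + 1)
    omega

/-- The boxes of `μ` and `ν` lie in different rows, and `l` contains both. -/
theorem localRule_of_ne {ρ μ ν l : YoungDiagram} (h1 : ρ ≤ μ) (h2 : ρ ≤ ν) (h3 : μ ≤ l)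
    (h4 : ν ≤ l) (c1 : μ.card = ρ.card + 1) (c2 : ν.card = ρ.card + 1) (c3 : l.card = μ.card + 1)
    (hne : μ ≠ ν) : LocalRule 0 ρ μ ν l := by
  obtain ⟨i, hi⟩ := exists_row_of_card_eq h1 c1
  obtain ⟨j, hj⟩ := exists_row_of_card_eq h2 c2
  obtain ⟨i', hi'⟩ := exists_row_of_card_eq h3 c3
  obtain ⟨j', hj'⟩ := exists_row_of_card_eq h4 (by omega)
  have hij : i ≠ j := fun h => hne (youngDiagram_ext fun k => by rw [hi, hj, h])
  have e1 : i' = j := by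
    have a1 := hi' j
    have a2 := hj' j
    rw [hi] at a1
    rw [hj, if_pos rfl] at a2
    rw [if_neg hij.symm] at a1
    by_contra h
    rw [if_neg (Ne.symm h)] at a1
    omega
  subst e1
  refine ⟨?_, fun k => ?_⟩
  · have := hi' 0
    have := hi 0
    have := hj 0
    split_ifs at * <;> omega
  · have := hi' (k + 1)
    have := hi k
    have := hj k
    have := hi (k + 1)
    have := hj (k + 1)
    split_ifs at * <;> omega

/-- The partition attached to the region to the left of and below the corner `(c, r)`. -/
noncomputable def cornerShape (S : Finset (ℕ × ℕ)) (c r : ℕ) : YoungDiagram :=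
  shape SE (S.filter fun x => x.1 ≤ c ∧ r < x.2)

/-- The box is the one in column `c + 1` and row `r + 1`. With `U` the region of its top-right
corner, the other regions arise by deleting the point `q` in the last column, the point `p` in the
top row, or both. If one of them is missing, corners coincide in pairs; if `p = q`, the first row
grows; otherwise the two smaller shapes are either equal (`shape_of_erase_eq`) or different
(`localRule_of_ne`). -/
theorem localRule_cornerShape {S : Finset (ℕ × ℕ)} (hS : IsPartialPerm S) (c r : ℕ) :
    LocalRule (if (c + 1, r + 1) ∈ S then 1 else 0) (cornerShape S c (r + 1)) (cornerShape S c r)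
      (cornerShape S (c + 1) (r + 1)) (cornerShape S (c + 1) r) := by
  unfold cornerShape
  set U := S.filter fun x => x.1 ≤ c + 1 ∧ r < x.2 with hU
  have hUS : U ⊆ S := Finset.filter_subset _ _
  have hUP := hS.mono hUS
  have hmem : ∀ x, x ∈ U ↔ x ∈ S ∧ x.1 ≤ c + 1 ∧ r < x.2 := fun x => Finset.mem_filter
  by_cases hq : ∃ q ∈ U, q.1 = c + 1
  swap
  · push Not at hq
    have e1 : (S.filter fun x => x.1 ≤ c ∧ r < x.2) = U := by
      ext x
      have := hq x
      rw [hmem] at this ⊢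
      rw [Finset.mem_filter]
      constructor
      · rintro ⟨h1, h2, h3⟩
        exact ⟨h1, by omega, h3⟩
      · rintro ⟨h1, h2, h3⟩
        have := this ⟨h1, h2, h3⟩
        exact ⟨h1, by omega, h3⟩
    have e2 : (S.filter fun x => x.1 ≤ c ∧ r + 1 < x.2) =
        S.filter fun x => x.1 ≤ c + 1 ∧ r + 1 < x.2 := by
      ext x
      have := hq x
      rw [hmem] at this
      rw [Finset.mem_filter, Finset.mem_filter]
      constructor
      · rintro ⟨h1, h2, h3⟩
        exact ⟨h1, by omega, h3⟩
      · rintro ⟨h1, h2, h3⟩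
        have := this ⟨h1, h2, by omega⟩
        exact ⟨h1, by omega, h3⟩
    have e3 : (c + 1, r + 1) ∉ S := fun h => hq (c + 1, r + 1) ((hmem _).2 ⟨h, by simp⟩) rfl
    rw [e1, e2, if_neg e3]
    by_cases hp : ∃ p ∈ U, p.2 = r + 1
    · obtain ⟨p, hp, hpr⟩ := hp
      have e4 : (S.filter fun x => x.1 ≤ c + 1 ∧ r + 1 < x.2) = U.erase p := by
        ext x
        rw [Finset.mem_erase, hmem, Finset.mem_filter]
        constructor
        · rintro ⟨h1, h2, h3⟩
          exact ⟨fun h => by rw [h, hpr] at h3; omega, h1, h2, by omega⟩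
        · rintro ⟨h0, h1, h2, h3⟩
          refine ⟨h1, h2, lt_of_le_of_ne h3 fun h => h0 ?_⟩
          exact (hS x h1 p (hUS hp)).2 (by omega)
      rw [e4]
      refine localRule_of_eq (shape_erase_le (Or.inl fun y hy h => ?_))
      have := ((hmem y).1 hy).2.2
      have := h.2
      omega
    · push Not at hp
      have e4 : (S.filter fun x => x.1 ≤ c + 1 ∧ r + 1 < x.2) = U := by
        ext x
        have := hp x
        rw [hmem] at this ⊢
        rw [Finset.mem_filter]
        constructor
        · rintro ⟨h1, h2, h3⟩
          exact ⟨h1, h2, by omega⟩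
        · rintro ⟨h1, h2, h3⟩
          have := this ⟨h1, h2, h3⟩
          exact ⟨h1, h2, by omega⟩
      rw [e4]
      exact localRule_of_eq le_rfl
  obtain ⟨q, hq, hqc⟩ := hq
  have hright : ∀ y ∈ U, y.1 ≤ q.1 := fun y hy => by rw [hqc]; exact ((hmem y).1 hy).2.1
  have qSE : ∀ y ∈ U, ¬ SE q y := fun y hy h => by have := hright y hy; have := h.1; omega
  have e1 : (S.filter fun x => x.1 ≤ c ∧ r < x.2) = U.erase q := by
    ext x
    rw [Finset.mem_erase, hmem, Finset.mem_filter]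
    constructor
    · rintro ⟨h1, h2, h3⟩
      exact ⟨fun h => by rw [h, hqc] at h2; omega, h1, by omega, h3⟩
    · rintro ⟨h0, h1, h2, h3⟩
      refine ⟨h1, Nat.le_of_lt_succ (lt_of_le_of_ne h2 fun h => h0 ?_), h3⟩
      exact (hS x h1 q (hUS hq)).1 (by omega)
  rw [e1]
  by_cases hp : ∃ p ∈ U, p.2 = r + 1
  swap
  · push Not at hp
    have e2 : (S.filter fun x => x.1 ≤ c + 1 ∧ r + 1 < x.2) = U := by
      ext x
      have := hp x
      rw [hmem] at this ⊢
      rw [Finset.mem_filter]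
      constructor
      · rintro ⟨h1, h2, h3⟩
        exact ⟨h1, h2, by omega⟩
      · rintro ⟨h1, h2, h3⟩
        have := this ⟨h1, h2, h3⟩
        exact ⟨h1, h2, by omega⟩
    have e3 : (S.filter fun x => x.1 ≤ c ∧ r + 1 < x.2) = U.erase q := by
      rw [← e1]
      ext x
      have := hp x
      rw [hmem] at this
      rw [Finset.mem_filter, Finset.mem_filter]
      constructor
      · rintro ⟨h1, h2, h3⟩
        exact ⟨h1, h2, by omega⟩
      · rintro ⟨h1, h2, h3⟩
        have := this ⟨h1, by omega, h3⟩
        exact ⟨h1, h2, by omega⟩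
    have e4 : (c + 1, r + 1) ∉ S := fun h => hp (c + 1, r + 1) ((hmem _).2 ⟨h, by simp⟩) rfl
    rw [e2, e3, if_neg e4]
    exact (localRule_of_eq (shape_erase_le (Or.inr qSE))).swap
  obtain ⟨p, hp, hpr⟩ := hp
  have htop : ∀ y ∈ U, p.2 ≤ y.2 := fun y hy => by rw [hpr]; exact ((hmem y).1 hy).2.2
  have pSE : ∀ y ∈ U, ¬ SE y p := fun y hy h => by have := htop y hy; have := h.2; omega
  have e2 : (S.filter fun x => x.1 ≤ c + 1 ∧ r + 1 < x.2) = U.erase p := by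
    ext x
    rw [Finset.mem_erase, hmem, Finset.mem_filter]
    constructor
    · rintro ⟨h1, h2, h3⟩
      exact ⟨fun h => by rw [h, hpr] at h3; omega, h1, h2, by omega⟩
    · rintro ⟨h0, h1, h2, h3⟩
      refine ⟨h1, h2, lt_of_le_of_ne h3 fun h => h0 ?_⟩
      exact (hS x h1 p (hUS hp)).2 (by omega)
  have e3 : (S.filter fun x => x.1 ≤ c ∧ r + 1 < x.2) = (U.erase p).erase q := by
    rw [Finset.erase_right_comm, ← e1]
    ext x
    rw [Finset.mem_erase, Finset.mem_filter, Finset.mem_filter]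
    constructor
    · rintro ⟨h1, h2, h3⟩
      exact ⟨fun h => by rw [h, hpr] at h3; omega, h1, h2, by omega⟩
    · rintro ⟨h0, h1, h2, h3⟩
      refine ⟨h1, h2, lt_of_le_of_ne h3 fun h => h0 ?_⟩
      exact (hS x h1 p (hUS hp)).2 (by omega)
  rw [e2, e3]
  by_cases hpq : p = q
  · subst hpq
    have e4 : (c + 1, r + 1) ∈ S := by
      have : p = (c + 1, r + 1) := Prod.ext hqc hpr
      exact this ▸ hUS hp
    rw [if_pos e4, Finset.erase_idem]
    have h := rowLen_shape_of_corner hp htop hright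
    refine ⟨?_, fun k => ?_⟩
    · rw [h]
      simp [add_comm]
    · rw [h]
      simp
  · have e4 : (c + 1, r + 1) ∉ S := by
      intro h
      have h1 := (hS p (hUS hp) _ h).2 hpr
      have h2 := (hS q (hUS hq) _ h).1 hqc
      exact hpq (h1.trans h2.symm)
    rw [if_neg e4]
    have hq' : q ∈ U.erase p := Finset.mem_erase.2 ⟨Ne.symm hpq, hq⟩
    have hp' : p ∈ U.erase q := Finset.mem_erase.2 ⟨hpq, hp⟩
    by_cases heq : shape SE (U.erase p) = shape SE (U.erase q)
    · obtain ⟨i, h1, h2, -⟩ := shape_of_erase_eq hUP hp hq hpq htop hright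
        (shape_NE_eq_transpose _ (hUP.mono (Finset.erase_subset _ _)))
        (shape_NE_eq_transpose _ (hUP.mono (Finset.erase_subset _ _)))
        (shape_NE_eq_transpose _
          (hUP.mono ((Finset.erase_subset _ _).trans (Finset.erase_subset _ _)))) heq
      rw [← heq]
      refine ⟨?_, fun k => ?_⟩
      · rw [h2]
        simp
      · rw [h2, max_self, min_self, h1 k]
        simp only [Nat.add_right_cancel_iff]
        omega
    · refine localRule_of_ne ?_ ?_ (shape_erase_le (Or.inr qSE)) (shape_erase_le (Or.inl pSE)) ?_
        (card_shape_erase hq') (card_shape_erase hq) (Ne.symm heq)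
      · rw [Finset.erase_right_comm]
        exact shape_erase_le (Or.inl fun y hy => pSE y (Finset.mem_of_mem_erase hy))
      · exact shape_erase_le (Or.inr fun y hy => qSE y (Finset.mem_of_mem_erase hy))
      · rw [Finset.erase_right_comm]
        exact card_shape_erase hp'

end LocalRule


/-! ### Steps between neighbouring corners. -/

theorem card_cornerShape (S : Finset (ℕ × ℕ)) (c r : ℕ) :
    (cornerShape S c r).card = (S.filter fun x => x.1 ≤ c ∧ r < x.2).card := card_shape _

theorem cornerShape_eq_bot {S : Finset (ℕ × ℕ)} {c r : ℕ} (h : ∀ x ∈ S, x.1 ≤ c → x.2 ≤ r) :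
    cornerShape S c r = ⊥ := by
  have : (S.filter fun x => x.1 ≤ c ∧ r < x.2) = ∅ :=
    Finset.filter_eq_empty_iff.2 fun x hx h' => by have := h x hx h'.1; omega
  rw [cornerShape, this, shape_empty]

/-- A corner does not see the rows above it, so rows can be added on top without changing labels
further down. -/
theorem cornerShape_filter (S : Finset (ℕ × ℕ)) {c r r' : ℕ} (h : r' ≤ r) :
    cornerShape (S.filter fun x => r' < x.2) c r = cornerShape S c r := by
  unfold cornerShape
  rw [Finset.filter_filter]
  congr 1
  refine Finset.filter_congr fun x _ => ?_
  constructor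
  · rintro ⟨-, h'⟩
    exact h'
  · intro h'
    exact ⟨by omega, h'⟩

theorem eqOrAddOne_of_erase {S T : Finset (ℕ × ℕ)} (hTS : T ⊆ S)
    (h : ∀ p ∈ S, p ∉ T → T = S.erase p ∧ ((∀ y ∈ S, ¬ SE y p) ∨ (∀ y ∈ S, ¬ SE p y))) :
    EqOrAddOne (shape SE T) (shape SE S) := by
  by_cases hST : ∃ p ∈ S, p ∉ T
  · obtain ⟨p, hp, hpT⟩ := hST
    obtain ⟨rfl, h2⟩ := h p hp hpT
    exact eqOrAddOne_iff.2 ⟨shape_erase_le h2, (card_shape_erase hp).le⟩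
  · push Not at hST
    exact Or.inl (by rw [Finset.Subset.antisymm hTS hST])

theorem eqOrAddOne_cornerShape_col {S : Finset (ℕ × ℕ)} (hS : IsPartialPerm S) (c r : ℕ) :
    EqOrAddOne (cornerShape S c r) (cornerShape S (c + 1) r) := by
  refine eqOrAddOne_of_erase ?_ fun p hp hpT => ?_
  · intro x
    simp only [Finset.mem_filter]
    rintro ⟨h1, h2, h3⟩
    exact ⟨h1, by omega, h3⟩
  · simp only [Finset.mem_filter, not_and, not_lt] at hp hpT ⊢
    have hpc : p.1 = c + 1 := by
      by_contra h
      have := hpT hp.1 (by omega)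
      omega
    refine ⟨?_, Or.inr fun y hy h => ?_⟩
    · ext x
      simp only [Finset.mem_filter, Finset.mem_erase]
      constructor
      · rintro ⟨h1, h2, h3⟩
        exact ⟨fun h => by rw [h] at h2; omega, h1, by omega, h3⟩
      · rintro ⟨h0, h1, h2, h3⟩
        exact ⟨h1, Nat.le_of_lt_succ (lt_of_le_of_ne h2 fun h => h0
          ((hS x h1 p hp.1).1 (by omega))), h3⟩
    · have := h.1
      omega

theorem eqOrAddOne_cornerShape_row {S : Finset (ℕ × ℕ)} (hS : IsPartialPerm S) (c r : ℕ) :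
    EqOrAddOne (cornerShape S c (r + 1)) (cornerShape S c r) := by
  refine eqOrAddOne_of_erase ?_ fun p hp hpT => ?_
  · intro x
    simp only [Finset.mem_filter]
    rintro ⟨h1, h2, h3⟩
    exact ⟨h1, h2, by omega⟩
  · simp only [Finset.mem_filter, not_and, not_lt] at hp hpT ⊢
    have hpc : p.2 = r + 1 := by
      have := hpT hp.1 hp.2.1
      omega
    refine ⟨?_, Or.inl fun y hy h => ?_⟩
    · ext x
      simp only [Finset.mem_filter, Finset.mem_erase]
      constructor
      · rintro ⟨h1, h2, h3⟩
        exact ⟨fun h => by rw [h] at h3; omega, h1, h2, by omega⟩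
      · rintro ⟨h0, h1, h2, h3⟩
        exact ⟨h1, h2, lt_of_le_of_ne h3 fun h => h0 ((hS x h1 p hp.1).2 (by omega))⟩
    · have := h.2
      omega

/-! ### Running the local rule backwards. -/

section LocalRule

theorem LocalRule.card {a : ℕ} {ρ μ ν l : YoungDiagram} (h : LocalRule a ρ μ ν l) :
    l.card + ρ.card = a + μ.card + ν.card := by
  -- As max plus min equals the sum, everything telescopes except the maximum in row `N`, which
  -- vanishes for large `N`.
  have key : ∀ N, ∑ k ∈ Finset.range (N + 1), l.rowLen k + ∑ k ∈ Finset.range N, ρ.rowLen k =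
      a + max (μ.rowLen N) (ν.rowLen N) + ∑ k ∈ Finset.range N, μ.rowLen k +
        ∑ k ∈ Finset.range N, ν.rowLen k := by
    intro N
    induction N with
    | zero => simp [h.1]
    | succ N ih =>
      rw [Finset.sum_range_succ _ (N + 1), Finset.sum_range_succ (fun k => ρ.rowLen k),
        Finset.sum_range_succ (fun k => μ.rowLen k), Finset.sum_range_succ (fun k => ν.rowLen k)]
      have := h.2 N
      omega
  have h1 := key (max (max (l.colLen 0) (ρ.colLen 0)) (max (μ.colLen 0) (ν.colLen 0)))
  rw [sum_rowLen_eq_card (by omega), sum_rowLen_eq_card (by omega), sum_rowLen_eq_card (by omega),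
    sum_rowLen_eq_card (by omega), rowLen_eq_zero (by omega), rowLen_eq_zero (by omega)] at h1
  omega

/-- Interlacing of the parts; it keeps the subtraction that defines `ρ` in `exists_localRule` from
truncating. -/
theorem rowLen_succ_le_of_eqOrAddOne {μ l : YoungDiagram} (h : EqOrAddOne μ l) (k : ℕ) :
    l.rowLen (k + 1) ≤ μ.rowLen k := by
  have h1 := l.rowLen_anti k (k + 1) (Nat.le_succ k)
  have h2 := μ.rowLen_anti k (k + 1) (Nat.le_succ k)
  rcases h with rfl | ⟨i, hi⟩
  · exact h1
  · rw [hi] at h1 ⊢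
    rw [hi k] at h1
    split_ifs at * <;> omega

/-- The local rule can be run backwards. -/
theorem exists_localRule {μ ν l : YoungDiagram} (h1 : EqOrAddOne μ l) (h2 : EqOrAddOne ν l) :
    ∃ (a : ℕ) (ρ : YoungDiagram), LocalRule a ρ μ ν l ∧ a ≤ 1 ∧ EqOrAddOne ρ μ ∧
      EqOrAddOne ρ ν := by
  have i1 := rowLen_succ_le_of_eqOrAddOne h1
  have i2 := rowLen_succ_le_of_eqOrAddOne h2
  obtain ⟨le1, c1⟩ := eqOrAddOne_iff.1 h1
  obtain ⟨le2, c2⟩ := eqOrAddOne_iff.1 h2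
  have r1 := le_iff_rowLen.1 le1
  have r2 := le_iff_rowLen.1 le2
  obtain ⟨ρ, hρ⟩ := exists_rowLen_eq (fun k => max (μ.rowLen (k + 1)) (ν.rowLen (k + 1)) +
      min (μ.rowLen k) (ν.rowLen k) - l.rowLen (k + 1))
    (antitone_nat_of_succ_le fun k => by
      have := i1 (k + 1); have := i2 (k + 1); have := r1 (k + 2); have := r2 (k + 2)
      have := i1 k; have := i2 k; have := r1 (k + 1); have := r2 (k + 1)
      simp only [add_assoc, Nat.reduceAdd] at *
      omega)
    ⟨l.colLen 0, by
      have hl : l.rowLen (l.colLen 0) = 0 := rowLen_eq_zero le_rfl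
      have hl' : l.rowLen (l.colLen 0 + 1) = 0 := rowLen_eq_zero (Nat.le_succ _)
      have := r1 (l.colLen 0); have := r2 (l.colLen 0)
      have := r1 (l.colLen 0 + 1); have := r2 (l.colLen 0 + 1)
      omega⟩
  have hl : LocalRule (l.rowLen 0 - max (μ.rowLen 0) (ν.rowLen 0)) ρ μ ν l := by
    refine ⟨?_, fun k => ?_⟩
    · have := r1 0; have := r2 0
      omega
    · rw [hρ]
      have := i1 k; have := i2 k; have := r1 (k + 1); have := r2 (k + 1)
      omega
  -- The box count alone gives `a ≤ 1` and the bounds on the sizes of `μ` and `ν`.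
  have hc := hl.card
  have le3 : ρ ≤ μ := le_iff_rowLen.2 fun k => by
    rw [hρ]
    have := r1 (k + 1); have := r2 (k + 1)
    omega
  have le4 : ρ ≤ ν := le_iff_rowLen.2 fun k => by
    rw [hρ]
    have := r1 (k + 1); have := r2 (k + 1)
    omega
  have c3 := card_le_of_le le3
  have c4 := card_le_of_le le4
  have c5 := card_le_of_le le1
  have c6 := card_le_of_le le2
  exact ⟨_, ρ, hl, by omega, eqOrAddOne_iff.2 ⟨le3, by omega⟩, eqOrAddOne_iff.2 ⟨le4, by omega⟩⟩

end LocalRule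

/-! ### Existence of fillings with prescribed labels. -/

section Existence

/-- The backward rule is applied box by box from right to left, starting from the label `e` at the
bottom-right corner of the row. -/
theorem exists_row_below (c : ℕ) (τ : ℕ → YoungDiagram)
    (hτ : ∀ i < c, EqOrAddOne (τ i) (τ (i + 1))) (e : YoungDiagram) (he : EqOrAddOne e (τ c)) :
    ∃ (σ : ℕ → YoungDiagram) (a : ℕ → ℕ), σ c = e ∧ (∀ i ≤ c, EqOrAddOne (σ i) (τ i)) ∧
      ∀ i < c, EqOrAddOne (σ i) (σ (i + 1)) ∧ a i ≤ 1 ∧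
        LocalRule (a i) (σ i) (τ i) (σ (i + 1)) (τ (i + 1)) := by
  induction c generalizing e with
  | zero => exact ⟨fun _ => e, fun _ => 0, rfl, fun i hi => by rwa [Nat.le_zero.1 hi], by simp⟩
  | succ c ih =>
    obtain ⟨a, ρ, hl, ha, h1, h2⟩ := exists_localRule (hτ c (Nat.lt_succ_self c)) he
    obtain ⟨σ, b, h3, h4, h5⟩ := ih (fun i hi => hτ i (by omega)) ρ h1
    refine ⟨fun i => if i = c + 1 then e else σ i, fun i => if i = c then a else b i, by simp,
      fun i hi => ?_, fun i hi => ?_⟩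
    · dsimp only
      split_ifs with h
      · rw [h]
        exact he
      · exact h4 i (by omega)
    · dsimp only
      rw [if_neg (by omega : i ≠ c + 1)]
      by_cases h : i = c
      · subst h
        simp only [if_true, h3]
        exact ⟨h2, ha, hl⟩
      · rw [if_neg (by omega : i + 1 ≠ c + 1), if_neg h]
        exact h5 i (by omega)

/-- A row of boxes that obey the local rule can be put on top of a set of points. -/
theorem exists_add_row {S : Finset (ℕ × ℕ)} (hS : IsPartialPerm S) {r c : ℕ}
    (hpos : ∀ x ∈ S, 1 ≤ x.1) (hrow : ∀ x ∈ S, r + 1 < x.2) {σ τ : ℕ → YoungDiagram} {a : ℕ → ℕ}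
    (h0 : τ 0 = ⊥) (hτ : ∀ i < c, EqOrAddOne (τ i) (τ (i + 1)))
    (hστ : ∀ i ≤ c, EqOrAddOne (σ i) (τ i))
    (ha : ∀ i < c, a i ≤ 1 ∧ LocalRule (a i) (σ i) (τ i) (σ (i + 1)) (τ (i + 1)))
    (hσ : ∀ i ≤ c, cornerShape S i (r + 1) = σ i) :
    ∃ T, IsPartialPerm T ∧ (∀ x ∈ T, 1 ≤ x.1) ∧ (T.filter fun x => r + 1 < x.2) = S ∧
      (∀ x ∈ T, r + 1 < x.2 ∨ (x.2 = r + 1 ∧ x.1 ≤ c)) ∧ ∀ i ≤ c, cornerShape T i r = τ i := by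
  classical
  let N := ((Finset.range c).filter fun i => a i = 1).image fun i => (i + 1, r + 1)
  have hN : ∀ x, x ∈ N ↔ ∃ i < c, a i = 1 ∧ x = (i + 1, r + 1) := by
    intro x
    simp only [N, Finset.mem_image, Finset.mem_filter, Finset.mem_range]
    constructor
    · rintro ⟨i, ⟨h1, h2⟩, h3⟩
      exact ⟨i, h1, h2, h3.symm⟩
    · rintro ⟨i, h1, h2, h3⟩
      exact ⟨i, ⟨h1, h2⟩, h3.symm⟩
  -- The excess of the size of `τ i` over that of `σ i` grows by `a i` at each box and never exceeds
  -- one, so a row holds at most one point.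
  have hmono : ∀ d i, i + d ≤ c →
      (τ i).card + (σ (i + d)).card ≤ (τ (i + d)).card + (σ i).card := by
    intro d
    induction d with
    | zero => intro i _; rfl
    | succ d ih =>
      intro i hi
      have h1 := ih i (by omega)
      have h2 := (ha (i + d) (by omega)).2.card
      rw [← add_assoc]
      omega
  have huniq : ∀ i < c, ∀ j < c, a i = 1 → a j = 1 → ¬ i < j := by
    intro i hi j hj hi1 hj1 hij
    have h1 := hmono (j - (i + 1)) (i + 1) (by omega)
    rw [show i + 1 + (j - (i + 1)) = j by omega] at h1
    have h2 := (ha i hi).2.card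
    have h3 := (ha j hj).2.card
    have h4 := (eqOrAddOne_iff.1 (hστ (j + 1) (by omega))).2
    have h5 := card_le_of_le (eqOrAddOne_iff.1 (hστ i (by omega))).1
    omega
  -- The size of `τ` grows by at most one from `i` to `i + 1`; if `a i = 1`, that of `σ` cannot
  -- grow, so the column has no point further down.
  have hcol : ∀ i < c, a i = 1 → ∀ x ∈ S, x.1 ≠ i + 1 := by
    intro i hi hi1 x hx hxi
    have h2 := (ha i hi).2.card
    have h3 := (eqOrAddOne_iff.1 (hτ i hi)).2
    have h4 : (cornerShape S i (r + 1)).card < (cornerShape S (i + 1) (r + 1)).card := by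
      rw [card_cornerShape, card_cornerShape]
      refine Finset.card_lt_card ((Finset.ssubset_iff_of_subset ?_).2 ⟨x, ?_, ?_⟩)
      · intro y
        simp only [Finset.mem_filter]
        rintro ⟨h1, h2, h3⟩
        exact ⟨h1, by omega, h3⟩
      · exact Finset.mem_filter.2 ⟨hx, hxi.le, hrow x hx⟩
      · simp [hxi]
    rw [hσ i hi.le, hσ (i + 1) hi] at h4
    omega
  have hfil : ((S ∪ N).filter fun x => r + 1 < x.2) = S := by
    ext x
    rw [Finset.mem_filter, Finset.mem_union, hN]
    constructor
    · rintro ⟨h | ⟨i, -, -, rfl⟩, h2⟩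
      · exact h
      · exact absurd h2 (lt_irrefl _)
    · intro h
      exact ⟨Or.inl h, hrow x h⟩
  have hP : IsPartialPerm (S ∪ N) := by
    intro x hx y hy
    rw [Finset.mem_union, hN] at hx hy
    rcases hx with hx | ⟨i, hi, hi1, rfl⟩ <;> rcases hy with hy | ⟨j, hj, hj1, rfl⟩
    · exact hS x hx y hy
    · exact ⟨fun h => absurd h (hcol j hj hj1 x hx), fun h => by have := hrow x hx; omega⟩
    · exact ⟨fun h => absurd h.symm (hcol i hi hi1 y hy), fun h => by have := hrow y hy; omega⟩
    · have h1 := huniq i hi j hj hi1 hj1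
      have h2 := huniq j hj i hi hj1 hi1
      have : i = j := by omega
      subst this
      simp
  have hshape : ∀ i, cornerShape (S ∪ N) i (r + 1) = cornerShape S i (r + 1) := fun i => by
    rw [← cornerShape_filter (S ∪ N) le_rfl, hfil]
  refine ⟨S ∪ N, hP, ?_, hfil, ?_, ?_⟩
  · intro x hx
    rw [Finset.mem_union, hN] at hx
    rcases hx with hx | ⟨i, -, -, rfl⟩
    · exact hpos x hx
    · simp
  · intro x hx
    rw [Finset.mem_union, hN] at hx
    rcases hx with hx | ⟨i, hi, -, rfl⟩
    · exact Or.inl (hrow x hx)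
    · exact Or.inr ⟨rfl, hi⟩
  · intro i
    induction i with
    | zero =>
      intro _
      rw [h0]
      refine cornerShape_eq_bot fun x hx h => ?_
      rw [Finset.mem_union, hN] at hx
      rcases hx with hx | ⟨i, -, -, rfl⟩
      · have := hpos x hx
        omega
      · simp at h
    | succ i ih =>
      intro hi
      have h1 := localRule_cornerShape hP i r
      rw [ih (by omega), hshape, hshape, hσ i (by omega), hσ (i + 1) hi] at h1
      have h2 : (if (i + 1, r + 1) ∈ S ∪ N then 1 else 0) = a i := by
        have h3 : (i + 1, r + 1) ∈ S ∪ N ↔ a i = 1 := by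
          rw [Finset.mem_union, hN]
          constructor
          · rintro (h | ⟨j, -, h, hj⟩)
            · exact absurd (hrow _ h) (lt_irrefl _)
            · simp only [Prod.mk.injEq, Nat.add_right_cancel_iff, and_true] at hj
              rwa [hj]
          · intro h
            exact Or.inr ⟨i, hi, h, rfl⟩
        have h4 := (ha i hi).1
        split_ifs with h5
        · exact (h3.1 h5).symm
        · have : a i ≠ 1 := fun h => h5 (h3.2 h)
          omega
      rw [h2] at h1
      exact h1.eq_top (ha i hi).2

theorem eq_bot_of_eqOrAddOne_bot {e : YoungDiagram} (h : EqOrAddOne e ⊥) : e = ⊥ :=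
  le_bot_iff.1 (eqOrAddOne_iff.1 h).1

theorem eq_bot_of_chain {τ : ℕ → YoungDiagram} {c : ℕ}
    (hτ : ∀ i < c, EqOrAddOne (τ i) (τ (i + 1))) (hc : τ c = ⊥) : ∀ i ≤ c, τ i = ⊥ := by
  intro i hi
  induction hi using Nat.decreasingInduction with
  | self => exact hc
  | of_succ k hk ih =>
    have := hτ k hk
    rw [ih] at this
    exact eq_bot_of_eqOrAddOne_bot this

/-- The growth diagram of a rectangle exists for all partitions along its top and right sides. -/
theorem exists_of_rectangle (R c : ℕ) (r : ℕ) (τ e : ℕ → YoungDiagram) (h0 : τ 0 = ⊥)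
    (hτ : ∀ i < c, EqOrAddOne (τ i) (τ (i + 1))) (he0 : e 0 = τ c)
    (he : ∀ s < R, EqOrAddOne (e (s + 1)) (e s)) (heR : e R = ⊥) :
    ∃ S, IsPartialPerm S ∧ (∀ x ∈ S, 1 ≤ x.1 ∧ x.1 ≤ c ∧ r < x.2 ∧ x.2 ≤ r + R) ∧
      (∀ i ≤ c, cornerShape S i r = τ i) ∧ ∀ s ≤ R, cornerShape S c (r + s) = e s := by
  induction R generalizing r τ e with
  | zero =>
    have h := eq_bot_of_chain hτ (he0.symm.trans heR)
    refine ⟨∅, by simp [IsPartialPerm], by simp, fun i hi => ?_, fun s hs => ?_⟩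
    · rw [h i hi, cornerShape_eq_bot (by simp)]
    · rw [Nat.le_zero.1 hs, heR, cornerShape_eq_bot (by simp)]
  | succ R ih =>
    obtain ⟨σ, a, h1, h2, h3⟩ := exists_row_below c τ hτ (e 1) (he0 ▸ he 0 (Nat.succ_pos R))
    have h0' : σ 0 = ⊥ := eq_bot_of_eqOrAddOne_bot (h0 ▸ h2 0 (Nat.zero_le c))
    obtain ⟨S, hS, hbd, hσ, hright⟩ := ih (r + 1) σ (fun s => e (s + 1)) h0'
      (fun i hi => (h3 i hi).1) h1.symm (fun s hs => he (s + 1) (by omega)) heR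
    obtain ⟨T, hT, hTpos, hTS, hTb, hTτ⟩ := exists_add_row hS (fun x hx => (hbd x hx).1)
      (fun x hx => (hbd x hx).2.2.1) h0 hτ h2 (fun i hi => (h3 i hi).2) hσ
    refine ⟨T, hT, fun x hx => ?_, hTτ, fun s hs => ?_⟩
    · have := hTpos x hx
      rcases hTb x hx with h | h
      · have := hbd x (by rw [← hTS]; exact Finset.mem_filter.2 ⟨hx, h⟩)
        omega
      · omega
    · rcases s with _ | s
      · rw [add_zero, hTτ c le_rfl, he0]
      · rw [← hright s (by omega), ← hTS, cornerShape_filter _ (by omega)]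
        congr 1
        omega

/-- The growth diagram of a staircase on top of a square exists for all vacillating sequences,
provided that the square can be filled for all partitions along its top side. -/
theorem exists_of_staircase {n : ℕ} (hn : 1 ≤ n) (L : ℕ → YoungDiagram) (hL0 : L 0 = ⊥)
    (hup : ∀ k, 2 * k + 1 ≤ 2 * n - 1 → EqOrAddOne (L (2 * k)) (L (2 * k + 1)))
    (hdown : ∀ k, 2 * k + 2 ≤ 2 * n - 1 → EqOrAddOne (L (2 * k + 2)) (L (2 * k + 1)))
    (Q : Finset (ℕ × ℕ) → Prop)
    (hQ : ∀ τ : ℕ → YoungDiagram, τ 0 = ⊥ → (∀ i < n, EqOrAddOne (τ i) (τ (i + 1))) →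
      τ n = L (2 * n - 1) → ∃ S, Q S ∧ IsPartialPerm S ∧
        (∀ x ∈ S, 1 ≤ x.1 ∧ x.1 ≤ n ∧ n ≤ x.2) ∧ ∀ i ≤ n, cornerShape S i (n - 1) = τ i) :
    ∃ S, IsPartialPerm S ∧ (∀ x ∈ S, 1 ≤ x.1 ∧ x.1 ≤ x.2 ∧ x.1 ≤ n) ∧
      Q (S.filter fun x => n - 1 < x.2) ∧
      ∀ m ≤ 2 * n - 1, cornerShape S ((m + 1) / 2) (m / 2) = L m := by
  -- Descending induction on `r` starts with the square at `r = n - 1` and puts one shorter row on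
  -- top at a time.
  have key : ∀ r, r ≤ n - 1 → ∀ τ : ℕ → YoungDiagram, τ 0 = ⊥ →
      (∀ i < r + 1, EqOrAddOne (τ i) (τ (i + 1))) → τ (r + 1) = L (2 * r + 1) →
      ∃ S, IsPartialPerm S ∧ (∀ x ∈ S, 1 ≤ x.1 ∧ x.1 ≤ x.2 ∧ x.1 ≤ n ∧ r < x.2) ∧
      Q (S.filter fun x => n - 1 < x.2) ∧ (∀ i ≤ r + 1, cornerShape S i r = τ i) ∧
      ∀ m, 2 * r + 1 ≤ m → m ≤ 2 * n - 1 → cornerShape S ((m + 1) / 2) (m / 2) = L m := by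
    intro r hr
    induction hr using Nat.decreasingInduction with
    | self =>
      intro τ h0 hτ hend
      rw [show n - 1 + 1 = n by omega] at *
      rw [show 2 * (n - 1) + 1 = 2 * n - 1 by omega] at *
      obtain ⟨S, hS, hP, hb, hc⟩ := hQ τ h0 hτ hend
      refine ⟨S, hP, fun x hx => ?_, ?_, hc, fun m h1 h2 => ?_⟩
      · have := hb x hx
        omega
      · rwa [Finset.filter_true_of_mem fun x hx => by have := hb x hx; omega]
      · have : m = 2 * n - 1 := by omega
        subst this
        rw [← hend, ← hc n le_rfl]
        congr 1 <;> omega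
    | of_succ r hr ih =>
      intro τ h0 hτ hend
      obtain ⟨σ, a, h1, h2, h3⟩ := exists_row_below (r + 1) τ hτ (L (2 * r + 2))
        (by rw [hend]; exact hdown r (by omega))
      have h0' : σ 0 = ⊥ := eq_bot_of_eqOrAddOne_bot (h0 ▸ h2 0 (Nat.zero_le _))
      -- The row below is one box longer: its top labels are `σ`, ending at corner `2r + 2`,
      -- followed by corner `2r + 3`.
      obtain ⟨S, hS, hbd, hQS, hσ, hlab⟩ :=
        ih (fun i => if i ≤ r + 1 then σ i else L (2 * (r + 1) + 1)) (by simpa using h0')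
          (by
            intro i hi
            rw [if_pos (by omega)]
            split_ifs with h
            · exact (h3 i (by omega)).1
            · have : i = r + 1 := by omega
              subst this
              rw [h1]
              exact hup (r + 1) (by omega))
          (by rw [if_neg (by omega)])
      obtain ⟨T, hT, hTpos, hTS, hTb, hTτ⟩ := exists_add_row hS (fun x hx => (hbd x hx).1)
        (fun x hx => (hbd x hx).2.2.2) h0 hτ h2 (fun i hi => (h3 i hi).2)
        (fun i hi => by rw [hσ i (by omega), if_pos hi])
      refine ⟨T, hT, fun x hx => ?_, ?_, hTτ, fun m hm1 hm2 => ?_⟩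
      · have := hTpos x hx
        rcases hTb x hx with h | h
        · have := hbd x (by rw [← hTS]; exact Finset.mem_filter.2 ⟨hx, h⟩)
          omega
        · omega
      · convert hQS using 1
        rw [← hTS, Finset.filter_filter]
        refine Finset.filter_congr fun x _ => ?_
        omega
      · by_cases hm : m = 2 * r + 1
        · subst hm
          rw [← hend, ← hTτ (r + 1) le_rfl]
          congr 1 <;> omega
        · rw [← cornerShape_filter T (by omega : r + 1 ≤ m / 2), hTS]
          by_cases hm' : m = 2 * r + 2
          · subst hm'
            rw [show (2 * r + 2 + 1) / 2 = r + 1 by omega, show (2 * r + 2) / 2 = r + 1 by omega,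
              hσ (r + 1) (by omega), if_pos le_rfl, h1]
          · exact hlab m (by omega) hm2
  obtain ⟨S, h1, h2, h3, h4, h5⟩ := key 0 (Nat.zero_le _) (fun i => if i = 0 then ⊥ else L 1)
    (by simp) (fun i hi => by
      have : i = 0 := by omega
      subst this
      have := hup 0 (by omega)
      rw [mul_zero, hL0] at this
      simpa using this) (by simp)
  refine ⟨S, h1, fun x hx => ?_, h3, fun m hm => ?_⟩
  · have := h2 x hx
    omega
  · rcases Nat.eq_zero_or_pos m with rfl | hm0
    · rw [hL0]
      refine cornerShape_eq_bot fun x hx h => ?_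
      have := (h2 x hx).1
      omega
    · exact h5 m (by omega) hm

end Existence

/-! ### Uniqueness of fillings with prescribed labels. -/

section Uniqueness

variable {S T : Finset (ℕ × ℕ)}

/-- From right to left, each box has its bottom-left label and its entry determined by the other
three labels (`LocalRule.eq_bot`). -/
theorem eq_row_below (hS : IsPartialPerm S) (hT : IsPartialPerm T) {r : ℕ} (c : ℕ)
    (h : ∀ i ≤ c, cornerShape S i r = cornerShape T i r)
    (hc : cornerShape S c (r + 1) = cornerShape T c (r + 1)) :
    (∀ i ≤ c, cornerShape S i (r + 1) = cornerShape T i (r + 1)) ∧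
      ∀ i < c, (i + 1, r + 1) ∈ S ↔ (i + 1, r + 1) ∈ T := by
  induction c with
  | zero => exact ⟨fun i hi => by rwa [Nat.le_zero.1 hi], by simp⟩
  | succ c ih =>
    have h1 := localRule_cornerShape hS c r
    have h2 := localRule_cornerShape hT c r
    rw [← h c (Nat.le_succ c), ← h (c + 1) le_rfl, ← hc] at h2
    obtain ⟨h3, h4⟩ := h1.eq_bot h2
    obtain ⟨h5, h6⟩ := ih (fun i hi => h i (by omega)) h4
    refine ⟨fun i hi => ?_, fun i hi => ?_⟩
    · rcases Nat.lt_or_ge c i with hci | hci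
      · rwa [show i = c + 1 by omega]
      · exact h5 i hci
    · rcases Nat.lt_or_ge i c with hci | hci
      · exact h6 i hci
      · rw [show i = c by omega]
        by_cases hcS : (c + 1, r + 1) ∈ S <;> by_cases hcT : (c + 1, r + 1) ∈ T <;>
          simp_all

theorem eq_of_rectangle (hS : IsPartialPerm S) (hT : IsPartialPerm T) {r c R : ℕ}
    (hSb : ∀ x ∈ S, 1 ≤ x.1 ∧ x.1 ≤ c ∧ r < x.2 ∧ x.2 ≤ r + R)
    (hTb : ∀ x ∈ T, 1 ≤ x.1 ∧ x.1 ≤ c ∧ r < x.2 ∧ x.2 ≤ r + R)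
    (htop : ∀ i ≤ c, cornerShape S i r = cornerShape T i r)
    (hright : ∀ s ≤ R, cornerShape S c (r + s) = cornerShape T c (r + s)) : S = T := by
  have key : ∀ s ≤ R, ∀ i ≤ c, cornerShape S i (r + s) = cornerShape T i (r + s) := by
    intro s
    induction s with
    | zero => exact fun _ => htop
    | succ s ih =>
      intro hs
      exact (eq_row_below hS hT c (ih (by omega)) (hright (s + 1) hs)).1
  have hmem : ∀ i < c, ∀ s < R, (i + 1, r + s + 1) ∈ S ↔ (i + 1, r + s + 1) ∈ T :=
    fun i hi s hs => (eq_row_below hS hT c (key s hs.le) (hright (s + 1) hs)).2 i hi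
  ext ⟨a, b⟩
  constructor
  · intro hx
    have hb := hSb _ hx
    dsimp only at hb
    have := hmem (a - 1) (by omega) (b - r - 1) (by omega)
    rw [show a - 1 + 1 = a by omega, show r + (b - r - 1) + 1 = b by omega] at this
    exact this.1 hx
  · intro hx
    have hb := hTb _ hx
    dsimp only at hb
    have := hmem (a - 1) (by omega) (b - r - 1) (by omega)
    rw [show a - 1 + 1 = a by omega, show r + (b - r - 1) + 1 = b by omega] at this
    exact this.2 hx

/-- The border determines the points above the square, but of the square only the labels along its
top side; the rest has to come from symmetry. -/
theorem eq_of_staircase (hS : IsPartialPerm S) (hT : IsPartialPerm T) {n : ℕ}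
    (hSb : ∀ x ∈ S, 1 ≤ x.1 ∧ x.1 ≤ x.2) (hTb : ∀ x ∈ T, 1 ≤ x.1 ∧ x.1 ≤ x.2)
    (h : ∀ m ≤ 2 * n - 1, cornerShape S ((m + 1) / 2) (m / 2) =
      cornerShape T ((m + 1) / 2) (m / 2)) :
    (∀ x : ℕ × ℕ, x.2 < n → (x ∈ S ↔ x ∈ T)) ∧
      ∀ i ≤ n, cornerShape S i (n - 1) = cornerShape T i (n - 1) := by
  have hzero : ∀ r, cornerShape S 0 r = cornerShape T 0 r := fun r => by
    rw [cornerShape_eq_bot fun x hx h => by have := hSb x hx; omega,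
      cornerShape_eq_bot fun x hx h => by have := hTb x hx; omega]
  have h1 : ∀ r < n, cornerShape S (r + 1) r = cornerShape T (r + 1) r := by
    intro r hr
    have := h (2 * r + 1) (by omega)
    rwa [show (2 * r + 1 + 1) / 2 = r + 1 by omega, show (2 * r + 1) / 2 = r by omega] at this
  have h2 : ∀ r, r + 1 < n → cornerShape S (r + 1) (r + 1) = cornerShape T (r + 1) (r + 1) := by
    intro r hr
    have := h (2 * r + 2) (by omega)
    rwa [show (2 * r + 2 + 1) / 2 = r + 1 by omega, show (2 * r + 2) / 2 = r + 1 by omega] at this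
  have key : ∀ r < n, ∀ i ≤ r + 1, cornerShape S i r = cornerShape T i r := by
    intro r
    induction r with
    | zero =>
      intro hr i hi
      rcases Nat.eq_zero_or_pos i with rfl | hi0
      · exact hzero 0
      · rw [show i = 0 + 1 by omega]
        exact h1 0 hr
    | succ r ih =>
      intro hr i hi
      by_cases hir : i ≤ r + 1
      · exact (eq_row_below hS hT (r + 1) (ih (by omega)) (h2 r hr)).1 i hir
      · rw [show i = r + 1 + 1 by omega]
        exact h1 (r + 1) hr
  have hmem : ∀ r, r + 1 < n → ∀ i < r + 1, (i + 1, r + 1) ∈ S ↔ (i + 1, r + 1) ∈ T :=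
    fun r hr => (eq_row_below hS hT (r + 1) (key r (by omega)) (h2 r hr)).2
  refine ⟨?_, fun i hi => ?_⟩
  · rintro ⟨a, b⟩ hb
    constructor
    · intro hx
      have := hSb _ hx
      dsimp only at this hb
      have := hmem (b - 1) (by omega) (a - 1) (by omega)
      rw [show a - 1 + 1 = a by omega, show b - 1 + 1 = b by omega] at this
      exact this.1 hx
    · intro hx
      have := hTb _ hx
      dsimp only at this hb
      have := hmem (b - 1) (by omega) (a - 1) (by omega)
      rw [show a - 1 + 1 = a by omega, show b - 1 + 1 = b by omega] at this
      exact this.2 hx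
  · rcases Nat.eq_zero_or_pos n with rfl | hn
    · rw [Nat.le_zero.1 hi]
      exact hzero _
    · exact key (n - 1) (by omega) i (by omega)

end Uniqueness


/-! ### Invariance of shapes under order-preserving and order-reversing maps. -/

section Transport

variable {α β : Type*}

theorem maxLevelled_le_of_map [DecidableEq β] {r : α → α → Prop} {r' : β → β → Prop} {S : Finset α}
    {S' : Finset β} (f : α → β) (g : β → α) (hf : ∀ x ∈ S, f x ∈ S') (hg : ∀ x ∈ S, g (f x) = x)
    (hr : ∀ x ∈ S, ∀ y ∈ S, r' (f x) (f y) → r x y) (k : ℕ) :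
    maxLevelled r k S ≤ maxLevelled r' k S' := by
  obtain ⟨T, hT, ⟨l, hl, hlm⟩, hc⟩ := exists_maxLevelled r k S
  rw [← hc, ← Finset.card_image_of_injOn (f := f) (s := T) fun x hx y hy h => by
    rw [← hg x (hT hx), ← hg y (hT hy), h]]
  refine IsLevelled.card_le_maxLevelled ⟨fun x => l (g x), ?_, ?_⟩
    (Finset.image_subset_iff.2 fun x hx => hf x (hT hx))
  · intro x hx
    obtain ⟨y, hy, rfl⟩ := Finset.mem_image.1 hx
    dsimp only
    rw [hg y (hT hy)]
    exact hl y hy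
  · intro x hx x' hx' h
    obtain ⟨y, hy, rfl⟩ := Finset.mem_image.1 hx
    obtain ⟨y', hy', rfl⟩ := Finset.mem_image.1 hx'
    dsimp only
    rw [hg y (hT hy), hg y' (hT hy')]
    exact hlm y hy y' hy' (hr y (hT hy) y' (hT hy') h)

theorem maxLevelled_le_of_map_reverse [DecidableEq β] {r : α → α → Prop} {r' : β → β → Prop}
    {S : Finset α} {S' : Finset β} (f : α → β) (g : β → α) (hf : ∀ x ∈ S, f x ∈ S')
    (hg : ∀ x ∈ S, g (f x) = x) (hr : ∀ x ∈ S, ∀ y ∈ S, r' (f x) (f y) → r y x) (k : ℕ) :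
    maxLevelled r k S ≤ maxLevelled r' k S' := by
  refine le_trans ?_ (maxLevelled_le_of_map (r := Function.swap r) f g hf hg hr k)
  obtain ⟨T, hT, ⟨l, hl, hlm⟩, hc⟩ := exists_maxLevelled r k S
  rw [← hc]
  -- Counting levels from the top turns a level function for `r` into one for the reversed relation.
  refine IsLevelled.card_le_maxLevelled ⟨fun x => k - 1 - l x, ?_, ?_⟩ hT
  · intro x hx
    have := hl x hx
    dsimp only
    omega
  · intro x hx y hy h
    have := hlm y hy x hx h
    have := hl x hx
    have := hl y hy
    dsimp only
    omega

theorem shape_eq_of_maxLevelled_eq {r : α → α → Prop} {r' : β → β → Prop} [IsStrictOrder α r]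
    [IsStrictOrder β r'] {S : Finset α} {S' : Finset β}
    (h : ∀ k, maxLevelled r k S = maxLevelled r' k S') : shape r S = shape r' S' := by
  refine youngDiagram_ext fun k => ?_
  have h1 := rowLen_shape_add (r := r) k S
  have h2 := rowLen_shape_add (r := r') k S'
  rw [h, h] at h1
  omega

end Transport

/-! ### Odd columns and the alternating sum of the parts. -/

section OddColumns

/-- The alternating sum of the first parts of a partition. -/
def altSum (μ : YoungDiagram) (m : ℕ) : ℤ := ∑ i ∈ Finset.range m, (-1) ^ i * (μ.rowLen i : ℤ)

theorem altSum_eq_of_le {μ : YoungDiagram} {m : ℕ} (hm : μ.colLen 0 ≤ m) :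
    altSum μ m = altSum μ (μ.colLen 0) := by
  unfold altSum
  rw [← Finset.sum_range_add_sum_Ico _ hm, add_eq_left]
  refine Finset.sum_eq_zero fun i hi => ?_
  rw [rowLen_eq_zero (Finset.mem_Ico.1 hi).1]
  simp

/-- For equal off-diagonal labels, `l.rowLen (k + 1) = μ.rowLen (k + 1) + μ.rowLen k - ρ.rowLen k`.
In the alternating sum the contributions of `μ` cancel. -/
theorem LocalRule.altSum {a : ℕ} {ρ μ l : YoungDiagram} (h : LocalRule a ρ μ μ l) :
    altSum l (l.colLen 0) = a + altSum ρ (ρ.colLen 0) := by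
  have key : ∀ m, GreeneGrowth.altSum l (m + 1) =
      a + GreeneGrowth.altSum ρ m + (-1) ^ m * (μ.rowLen m : ℤ) := by
    intro m
    induction m with
    | zero => simp [GreeneGrowth.altSum, h.1]
    | succ m ih =>
      have h1 : (l.rowLen (m + 1) : ℤ) = μ.rowLen (m + 1) + μ.rowLen m - ρ.rowLen m := by
        have := h.2 m
        rw [max_self, min_self] at this
        omega
      rw [GreeneGrowth.altSum, Finset.sum_range_succ, ← GreeneGrowth.altSum, ih, h1,
        GreeneGrowth.altSum, GreeneGrowth.altSum, Finset.sum_range_succ]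
      ring
  have h1 := key (max (l.colLen 0) (max (ρ.colLen 0) (μ.colLen 0)))
  rw [altSum_eq_of_le (μ := l) (by omega), altSum_eq_of_le (μ := ρ) (by omega),
    rowLen_eq_zero (by omega)] at h1
  simpa using h1

/-- Summed column by column, a column contributes `1 - 1 + 1 - …`, that is, the parity of its
length. -/
theorem altSum_eq_card (μ : YoungDiagram) :
    altSum μ (μ.colLen 0) =
      (((Finset.range (μ.rowLen 0)).filter fun j => Odd (μ.colLen j)).card : ℤ) := by
  have h1 : ∀ c m : ℕ, c ≤ m → ∑ i ∈ Finset.range m, (if i < c then (-1 : ℤ) ^ i else 0) =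
      if Odd c then 1 else 0 := by
    intro c m hcm
    rw [← Finset.sum_filter, show (Finset.range m).filter (fun i => i < c) = Finset.range c by
      ext i
      simp only [Finset.mem_filter, Finset.mem_range]
      omega]
    clear hcm
    induction c with
    | zero => simp
    | succ c ih =>
      rw [Finset.sum_range_succ, ih]
      rcases Nat.even_or_odd c with h | h
      · simp [h, Even.add_one h, Nat.not_odd_iff_even.2 h]
      · simp [h, Nat.not_odd_iff_even.2 (Odd.add_one h)]
  have h2 : ∀ i, (μ.rowLen i : ℤ) =
      ∑ j ∈ Finset.range (μ.rowLen 0), if i < μ.colLen j then 1 else 0 := by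
    intro i
    rw [Finset.sum_boole]
    congr 1
    rw [show (Finset.range (μ.rowLen 0)).filter (fun j => i < μ.colLen j) =
      Finset.range (μ.rowLen i) by
        ext j
        have := μ.rowLen_anti 0 i (Nat.zero_le i)
        simp only [Finset.mem_filter, Finset.mem_range, ← YoungDiagram.mem_iff_lt_colLen,
          YoungDiagram.mem_iff_lt_rowLen]
        omega]
    rw [Finset.card_range]
  unfold altSum
  rw [Finset.sum_congr rfl fun i _ => by rw [h2 i, Finset.mul_sum], Finset.sum_comm,
    ← Finset.sum_boole]
  refine Finset.sum_congr rfl fun j _ => ?_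
  rw [← h1 _ _ (μ.colLen_anti 0 j (Nat.zero_le j))]
  refine Finset.sum_congr rfl fun i _ => ?_
  split_ifs <;> simp

theorem atMostOneOddColumn_iff (μ : YoungDiagram) :
    AtMostOneOddColumn μ ↔ altSum μ (μ.colLen 0) ≤ 1 := by
  rw [altSum_eq_card, Nat.cast_le_one, Finset.card_le_one]
  have h : ∀ j, Odd (μ.colLen j) → j < μ.rowLen 0 := fun j hj => by
    rw [← YoungDiagram.mem_iff_lt_rowLen, YoungDiagram.mem_iff_lt_colLen]
    exact hj.pos
  constructor
  · intro hs a ha b hb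
    exact hs (Finset.mem_filter.1 ha).2 (Finset.mem_filter.1 hb).2
  · intro hs a ha b hb
    exact hs a (by simpa using ⟨h a ha, ha⟩) b (by simpa using ⟨h b hb, hb⟩)

theorem atMostOneOddPart_transpose_iff (μ : YoungDiagram) :
    AtMostOneOddPart μ.transpose ↔ AtMostOneOddColumn μ := by
  unfold AtMostOneOddPart AtMostOneOddColumn
  simp only [YoungDiagram.rowLen_transpose]

end OddColumns

/-! ### Symmetric fillings of the square, and reversal of its rows. -/

section Square

/-- Reflection of the `n × n` square (columns `1, …, n` and rows `n, …, 2n-1`) in the diagonal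
from bottom-left to top-right. -/
def reflect (n : ℕ) (x : ℕ × ℕ) : ℕ × ℕ := (2 * n - x.2, 2 * n - x.1)

/-- The points lie in the square formed by the columns `1, …, n` and the rows `n, …, 2n-1`. -/
def InSquare (n : ℕ) (S : Finset (ℕ × ℕ)) : Prop :=
  ∀ x ∈ S, 1 ≤ x.1 ∧ x.1 ≤ n ∧ n ≤ x.2 ∧ x.2 ≤ 2 * n - 1

/-- Partial permutation matrices in the square that are symmetric with respect to `reflect`. -/
structure IsSymmetricSquare (n : ℕ) (S : Finset (ℕ × ℕ)) : Prop where
  perm : IsPartialPerm S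
  inSquare : InSquare n S
  symm : ∀ x ∈ S, reflect n x ∈ S

/-- At most one point lies on the diagonal of the square. -/
def AtMostOneDiagonal (n : ℕ) (S : Finset (ℕ × ℕ)) : Prop :=
  ∀ x ∈ S, ∀ y ∈ S, x.1 + x.2 = 2 * n → y.1 + y.2 = 2 * n → x = y

variable {n : ℕ} {S T : Finset (ℕ × ℕ)}

theorem reflect_reflect {x : ℕ × ℕ} (h1 : x.1 ≤ 2 * n) (h2 : x.2 ≤ 2 * n) :
    reflect n (reflect n x) = x := by
  ext <;> simp only [reflect] <;> omega

theorem InSquare.image_reflect (hS : InSquare n S) : InSquare n (S.image (reflect n)) := by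
  intro x hx
  obtain ⟨y, hy, rfl⟩ := Finset.mem_image.1 hx
  have := hS y hy
  simp only [reflect]
  omega

/-- The reflection reverses `SE`, which does not affect the maximal sizes of levelled sets, and maps
the region of one corner to that of the mirrored corner. -/
theorem cornerShape_image_reflect (hS : InSquare n S) {c r : ℕ} (hc : c < 2 * n) (hr : r < 2 * n) :
    cornerShape (S.image (reflect n)) c r = cornerShape S (2 * n - r - 1) (2 * n - c - 1) := by
  refine shape_eq_of_maxLevelled_eq fun k => le_antisymm ?_ ?_
  · refine maxLevelled_le_of_map_reverse (reflect n) (reflect n) ?_ ?_ ?_ k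
    · intro x hx
      rw [Finset.mem_filter] at hx ⊢
      obtain ⟨y, hy, rfl⟩ := Finset.mem_image.1 hx.1
      have h1 := hS y hy
      have h2 := hx.2
      rw [reflect_reflect (by omega) (by omega)]
      simp only [reflect] at h2
      exact ⟨hy, by omega, by omega⟩
    · intro x hx
      have := hS.image_reflect x (Finset.mem_filter.1 hx).1
      exact reflect_reflect (by omega) (by omega)
    · intro x hx y hy h
      unfold SE reflect at *
      dsimp only at h
      omega
  · refine maxLevelled_le_of_map_reverse (reflect n) (reflect n) ?_ ?_ ?_ k
    · intro x hx
      rw [Finset.mem_filter] at hx ⊢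
      have h1 := hS x hx.1
      refine ⟨Finset.mem_image_of_mem _ hx.1, ?_⟩
      have h2 := hx.2
      simp only [reflect]
      omega
    · intro x hx
      have := hS x (Finset.mem_filter.1 hx).1
      exact reflect_reflect (by omega) (by omega)
    · intro x hx y hy h
      unfold SE reflect at *
      dsimp only at h
      omega

theorem IsSymmetricSquare.image_reflect (hS : IsSymmetricSquare n S) :
    S.image (reflect n) = S := by
  ext x
  rw [Finset.mem_image]
  constructor
  · rintro ⟨y, hy, rfl⟩
    exact hS.symm y hy
  · intro hx
    have := hS.inSquare x hx
    exact ⟨reflect n x, hS.symm x hx, reflect_reflect (by omega) (by omega)⟩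

theorem IsSymmetricSquare.cornerShape_eq (hS : IsSymmetricSquare n S) {c r : ℕ} (hc : c < 2 * n)
    (hr : r < 2 * n) : cornerShape S c r = cornerShape S (2 * n - r - 1) (2 * n - c - 1) := by
  rw [← cornerShape_image_reflect hS.inSquare hc hr, hS.image_reflect]

theorem InSquare.rectangle (hn : 1 ≤ n) (hS : InSquare n S) :
    ∀ x ∈ S, 1 ≤ x.1 ∧ x.1 ≤ n ∧ n - 1 < x.2 ∧ x.2 ≤ n - 1 + n := fun x hx => by
  have := hS x hx
  omega

/-- Symmetry turns the labels on the right side into labels along the top, so `eq_of_rectangle`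
applies. -/
theorem IsSymmetricSquare.eq (hn : 1 ≤ n) (hS : IsSymmetricSquare n S)
    (hT : IsSymmetricSquare n T)
    (h : ∀ i ≤ n, cornerShape S i (n - 1) = cornerShape T i (n - 1)) : S = T := by
  refine eq_of_rectangle hS.perm hT.perm (hS.inSquare.rectangle hn) (hT.inSquare.rectangle hn) h
    fun s hs => ?_
  rcases Nat.lt_or_ge (n - 1 + s) (2 * n) with h1 | h1
  · rw [hS.cornerShape_eq (by omega) h1, hT.cornerShape_eq (by omega) h1,
      show 2 * n - n - 1 = n - 1 by omega]
    exact h _ (by omega)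
  · omega

/-- The labels on the right side are prescribed as the mirror image of those on top. The reflected
filling then has the same border labels, hence is the same filling. -/
theorem exists_symmetricSquare (hn : 1 ≤ n) (τ : ℕ → YoungDiagram) (h0 : τ 0 = ⊥)
    (hτ : ∀ i < n, EqOrAddOne (τ i) (τ (i + 1))) :
    ∃ S, IsSymmetricSquare n S ∧ ∀ i ≤ n, cornerShape S i (n - 1) = τ i := by
  obtain ⟨S, hS, hb, htop, hright⟩ := exists_of_rectangle n n (n - 1) τ (fun s => τ (n - s)) h0 hτ
    (by simp) (fun s hs => by
      have := hτ (n - (s + 1)) (by omega)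
      rwa [show n - (s + 1) + 1 = n - s by omega] at this) (by simpa using h0)
  have hsq : InSquare n S := fun x hx => by
    have := hb x hx
    omega
  have hP : IsPartialPerm (S.image (reflect n)) := by
    intro x hx y hy
    obtain ⟨x', hx', rfl⟩ := Finset.mem_image.1 hx
    obtain ⟨y', hy', rfl⟩ := Finset.mem_image.1 hy
    have h1 := hS x' hx' y' hy'
    have h2 := hsq x' hx'
    have h3 := hsq y' hy'
    simp only [reflect]
    exact ⟨fun h => by rw [h1.2 (by omega)], fun h => by rw [h1.1 (by omega)]⟩
  have heq : S.image (reflect n) = S := by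
    refine eq_of_rectangle hP hS (hsq.image_reflect.rectangle hn) hb (fun i hi => ?_)
      fun s hs => ?_
    · rw [cornerShape_image_reflect hsq (by omega) (by omega), htop i hi,
        show 2 * n - (n - 1) - 1 = n by omega, show 2 * n - i - 1 = n - 1 + (n - i) by omega,
        hright _ (by omega)]
      congr 1
      omega
    · rw [cornerShape_image_reflect hsq (by omega) (by omega), hright s hs,
        show 2 * n - n - 1 = n - 1 by omega, htop _ (by omega)]
      congr 1
      omega
  exact ⟨S, ⟨hS, hsq, fun x hx => by rw [← heq]; exact Finset.mem_image_of_mem _ hx⟩, htop⟩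

/-- The number of odd columns is the number of points on the diagonal. -/
theorem IsSymmetricSquare.atMostOneOddColumn_iff (hn : 1 ≤ n) (hS : IsSymmetricSquare n S) :
    AtMostOneOddColumn (cornerShape S n (n - 1)) ↔ AtMostOneDiagonal n S := by
  -- Walking up the diagonal from the bottom-left corner: the two off-diagonal labels of a diagonal
  -- box agree by symmetry, so `LocalRule.altSum` adds exactly its entry.
  have key : ∀ s ≤ n, altSum (cornerShape S s (2 * n - 1 - s))
      ((cornerShape S s (2 * n - 1 - s)).colLen 0) =
      (((Finset.range s).filter fun t => (t + 1, 2 * n - 1 - t) ∈ S).card : ℤ) := by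
    intro s
    induction s with
    | zero =>
      intro _
      rw [cornerShape_eq_bot fun x hx h => by have := hS.inSquare x hx; omega]
      simp [altSum, rowLen_bot]
    | succ s ih =>
      intro hs
      have h1 := localRule_cornerShape hS.perm s (2 * n - 1 - (s + 1))
      rw [show 2 * n - 1 - (s + 1) + 1 = 2 * n - 1 - s by omega,
        hS.cornerShape_eq (c := s) (r := 2 * n - 1 - (s + 1)) (by omega) (by omega),
        show 2 * n - (2 * n - 1 - (s + 1)) - 1 = s + 1 by omega,
        show 2 * n - s - 1 = 2 * n - 1 - s by omega] at h1
      rw [h1.altSum, ih (by omega), Finset.range_add_one, Finset.filter_insert]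
      split_ifs with h
      · rw [Finset.card_insert_of_notMem (by simp)]
        push_cast
        ring
      · simp
  have h1 := key n le_rfl
  rw [show 2 * n - 1 - n = n - 1 by omega] at h1
  rw [GreeneGrowth.atMostOneOddColumn_iff, h1, Nat.cast_le_one, Finset.card_le_one]
  constructor
  · rintro h ⟨a, b⟩ hx ⟨a', b'⟩ hy hxd hyd
    have b1 := hS.inSquare _ hx
    have b2 := hS.inSquare _ hy
    dsimp only at hxd hyd b1 b2
    have := h (a - 1) (by
      rw [Finset.mem_filter, Finset.mem_range, show a - 1 + 1 = a by omega,
        show 2 * n - 1 - (a - 1) = b by omega]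
      exact ⟨by omega, hx⟩) (a' - 1) (by
      rw [Finset.mem_filter, Finset.mem_range, show a' - 1 + 1 = a' by omega,
        show 2 * n - 1 - (a' - 1) = b' by omega]
      exact ⟨by omega, hy⟩)
    ext <;> dsimp only <;> omega
  · intro h s hs t ht
    rw [Finset.mem_filter, Finset.mem_range] at hs ht
    have := h _ hs.2 _ ht.2 (by dsimp only; omega) (by dsimp only; omega)
    simp only [Prod.mk.injEq] at this
    omega

/-- Reversal of the rows `n, …, 2n-1` of the square. -/
def flip (n : ℕ) (x : ℕ × ℕ) : ℕ × ℕ := if x.2 < n then x else (x.1, 3 * n - 1 - x.2)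

theorem flip_flip {x : ℕ × ℕ} (h : x.2 ≤ 2 * n - 1) : flip n (flip n x) = x := by
  unfold flip
  split_ifs with h1 h2
  · rfl
  · dsimp only at h2
    omega
  · ext
    · rfl
    · dsimp only
      omega

theorem flip_snd_lt_iff {x : ℕ × ℕ} (h : x.2 ≤ 2 * n - 1) : (flip n x).2 < n ↔ x.2 < n := by
  unfold flip
  split_ifs with h1
  · simp [h1]
  · dsimp only
    omega

theorem flip_fst (x : ℕ × ℕ) : (flip n x).1 = x.1 := by
  unfold flip
  split_ifs <;> rfl

theorem flip_snd_le {x : ℕ × ℕ} (h : x.2 ≤ 2 * n - 1) : (flip n x).2 ≤ 2 * n - 1 := by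
  unfold flip
  split_ifs with h1
  · exact h
  · dsimp only
    omega

theorem flip_snd_injOn {x y : ℕ × ℕ} (hx : x.2 ≤ 2 * n - 1) (hy : y.2 ≤ 2 * n - 1)
    (h : (flip n x).2 = (flip n y).2) : x.2 = y.2 := by
  unfold flip at h
  split_ifs at h <;> try dsimp only at h
  all_goals omega

theorem IsPartialPerm.image_flip (hS : IsPartialPerm S) (hb : ∀ x ∈ S, x.2 ≤ 2 * n - 1) :
    IsPartialPerm (S.image (flip n)) := by
  intro x hx y hy
  obtain ⟨x', hx', rfl⟩ := Finset.mem_image.1 hx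
  obtain ⟨y', hy', rfl⟩ := Finset.mem_image.1 hy
  have h1 := hS x' hx' y' hy'
  refine ⟨fun h => ?_, fun h => ?_⟩
  · rw [flip_fst, flip_fst] at h
    rw [h1.1 h]
  · rw [h1.2 (flip_snd_injOn (hb x' hx') (hb y' hy') h)]

theorem image_flip_image_flip (hb : ∀ x ∈ S, x.2 ≤ 2 * n - 1) :
    (S.image (flip n)).image (flip n) = S := by
  rw [Finset.image_image]
  conv_rhs => rw [← Finset.image_id (s := S)]
  exact Finset.image_congr fun x hx => flip_flip (hb x hx)

theorem filter_image_flip (hb : ∀ x ∈ S, x.2 ≤ 2 * n - 1) (hn : 1 ≤ n) :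
    ((S.image (flip n)).filter fun x => n - 1 < x.2) =
      (S.filter fun x => n - 1 < x.2).image (flip n) := by
  ext x
  simp only [Finset.mem_filter, Finset.mem_image]
  constructor
  · rintro ⟨⟨y, hy, rfl⟩, h⟩
    have := flip_snd_lt_iff (hb y hy)
    exact ⟨y, ⟨hy, by omega⟩, rfl⟩
  · rintro ⟨y, ⟨hy, h⟩, rfl⟩
    have := flip_snd_lt_iff (hb y hy)
    exact ⟨⟨y, hy, rfl⟩, by omega⟩

/-- Reversing the rows of the square conjugates the partitions along its top side. -/
theorem cornerShape_image_flip (hn : 1 ≤ n) (hS : IsPartialPerm S)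
    (hb : ∀ x ∈ S, x.2 ≤ 2 * n - 1) (i : ℕ) :
    cornerShape (S.image (flip n)) i (n - 1) = (cornerShape S i (n - 1)).transpose := by
  rw [cornerShape, cornerShape, ← shape_NE_eq_transpose _ (hS.mono (Finset.filter_subset _ _))]
  refine shape_eq_of_maxLevelled_eq fun k => le_antisymm ?_ ?_
  · refine maxLevelled_le_of_map (flip n) (flip n) ?_ ?_ ?_ k
    · intro x hx
      rw [Finset.mem_filter] at hx ⊢
      obtain ⟨y, hy, rfl⟩ := Finset.mem_image.1 hx.1
      have h2 := hx.2
      have := flip_snd_lt_iff (hb y hy)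
      rw [flip_fst] at h2
      rw [flip_flip (hb y hy)]
      exact ⟨hy, by omega, by omega⟩
    · intro x hx
      obtain ⟨y, hy, rfl⟩ := Finset.mem_image.1 (Finset.mem_filter.1 hx).1
      exact flip_flip (flip_snd_le (hb y hy))
    · intro x hx y hy h
      have h1 := (Finset.mem_filter.1 hx).2.2
      have h2 := (Finset.mem_filter.1 hy).2.2
      unfold NE flip at h
      rw [if_neg (by omega), if_neg (by omega)] at h
      unfold SE
      dsimp only at h
      omega
  · refine maxLevelled_le_of_map (flip n) (flip n) ?_ ?_ ?_ k
    · intro x hx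
      rw [Finset.mem_filter] at hx ⊢
      have h2 := hx.2
      have := flip_snd_lt_iff (hb x hx.1)
      refine ⟨Finset.mem_image_of_mem _ hx.1, ?_⟩
      rw [flip_fst]
      omega
    · intro x hx
      exact flip_flip (hb x (Finset.mem_filter.1 hx).1)
    · intro x hx y hy h
      have h1 := (Finset.mem_filter.1 hx).2.2
      have h2 := (Finset.mem_filter.1 hy).2.2
      have h3 := hb x (Finset.mem_filter.1 hx).1
      have h4 := hb y (Finset.mem_filter.1 hy).1
      unfold SE flip at h
      rw [if_neg (by omega), if_neg (by omega)] at h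
      unfold NE
      dsimp only at h
      omega

end Square


/-! ### Labellings of nesting sets and of their row-reversed versions. -/

section NestingSets

/-- The sets of boxes filled with ones by the fillings of the nesting polyomino that correspond to
type `C_n` set partitions. -/
structure IsNestingSet (n : ℕ) (S : Finset (ℕ × ℕ)) : Prop where
  perm : IsPartialPerm S
  bounds : ∀ x ∈ S, 1 ≤ x.1 ∧ x.1 ≤ n ∧ x.1 ≤ x.2 ∧ x.2 ≤ 2 * n - 1
  symm : ∀ x ∈ S, n ≤ x.2 → reflect n x ∈ S
  diagonal : AtMostOneDiagonal n S

variable {n : ℕ} {S T : Finset (ℕ × ℕ)}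

theorem IsNestingSet.square (hS : IsNestingSet n S) :
    IsSymmetricSquare n (S.filter fun x => n - 1 < x.2) where
  perm := hS.perm.mono (Finset.filter_subset _ _)
  inSquare := fun x hx => by
    rw [Finset.mem_filter] at hx
    have := hS.bounds x hx.1
    omega
  symm := fun x hx => by
    rw [Finset.mem_filter] at hx ⊢
    have := hS.bounds x hx.1
    refine ⟨hS.symm x hx.1 (by omega), ?_⟩
    simp only [reflect]
    omega

/-- A point with `x.1 + x.2 = 2 * n` outside the square would have column greater than `n`. -/
theorem atMostOneDiagonal_filter_iff (hb : ∀ x ∈ S, x.1 ≤ n) :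
    AtMostOneDiagonal n (S.filter fun x => n - 1 < x.2) ↔ AtMostOneDiagonal n S := by
  constructor
  · intro h x hx y hy h1 h2
    have b1 := hb x hx
    have b2 := hb y hy
    by_cases hx0 : n - 1 < x.2
    · by_cases hy0 : n - 1 < y.2
      · exact h x (Finset.mem_filter.2 ⟨hx, hx0⟩) y (Finset.mem_filter.2 ⟨hy, hy0⟩) h1 h2
      · ext <;> omega
    · ext <;> omega
  · intro h x hx y hy
    exact h x (Finset.mem_filter.1 hx).1 y (Finset.mem_filter.1 hy).1

theorem isNestingSet_of_square (hS : IsPartialPerm S)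
    (hb : ∀ x ∈ S, 1 ≤ x.1 ∧ x.1 ≤ x.2 ∧ x.1 ≤ n)
    (hsq : IsSymmetricSquare n (S.filter fun x => n - 1 < x.2))
    (hd : AtMostOneDiagonal n (S.filter fun x => n - 1 < x.2)) : IsNestingSet n S where
  perm := hS
  bounds := fun x hx => by
    have h1 := hb x hx
    by_cases h : n - 1 < x.2
    · have := hsq.inSquare x (Finset.mem_filter.2 ⟨hx, h⟩)
      omega
    · omega
  symm := fun x hx h =>
    (Finset.mem_filter.1 (hsq.symm x (Finset.mem_filter.2 ⟨hx, by have := hb x hx; omega⟩))).1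
  diagonal := (atMostOneDiagonal_filter_iff fun x hx => (hb x hx).2.2).1 hd

/-- The labelling of the border of the upper half. -/
noncomputable def borderLabels (n : ℕ) (S : Finset (ℕ × ℕ)) : PartitionSeq n :=
  fun m => cornerShape S ((m.1 + 1) / 2) (m.1 / 2)

theorem term_borderLabels (hb : ∀ x ∈ S, 1 ≤ x.1) {m : ℕ} (hm : m ≤ 2 * n - 1) :
    (borderLabels n S).term m = cornerShape S ((m + 1) / 2) (m / 2) := by
  unfold PartitionSeq.term
  split_ifs with h
  · rfl
  · rw [Finset.mem_Icc] at h
    have : m = 0 := by omega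
    subst this
    exact (cornerShape_eq_bot fun x hx h' => by have := hb x hx; omega).symm

theorem isVacillating_borderLabels (hb : ∀ x ∈ S, 1 ≤ x.1) (hS : IsPartialPerm S) :
    IsVacillating (borderLabels n S) := by
  intro k
  refine ⟨fun h => ?_, fun h => ?_⟩
  · rw [term_borderLabels hb h, term_borderLabels hb (by omega),
      show (2 * k + 1) / 2 = k by omega, show 2 * k / 2 = k by omega,
      show (2 * k + 1 + 1) / 2 = k + 1 by omega]
    exact eqOrAddOne_cornerShape_col hS k k
  · rw [term_borderLabels hb h, term_borderLabels hb (by omega),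
      show (2 * k + 2 + 1) / 2 = k + 1 by omega, show (2 * k + 2) / 2 = k + 1 by omega,
      show (2 * k + 1) / 2 = k by omega]
    exact eqOrAddOne_cornerShape_row hS (k + 1) k

theorem term_borderLabels_last (hb : ∀ x ∈ S, 1 ≤ x.1) :
    (borderLabels n S).term (2 * n - 1) = cornerShape S n (n - 1) := by
  rw [term_borderLabels hb le_rfl]
  congr 1 <;> omega

theorem cornerShape_eq_of_borderLabels_eq (hSb : ∀ x ∈ S, 1 ≤ x.1) (hTb : ∀ x ∈ T, 1 ≤ x.1)
    (h : borderLabels n S = borderLabels n T) {m : ℕ} (hm : m ≤ 2 * n - 1) :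
    cornerShape S ((m + 1) / 2) (m / 2) = cornerShape T ((m + 1) / 2) (m / 2) := by
  rw [← term_borderLabels hSb hm, ← term_borderLabels hTb hm, h]

theorem exists_of_vacillating (hn : 1 ≤ n) {L : PartitionSeq n} (hL : IsVacillating L)
    (Q : Finset (ℕ × ℕ) → Prop)
    (hQ : ∀ τ : ℕ → YoungDiagram, τ 0 = ⊥ → (∀ i < n, EqOrAddOne (τ i) (τ (i + 1))) →
      τ n = L.term (2 * n - 1) → ∃ S, Q S ∧ IsPartialPerm S ∧
        (∀ x ∈ S, 1 ≤ x.1 ∧ x.1 ≤ n ∧ n ≤ x.2) ∧ ∀ i ≤ n, cornerShape S i (n - 1) = τ i) :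
    ∃ S, IsPartialPerm S ∧ (∀ x ∈ S, 1 ≤ x.1 ∧ x.1 ≤ x.2 ∧ x.1 ≤ n) ∧
      Q (S.filter fun x => n - 1 < x.2) ∧ borderLabels n S = L := by
  obtain ⟨S, h1, h2, h3, h4⟩ := exists_of_staircase hn L.term (by simp [PartitionSeq.term])
    (fun k => (hL k).1) (fun k => (hL k).2) Q hQ
  refine ⟨S, h1, h2, h3, ?_⟩
  funext ⟨m, hm⟩
  refine (h4 m (Finset.mem_Icc.1 hm).2).trans ?_
  rw [PartitionSeq.term, dif_pos hm]

section Nesting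

theorem IsNestingSet.atMostOneOddColumn (hn : 1 ≤ n) (hS : IsNestingSet n S) :
    AtMostOneOddColumn (cornerShape S n (n - 1)) := by
  rw [← cornerShape_filter S le_rfl, hS.square.atMostOneOddColumn_iff hn,
    atMostOneDiagonal_filter_iff fun x hx => (hS.bounds x hx).2.1]
  exact hS.diagonal

theorem IsNestingSet.eq_of_cornerShape_eq (hn : 1 ≤ n) (hS : IsNestingSet n S)
    (hT : IsNestingSet n T) (h1 : ∀ x : ℕ × ℕ, x.2 < n → (x ∈ S ↔ x ∈ T))
    (h2 : ∀ i ≤ n, cornerShape S i (n - 1) = cornerShape T i (n - 1)) : S = T := by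
  have h3 := hS.square.eq hn hT.square fun i hi => by
    rw [cornerShape_filter _ le_rfl, cornerShape_filter _ le_rfl, h2 i hi]
  ext x
  by_cases hx : x.2 < n
  · exact h1 x hx
  · have h4 := Finset.ext_iff.1 h3 x
    simp only [Finset.mem_filter] at h4
    constructor
    · intro h
      exact (h4.1 ⟨h, by omega⟩).1
    · intro h
      exact (h4.2 ⟨h, by omega⟩).1

theorem IsNestingSet.eq_of_borderLabels_eq (hn : 1 ≤ n) (hS : IsNestingSet n S)
    (hT : IsNestingSet n T) (h : borderLabels n S = borderLabels n T) : S = T := by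
  obtain ⟨h1, h2⟩ := eq_of_staircase hS.perm hT.perm (n := n)
    (fun x hx => by have := hS.bounds x hx; omega) (fun x hx => by have := hT.bounds x hx; omega)
    fun m hm => cornerShape_eq_of_borderLabels_eq (fun x hx => (hS.bounds x hx).1)
      (fun x hx => (hT.bounds x hx).1) h hm
  exact hS.eq_of_cornerShape_eq hn hT h1 h2

theorem exists_nestingSet (hn : 1 ≤ n) {L : PartitionSeq n} (hL : IsVacillating L)
    (hodd : AtMostOneOddColumn (L.term (2 * n - 1))) :
    ∃ S, IsNestingSet n S ∧ borderLabels n S = L := by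
  obtain ⟨S, h1, h2, ⟨h3, h4⟩, h5⟩ := exists_of_vacillating hn hL
    (fun S => IsSymmetricSquare n S ∧ AtMostOneDiagonal n S) fun τ h0 hτ hend => by
      obtain ⟨S, hS, hc⟩ := exists_symmetricSquare hn τ h0 hτ
      refine ⟨S, ⟨hS, ?_⟩, hS.perm, fun x hx => ?_, hc⟩
      · rwa [← hS.atMostOneOddColumn_iff hn, hc n le_rfl, hend]
      · have := hS.inSquare x hx
        omega
  exact ⟨S, isNestingSet_of_square h1 h2 h3 h4, h5⟩

end Nesting

section Crossing

theorem IsNestingSet.perm_flip (hS : IsNestingSet n S) : IsPartialPerm (S.image (flip n)) :=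
  hS.perm.image_flip fun x hx => (hS.bounds x hx).2.2.2

theorem IsNestingSet.bounds_flip (hS : IsNestingSet n S) :
    ∀ x ∈ S.image (flip n), 1 ≤ x.1 ∧ x.1 ≤ n ∧ x.1 ≤ x.2 ∧ x.2 ≤ 2 * n - 1 := by
  intro x hx
  obtain ⟨y, hy, rfl⟩ := Finset.mem_image.1 hx
  have h := hS.bounds y hy
  unfold flip
  split_ifs with h1
  · exact h
  · dsimp only
    omega

theorem IsNestingSet.cornerShape_flip (hn : 1 ≤ n) (hS : IsNestingSet n S) (i : ℕ) :
    cornerShape (S.image (flip n)) i (n - 1) = (cornerShape S i (n - 1)).transpose :=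
  cornerShape_image_flip hn hS.perm (fun x hx => (hS.bounds x hx).2.2.2) i

theorem IsNestingSet.atMostOneOddPart (hn : 1 ≤ n) (hS : IsNestingSet n S) :
    AtMostOneOddPart (cornerShape (S.image (flip n)) n (n - 1)) := by
  rw [hS.cornerShape_flip hn, atMostOneOddPart_transpose_iff]
  exact hS.atMostOneOddColumn hn

theorem mem_image_flip_of_lt {x : ℕ × ℕ} (hb : ∀ x ∈ S, x.2 ≤ 2 * n - 1) (hx : x.2 < n) :
    x ∈ S.image (flip n) ↔ x ∈ S := by
  have hfx : flip n x = x := if_pos hx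
  constructor
  · intro h
    obtain ⟨y, hy, h⟩ := Finset.mem_image.1 h
    rwa [← hfx, ← h, flip_flip (hb y hy)]
  · intro h
    rw [← hfx]
    exact Finset.mem_image_of_mem _ h

theorem IsNestingSet.eq_of_borderLabels_flip_eq (hn : 1 ≤ n) (hS : IsNestingSet n S)
    (hT : IsNestingSet n T)
    (h : borderLabels n (S.image (flip n)) = borderLabels n (T.image (flip n))) : S = T := by
  have bS := hS.bounds_flip
  have bT := hT.bounds_flip
  obtain ⟨h1, h2⟩ := eq_of_staircase hS.perm_flip hT.perm_flip (n := n)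
    (fun x hx => by have := bS x hx; omega) (fun x hx => by have := bT x hx; omega)
    fun m hm => cornerShape_eq_of_borderLabels_eq (fun x hx => (bS x hx).1)
      (fun x hx => (bT x hx).1) h hm
  refine hS.eq_of_cornerShape_eq hn hT (fun x hx => ?_) fun i hi => ?_
  · rw [← mem_image_flip_of_lt (fun x hx => (hS.bounds x hx).2.2.2) hx, h1 x hx,
      mem_image_flip_of_lt (fun x hx => (hT.bounds x hx).2.2.2) hx]
  · rw [← YoungDiagram.transpose_eq_iff, ← hS.cornerShape_flip hn, ← hT.cornerShape_flip hn,
      h2 i hi]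

theorem transpose_bot : (⊥ : YoungDiagram).transpose = ⊥ :=
  map_bot YoungDiagram.transposeOrderIso

theorem eqOrAddOne_transpose {μ ν : YoungDiagram} (h : EqOrAddOne μ ν) :
    EqOrAddOne μ.transpose ν.transpose := by
  rw [eqOrAddOne_iff] at h ⊢
  rw [card_transpose, card_transpose, YoungDiagram.transpose_le_iff]
  exact h

/-- The square is filled by the row reversal of a symmetric filling for the transposed labels.
Reversing the rows of the whole set once more gives the nesting set. -/
theorem exists_nestingSet_flip (hn : 1 ≤ n) {L : PartitionSeq n} (hL : IsVacillating L)
    (hodd : AtMostOneOddPart (L.term (2 * n - 1))) :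
    ∃ S, IsNestingSet n S ∧ borderLabels n (S.image (flip n)) = L := by
  have sqb : ∀ U, InSquare n U → ∀ x ∈ U, x.2 ≤ 2 * n - 1 := fun U hU x hx => (hU x hx).2.2.2
  obtain ⟨S, h1, h2, ⟨U, hU, hd, hUS⟩, h5⟩ := exists_of_vacillating hn hL
    (fun S => ∃ U, IsSymmetricSquare n U ∧ AtMostOneDiagonal n U ∧ S = U.image (flip n))
    fun τ h0 hτ hend => by
      obtain ⟨U, hU, hc⟩ := exists_symmetricSquare hn (fun i => (τ i).transpose)
        (by rw [h0, transpose_bot]) (fun i hi => eqOrAddOne_transpose (hτ i hi))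
      refine ⟨U.image (flip n), ⟨U, hU, ?_, rfl⟩,
        hU.perm.image_flip (sqb U hU.inSquare), fun x hx => ?_, fun i hi => ?_⟩
      · rwa [← hU.atMostOneOddColumn_iff hn, hc n le_rfl, ← atMostOneOddPart_transpose_iff,
          YoungDiagram.transpose_transpose, hend]
      · obtain ⟨y, hy, rfl⟩ := Finset.mem_image.1 hx
        have := hU.inSquare y hy
        have := flip_snd_lt_iff (n := n) (x := y) (by omega)
        rw [flip_fst]
        omega
      · rw [cornerShape_image_flip hn hU.perm (sqb U hU.inSquare), hc i hi,
          YoungDiagram.transpose_transpose]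
  have hb : ∀ x ∈ S, x.2 ≤ 2 * n - 1 := by
    intro x hx
    by_cases h : n - 1 < x.2
    · have hxU : x ∈ U.image (flip n) := hUS ▸ Finset.mem_filter.2 ⟨hx, h⟩
      obtain ⟨y, hy, rfl⟩ := Finset.mem_image.1 hxU
      exact flip_snd_le (sqb U hU.inSquare y hy)
    · omega
  have hfil : ((S.image (flip n)).filter fun x => n - 1 < x.2) = U := by
    rw [filter_image_flip hb hn, hUS, image_flip_image_flip (sqb U hU.inSquare)]
  refine ⟨S.image (flip n), isNestingSet_of_square (h1.image_flip hb) (fun x hx => ?_)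
    (hfil.symm ▸ hU) (hfil.symm ▸ hd), by rw [image_flip_image_flip hb, h5]⟩
  obtain ⟨y, hy, rfl⟩ := Finset.mem_image.1 hx
  have := h2 y hy
  have := hb y hy
  unfold flip
  split_ifs with h
  · exact h2 y hy
  · dsimp only
    omega

end Crossing

end NestingSets


variable {n : ℕ}

/-! ### Positions in the nesting order and row labels. -/

section Positions

theorem mem_signedSet {x : ℤ} : x ∈ signedSet n ↔ x ≠ 0 ∧ -(n : ℤ) ≤ x ∧ x ≤ n := by
  simp [signedSet]

theorem neg_mem_signedSet {x : ℤ} (h : x ∈ signedSet n) : -x ∈ signedSet n := by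
  rw [mem_signedSet] at h ⊢
  omega

theorem nestingPos_neg {x : ℤ} (h : x ∈ signedSet n) :
    nestingPos n (-x) = 2 * (n : ℤ) + 1 - nestingPos n x := by
  rw [mem_signedSet] at h
  unfold nestingPos
  split_ifs <;> omega

theorem nestingPos_injOn {x y : ℤ} (hx : x ∈ signedSet n) (hy : y ∈ signedSet n)
    (h : nestingPos n x = nestingPos n y) : x = y := by
  rw [mem_signedSet] at hx hy
  unfold nestingPos at h
  split_ifs at h <;> omega

theorem nestingRow_injOn {r s : ℕ} (hr : 1 ≤ r ∧ r ≤ 2 * n - 1) (hs : 1 ≤ s ∧ s ≤ 2 * n - 1)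
    (h : nestingRow n r = nestingRow n s) : r = s := by
  unfold nestingRow at h
  split_ifs at h <;> omega

theorem mem_negSet {B : Finset ℤ} {x : ℤ} : x ∈ negSet B ↔ -x ∈ B := by
  unfold negSet
  rw [Finset.mem_image]
  constructor
  · rintro ⟨y, hy, rfl⟩
    rwa [neg_neg]
  · intro h
    exact ⟨-x, h, neg_neg x⟩

theorem mem_boxes {x : ℕ × ℕ} : x ∈ boxes n ↔ 1 ≤ x.1 ∧ x.1 ≤ n ∧ x.1 ≤ x.2 ∧ x.2 ≤ 2 * n - 1 := by
  simp only [boxes, Finset.mem_filter, Finset.mem_product, Finset.mem_Icc]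
  omega

/-- Every pair of a positive element and an element of larger position belongs to a box. -/
theorem exists_box {i j : ℤ} (hi : i ∈ signedSet n) (hj : j ∈ signedSet n) (h0 : 0 < i)
    (h : nestingPos n i < nestingPos n j) :
    ∃ x ∈ boxes n, (x.1 : ℤ) = i ∧ nestingRow n x.2 = j := by
  rw [mem_signedSet] at hi hj
  -- Row labels start with `2`, so row `r` carries the element of position `r + 1`.
  refine ⟨(i.toNat, (nestingPos n j - 1).toNat), ?_, ?_, ?_⟩
  · rw [mem_boxes]
    unfold nestingPos at *
    dsimp only
    split_ifs at * <;> omega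
  · dsimp only
    omega
  · unfold nestingPos nestingRow at *
    dsimp only
    split_ifs at * <;> omega

end Positions

/-! ### Arcs of a type `C_n` set partition determine it. -/

section Arcs

variable {P : TypeCPartition n} {i j k : ℤ}

theorem mem_signedSet_of_mem_parts {B : Finset ℤ} (hB : B ∈ P.1.parts) (hi : i ∈ B) :
    i ∈ signedSet n := P.1.le hB hi

theorem _root_.IsArc.mem_left (h : IsArc P i j) : i ∈ signedSet n := by
  obtain ⟨B, hB, hi, -⟩ := h
  exact mem_signedSet_of_mem_parts hB hi

theorem _root_.IsArc.mem_right (h : IsArc P i j) : j ∈ signedSet n := by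
  obtain ⟨B, hB, -, hj, -⟩ := h
  exact mem_signedSet_of_mem_parts hB hj

theorem _root_.IsArc.pos_lt (h : IsArc P i j) : nestingPos n i < nestingPos n j := by
  obtain ⟨B, hB, -, -, h, -⟩ := h
  exact h

theorem _root_.IsArc.neg (h : IsArc P i j) : IsArc P (-j) (-i) := by
  have hi := h.mem_left
  have hj := h.mem_right
  obtain ⟨B, hB, hiB, hjB, hlt, hno⟩ := h
  refine ⟨negSet B, (P.2.1 B).1 hB, by rwa [mem_negSet, neg_neg], by rwa [mem_negSet, neg_neg],
    ?_, fun k hk hk' => ?_⟩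
  · rw [nestingPos_neg hi, nestingPos_neg hj]
    omega
  · rw [mem_negSet] at hk
    refine hno (-k) hk ?_
    have hks := mem_signedSet_of_mem_parts hB hk
    have := nestingPos_neg hks
    rw [neg_neg] at this
    rw [nestingPos_neg hi, nestingPos_neg hj] at hk'
    omega

theorem _root_.IsArc.right_unique (h : IsArc P i j) (h' : IsArc P i k) : j = k := by
  have hj := h.mem_right
  have hk := h'.mem_right
  obtain ⟨B, hB, hiB, hjB, hlt, hno⟩ := h
  obtain ⟨B', hB', hiB', hkB', hlt', hno'⟩ := h'
  obtain rfl := P.1.eq_of_mem_parts hB hB' hiB hiB'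
  have h1 := hno k hkB'
  have h2 := hno' j hjB
  exact nestingPos_injOn hj hk (by omega)

theorem _root_.IsArc.left_unique (h : IsArc P i k) (h' : IsArc P j k) : i = j :=
  neg_injective (h.neg.right_unique h'.neg)

/-- Only one arc joins an element to its negative. -/
theorem _root_.IsArc.self_neg_unique (h : IsArc P i (-i)) (h' : IsArc P j (-j)) : i = j := by
  have hi := h.mem_left
  have hj := h'.mem_left
  obtain ⟨B, hB, hiB, hiB', hlt, hno⟩ := h
  obtain ⟨B', hB', hjB, hjB', hlt', hno'⟩ := h'
  have e1 : B = negSet B :=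
    P.1.eq_of_mem_parts hB ((P.2.1 B).1 hB) hiB (mem_negSet.2 hiB')
  have e2 : B' = negSet B' :=
    P.1.eq_of_mem_parts hB' ((P.2.1 B').1 hB') hjB (mem_negSet.2 hjB')
  -- Both arcs lie in the zero block. Their position intervals are centred at the same point, so
  -- unless they are equal one contains the ends of the other in its interior.
  obtain rfl := P.2.2 B hB B' hB' e1 e2
  have h1 := hno j hjB
  have h2 := hno' i hiB
  rw [nestingPos_neg hi] at h1 hlt
  rw [nestingPos_neg hj] at h2 hlt'
  exact nestingPos_injOn hi hj (by omega)

theorem reflTransGen_isArc {B : Finset ℤ} (hB : B ∈ P.1.parts) (d : ℕ) :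
    ∀ i ∈ B, ∀ j ∈ B, nestingPos n j = nestingPos n i + d →
      Relation.ReflTransGen (IsArc P) i j := by
  induction d using Nat.strong_induction_on with
  | _ d ih =>
  intro i hi j hj hd
  rcases Nat.eq_zero_or_pos d with rfl | hd0
  · rw [nestingPos_injOn (mem_signedSet_of_mem_parts hB hi) (mem_signedSet_of_mem_parts hB hj)
      (by omega)]
  · obtain ⟨k, hk, hmin⟩ := (B.filter fun k => nestingPos n i < nestingPos n k).exists_min_image
      (nestingPos n) ⟨j, Finset.mem_filter.2 ⟨hj, by omega⟩⟩
    rw [Finset.mem_filter] at hk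
    have h1 := hmin j (Finset.mem_filter.2 ⟨hj, by omega⟩)
    have h2 : IsArc P i k := ⟨B, hB, hi, hk.1, hk.2, fun l hl hl' => by
      have := hmin l (Finset.mem_filter.2 ⟨hl, hl'.1⟩)
      omega⟩
    exact .head h2 (ih (nestingPos n j - nestingPos n k).toNat (by omega) k hk.1 j hj (by omega))

theorem reflTransGen_isArc_or {B : Finset ℤ} (hB : B ∈ P.1.parts) (hi : i ∈ B) (hj : j ∈ B) :
    Relation.ReflTransGen (IsArc P) i j ∨ Relation.ReflTransGen (IsArc P) j i := by
  rcases le_total (nestingPos n i) (nestingPos n j) with h | h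
  · exact Or.inl (reflTransGen_isArc hB (nestingPos n j - nestingPos n i).toNat i hi j hj
      (by omega))
  · exact Or.inr (reflTransGen_isArc hB (nestingPos n i - nestingPos n j).toNat j hj i hi
      (by omega))

theorem mem_of_reflTransGen_isArc {B : Finset ℤ} (hB : B ∈ P.1.parts)
    (h : Relation.ReflTransGen (IsArc P) i j) : i ∈ B ↔ j ∈ B := by
  induction h with
  | refl => rfl
  | tail _ hbc ih =>
    rw [ih]
    obtain ⟨B', hB', hb, hc, -⟩ := hbc
    constructor
    · intro h
      rwa [P.1.eq_of_mem_parts hB hB' h hb]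
    · intro h
      rwa [P.1.eq_of_mem_parts hB hB' h hc]

theorem parts_subset_of_isArc_iff {P' : TypeCPartition n}
    (h : ∀ i j, IsArc P i j ↔ IsArc P' i j) : P.1.parts ⊆ P'.1.parts := by
  intro B hB
  obtain ⟨i, hi⟩ := P.1.nonempty_of_mem_parts hB
  obtain ⟨B', hB', hi'⟩ := P'.1.exists_mem (mem_signedSet_of_mem_parts hB hi)
  have hrel : IsArc P = IsArc P' := by
    funext i j
    exact propext (h i j)
  have : B = B' := by
    ext j
    constructor
    · intro hj
      rcases reflTransGen_isArc_or hB hi hj with h | h <;> rw [hrel] at h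
      · exact (mem_of_reflTransGen_isArc hB' h).1 hi'
      · exact (mem_of_reflTransGen_isArc hB' h).2 hi'
    · intro hj
      rcases reflTransGen_isArc_or hB' hi' hj with h | h <;> rw [← hrel] at h
      · exact (mem_of_reflTransGen_isArc hB h).1 hi
      · exact (mem_of_reflTransGen_isArc hB h).2 hi
  rwa [this]

theorem eq_of_isArc_iff {P' : TypeCPartition n} (h : ∀ i j, IsArc P i j ↔ IsArc P' i j) :
    P = P' := by
  refine Subtype.ext (Finpartition.ext ?_)
  exact Finset.Subset.antisymm (parts_subset_of_isArc_iff h)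
    (parts_subset_of_isArc_iff fun i j => (h i j).symm)

end Arcs

section ArcSet

open Classical in
/-- The boxes of the nesting polyomino that correspond to arcs. -/
noncomputable def arcSet (P : TypeCPartition n) : Finset (ℕ × ℕ) :=
  (boxes n).filter fun x => IsArc P (x.1 : ℤ) (nestingRow n x.2)

theorem mem_arcSet {P : TypeCPartition n} {x : ℕ × ℕ} :
    x ∈ arcSet P ↔ x ∈ boxes n ∧ IsArc P (x.1 : ℤ) (nestingRow n x.2) := by
  classical
  exact Finset.mem_filter

theorem nestingRow_of_ge {r : ℕ} (h : n ≤ r) : nestingRow n r = (r : ℤ) - 2 * n :=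
  if_neg (by omega)

/-- For `r ≥ n` the box `(c, r)` stands for the arc `(c, -(2n - r))`. Its negative `(2n - r, -c)` is
the arc of the reflected box, and diagonal boxes stand for arcs `(c, -c)`. -/
theorem isNestingSet_arcSet (P : TypeCPartition n) : IsNestingSet n (arcSet P) where
  perm := by
    intro x hx y hy
    rw [mem_arcSet, mem_boxes] at hx hy
    have key : x.2 = y.2 → x.1 = y.1 := fun h => by
      have h1 := hx.2
      rw [h] at h1
      exact_mod_cast h1.left_unique hy.2
    have key' : x.1 = y.1 → x.2 = y.2 := fun h => by
      have h1 := hx.2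
      rw [h] at h1
      exact nestingRow_injOn (by omega) (by omega) (h1.right_unique hy.2)
    exact ⟨fun h => Prod.ext h (key' h), fun h => Prod.ext (key h) h⟩
  bounds := fun x hx => mem_boxes.1 (mem_arcSet.1 hx).1
  symm := by
    intro x hx hxn
    rw [mem_arcSet, mem_boxes] at hx ⊢
    obtain ⟨hb, harc⟩ := hx
    have h := harc.neg
    rw [nestingRow_of_ge hxn] at h
    simp only [reflect]
    rw [nestingRow_of_ge (by omega)]
    refine ⟨by omega, ?_⟩
    convert h using 1 <;> omega
  diagonal := by
    intro x hx y hy hxd hyd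
    rw [mem_arcSet, mem_boxes] at hx hy
    have h1 := hx.2
    have h2 := hy.2
    rw [nestingRow_of_ge (by omega), show (x.2 : ℤ) - 2 * n = -(x.1 : ℤ) by omega] at h1
    rw [nestingRow_of_ge (by omega), show (y.2 : ℤ) - 2 * n = -(y.1 : ℤ) by omega] at h2
    have h3 := h1.self_neg_unique h2
    ext <;> omega

/-- The boxes record only arcs with positive first element. An arc that starts at a negative element
also ends at one, and its negative is recorded. -/
theorem isArc_iff_of_arcSet_eq {P P' : TypeCPartition n} (h : arcSet P = arcSet P') {i j : ℤ}
    (harc : IsArc P i j) : IsArc P' i j := by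
  have pos : ∀ i j, 0 < i → IsArc P i j → IsArc P' i j := by
    intro i j hi harc
    obtain ⟨x, hx, rfl, rfl⟩ := exists_box harc.mem_left harc.mem_right hi harc.pos_lt
    exact (mem_arcSet.1 (h ▸ mem_arcSet.2 ⟨hx, harc⟩)).2
  rcases lt_or_ge 0 i with hi | hi
  · exact pos i j hi harc
  · have hj : 0 < -j := by
      have h1 := mem_signedSet.1 harc.mem_left
      have h2 := mem_signedSet.1 harc.mem_right
      have h3 := harc.pos_lt
      unfold nestingPos at h3
      split_ifs at h3 <;> omega
    have h1 := (pos _ _ hj harc.neg).neg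
    rwa [neg_neg, neg_neg] at h1

theorem arcSet_injective : Function.Injective (arcSet (n := n)) := fun _ _ h =>
  eq_of_isArc_iff fun _ _ => ⟨isArc_iff_of_arcSet_eq h, isArc_iff_of_arcSet_eq h.symm⟩

end ArcSet

/-! ### The set partition with a given nesting set of arcs. -/

section Construction

/-- The arcs with positive first element that correspond to a set of boxes. -/
def BaseArc (n : ℕ) (S : Finset (ℕ × ℕ)) (i j : ℤ) : Prop :=
  ∃ x ∈ S, (x.1 : ℤ) = i ∧ nestingRow n x.2 = j

/-- The arcs that correspond to a set of boxes, together with their negatives. -/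
def SetArc (n : ℕ) (S : Finset (ℕ × ℕ)) (i j : ℤ) : Prop :=
  BaseArc n S i j ∨ BaseArc n S (-j) (-i)

variable {S : Finset (ℕ × ℕ)} {i j k : ℤ}

theorem SetArc.neg (h : SetArc n S i j) : SetArc n S (-j) (-i) := by
  unfold SetArc at *
  rw [neg_neg, neg_neg]
  exact h.symm

theorem BaseArc.bounds (hS : IsNestingSet n S) (h : BaseArc n S i j) :
    0 < i ∧ i ∈ signedSet n ∧ j ∈ signedSet n ∧ nestingPos n i < nestingPos n j := by
  obtain ⟨x, hx, rfl, rfl⟩ := h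
  have := hS.bounds x hx
  rw [mem_signedSet, mem_signedSet]
  unfold nestingPos nestingRow
  split_ifs <;> omega

theorem BaseArc.neg (hS : IsNestingSet n S) (h : BaseArc n S i j) (hj : j < 0) :
    BaseArc n S (-j) (-i) := by
  obtain ⟨x, hx, rfl, rfl⟩ := h
  have hb := hS.bounds x hx
  have hxn : n ≤ x.2 := by
    unfold nestingRow at hj
    split_ifs at hj <;> omega
  refine ⟨reflect n x, hS.symm x hx hxn, ?_, ?_⟩
  · rw [nestingRow_of_ge hxn]
    simp only [reflect]
    omega
  · simp only [reflect]
    rw [nestingRow_of_ge (by omega)]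
    omega

theorem SetArc.baseArc (hS : IsNestingSet n S) (h : SetArc n S i j) (hi : 0 < i) :
    BaseArc n S i j := by
  rcases h with h | h
  · exact h
  · have := h.neg hS (by omega)
    rwa [neg_neg, neg_neg] at this

theorem SetArc.bounds (hS : IsNestingSet n S) (h : SetArc n S i j) :
    i ∈ signedSet n ∧ j ∈ signedSet n ∧ nestingPos n i < nestingPos n j := by
  rcases h with h | h
  · exact (h.bounds hS).2
  · obtain ⟨-, h1, h2, h3⟩ := h.bounds hS
    have hj := neg_mem_signedSet h1
    have hi := neg_mem_signedSet h2
    rw [neg_neg] at hi hj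
    rw [nestingPos_neg hi, nestingPos_neg hj] at h3
    exact ⟨hi, hj, by omega⟩

theorem SetArc.right_unique (hS : IsNestingSet n S) (h : SetArc n S i j) (h' : SetArc n S i k) :
    j = k := by
  by_cases hi : 0 < i
  · obtain ⟨x, hx, hxi, rfl⟩ := h.baseArc hS hi
    obtain ⟨y, hy, hyi, rfl⟩ := h'.baseArc hS hi
    rw [(hS.perm x hx y hy).1 (by omega)]
  -- No base arc starts at a negative element, so the arc is the negative of a base arc, and
  -- uniqueness within rows applies.
  · have key : ∀ j, SetArc n S i j → BaseArc n S (-j) (-i) := fun j h =>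
      h.resolve_left fun h => hi (h.bounds hS).1
    obtain ⟨x, hx, hxj, hxi⟩ := key j h
    obtain ⟨y, hy, hyj, hyi⟩ := key k h'
    have b1 := hS.bounds x hx
    have b2 := hS.bounds y hy
    have h1 := nestingRow_injOn (n := n) (r := x.2) (s := y.2) (by omega) (by omega)
      (hxi.trans hyi.symm)
    rw [(hS.perm x hx y hy).2 h1] at hxj
    omega

theorem SetArc.left_unique (hS : IsNestingSet n S) (h : SetArc n S i k) (h' : SetArc n S j k) :
    i = j := neg_injective (h.neg.right_unique hS h'.neg)

theorem SetArc.self_neg_unique (hS : IsNestingSet n S) (hi : 0 < i) (hj : 0 < j)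
    (h : SetArc n S i (-i)) (h' : SetArc n S j (-j)) : i = j := by
  obtain ⟨x, hx, hxi, hxr⟩ := h.baseArc hS hi
  obtain ⟨y, hy, hyj, hyr⟩ := h'.baseArc hS hj
  have b1 := hS.bounds x hx
  have b2 := hS.bounds y hy
  have h1 : x.1 + x.2 = 2 * n := by
    unfold nestingRow at hxr
    split_ifs at hxr <;> omega
  have h2 : y.1 + y.2 = 2 * n := by
    unfold nestingRow at hyr
    split_ifs at hyr <;> omega
  rw [← hxi, ← hyj, hS.diagonal x hx y hy h1 h2]

/-- Two elements are connected by a sequence of arcs. -/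
def Connected (n : ℕ) (S : Finset (ℕ × ℕ)) (i j : ℤ) : Prop :=
  Relation.ReflTransGen (SetArc n S) i j ∨ Relation.ReflTransGen (SetArc n S) j i

theorem pos_le_of_reflTransGen (hS : IsNestingSet n S)
    (h : Relation.ReflTransGen (SetArc n S) i j) : nestingPos n i ≤ nestingPos n j := by
  induction h with
  | refl => exact le_rfl
  | tail _ h ih => exact ih.trans (h.bounds hS).2.2.le

theorem Connected.symm (h : Connected n S i j) : Connected n S j i := Or.symm h

/-- Successors and predecessors along arcs are unique, so of two paths with a common end one extends
the other; components are therefore paths. -/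
theorem Connected.trans (hS : IsNestingSet n S) (h : Connected n S i j) (h' : Connected n S j k) :
    Connected n S i k := by
  rcases h with h | h <;> rcases h' with h' | h'
  · exact Or.inl (h.trans h')
  · have hl : Relator.RightUnique (Function.swap (SetArc n S)) := fun a b c h h' =>
      h.left_unique hS h'
    have h1 := Relation.reflTransGen_swap.2 h
    have h2 := Relation.reflTransGen_swap.2 h'
    rcases Relation.ReflTransGen.total_of_right_unique hl h1 h2 with h | h
    · exact Or.inr (Relation.reflTransGen_swap.1 h)
    · exact Or.inl (Relation.reflTransGen_swap.1 h)
  · have hl : Relator.RightUnique (SetArc n S) := fun a b c h h' => h.right_unique hS h'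
    exact Relation.ReflTransGen.total_of_right_unique hl h h'
  · exact Or.inr (h'.trans h)

theorem reflTransGen_neg (h : Relation.ReflTransGen (SetArc n S) i j) :
    Relation.ReflTransGen (SetArc n S) (-j) (-i) := by
  induction h with
  | refl => exact .refl
  | tail _ h ih => exact .head h.neg ih

theorem Connected.neg (h : Connected n S i j) : Connected n S (-i) (-j) :=
  h.symm.imp reflTransGen_neg reflTransGen_neg

theorem Connected.reflTransGen (hS : IsNestingSet n S) (hi : i ∈ signedSet n)
    (hj : j ∈ signedSet n) (h : Connected n S i j) (hlt : nestingPos n i ≤ nestingPos n j) :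
    Relation.ReflTransGen (SetArc n S) i j := by
  rcases h with h | h
  · exact h
  · have := pos_le_of_reflTransGen hS h
    rw [nestingPos_injOn hi hj (by omega)]

/-- Connectedness by arcs as an equivalence relation. -/
def connectedSetoid (hS : IsNestingSet n S) : Setoid ℤ where
  r := Connected n S
  iseqv := ⟨fun _ => Or.inl .refl, Connected.symm, Connected.trans hS⟩

open Classical in
/-- The set partition of `[±n]` into the connected components of the arcs. -/
noncomputable def arcPartition (hS : IsNestingSet n S) : Finpartition (signedSet n) :=
  Finpartition.ofSetSetoid (connectedSetoid hS) (signedSet n)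

theorem mem_part_arcPartition (hS : IsNestingSet n S) :
    j ∈ (arcPartition hS).part i ↔ i ∈ signedSet n ∧ j ∈ signedSet n ∧ Connected n S i j := by
  classical
  exact Finpartition.mem_part_ofSetSetoid_iff_rel _

theorem exists_of_mem_parts {B : Finset ℤ} (hS : IsNestingSet n S)
    (hB : B ∈ (arcPartition hS).parts) :
    ∃ i ∈ signedSet n, ∀ j, j ∈ B ↔ j ∈ signedSet n ∧ Connected n S i j := by
  obtain ⟨i, hi⟩ := (arcPartition hS).nonempty_of_mem_parts hB
  have his : i ∈ signedSet n := (arcPartition hS).le hB hi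
  refine ⟨i, his, fun j => ?_⟩
  rw [← (arcPartition hS).part_eq_of_mem hB hi, mem_part_arcPartition]
  exact ⟨fun h => h.2, fun h => ⟨his, h⟩⟩

theorem negSet_mem_parts {B : Finset ℤ} (hS : IsNestingSet n S)
    (hB : B ∈ (arcPartition hS).parts) : negSet B ∈ (arcPartition hS).parts := by
  obtain ⟨i, hi, h⟩ := exists_of_mem_parts hS hB
  have : negSet B = (arcPartition hS).part (-i) := by
    ext j
    rw [mem_negSet, h, mem_part_arcPartition]
    constructor
    · rintro ⟨h1, h2⟩
      have h3 := neg_mem_signedSet h1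
      have h4 := h2.neg
      rw [neg_neg] at h3 h4
      exact ⟨neg_mem_signedSet hi, h3, h4⟩
    · rintro ⟨-, h1, h2⟩
      have h3 := h2.neg
      rw [neg_neg] at h3
      exact ⟨neg_mem_signedSet h1, h3⟩
  rw [this, Finpartition.part_mem]
  exact neg_mem_signedSet hi

theorem negSet_negSet (B : Finset ℤ) : negSet (negSet B) = B := by
  ext x
  rw [mem_negSet, mem_negSet, neg_neg]

/-- A block that equals its negative contains an arc joining an element to its negative. -/
theorem exists_setArc_neg {B : Finset ℤ} (hS : IsNestingSet n S)
    (hB : B ∈ (arcPartition hS).parts) (hneg : B = negSet B) :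
    ∃ c ∈ B, 0 < c ∧ SetArc n S c (-c) := by
  obtain ⟨i, hi, h⟩ := exists_of_mem_parts hS hB
  have hnegmem : ∀ x ∈ B, -x ∈ B := fun x hx => by
    rw [hneg, mem_negSet, neg_neg]
    exact hx
  have hiB : i ∈ B := (h i).2 ⟨hi, Or.inl .refl⟩
  have hne : (B.filter fun x => 0 < x).Nonempty := by
    rcases lt_or_ge 0 i with h0 | h0
    · exact ⟨i, Finset.mem_filter.2 ⟨hiB, h0⟩⟩
    · have := (mem_signedSet.1 hi).1
      exact ⟨-i, Finset.mem_filter.2 ⟨hnegmem i hiB, by omega⟩⟩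
  -- The largest positive `c` in `B`, together with `-c`, bounds the innermost pair of the block.
  -- The first arc on the path from `c` to `-c` cannot stop in between, so it ends at `-c`.
  obtain ⟨c, hc, hmax⟩ := Finset.exists_max_image _ id hne
  rw [Finset.mem_filter] at hc
  refine ⟨c, hc.1, hc.2, ?_⟩
  have hcs := ((h c).1 hc.1).1
  have hcn := neg_mem_signedSet hcs
  have hconn : Connected n S c (-c) :=
    ((h c).1 hc.1).2.symm.trans hS ((h (-c)).1 (hnegmem c hc.1)).2
  have hcb := mem_signedSet.1 hcs
  have hpos : nestingPos n c ≤ nestingPos n (-c) := by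
    unfold nestingPos
    split_ifs <;> omega
  have hpath := hconn.reflTransGen hS hcs hcn hpos
  rcases Relation.ReflTransGen.cases_head hpath with h0 | ⟨k, hk, hkc⟩
  · omega
  · have hkB : k ∈ B := (h k).2 ⟨(hk.bounds hS).2.1,
      ((h c).1 hc.1).2.trans hS (Or.inl (.single hk))⟩
    have hks := mem_signedSet.1 (hk.bounds hS).2.1
    have hlt := (hk.bounds hS).2.2
    have hle := pos_le_of_reflTransGen hS hkc
    have hk1 : 0 < k → k ≤ c := fun h0 => hmax k (Finset.mem_filter.2 ⟨hkB, h0⟩)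
    have hk2 : 0 < -k → -k ≤ c := fun h0 =>
      hmax (-k) (Finset.mem_filter.2 ⟨hnegmem k hkB, h0⟩)
    have : k = -c := by
      unfold nestingPos at hlt hle
      split_ifs at hlt hle <;> omega
    rwa [this] at hk

/-- The type `C_n` set partition with given arcs. -/
noncomputable def partitionOfSet (hS : IsNestingSet n S) : TypeCPartition n :=
  ⟨arcPartition hS, fun B => ⟨negSet_mem_parts hS, fun h => by
      have := negSet_mem_parts hS h
      rwa [negSet_negSet] at this⟩,
    fun B hB B' hB' h h' => by
      obtain ⟨c, hc, hc0, harc⟩ := exists_setArc_neg hS hB h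
      obtain ⟨c', hc', hc0', harc'⟩ := exists_setArc_neg hS hB' h'
      have := harc.self_neg_unique hS hc0 hc0' harc'
      subst this
      exact (arcPartition hS).eq_of_mem_parts hB hB' hc hc'⟩

/-- Blocks are paths along which positions increase, so consecutive elements of a block are exactly
neighbours on its path. -/
theorem isArc_partitionOfSet_iff (hS : IsNestingSet n S) :
    IsArc (partitionOfSet hS) i j ↔ SetArc n S i j := by
  constructor
  · rintro ⟨B, hB, hi, hj, hlt, hno⟩
    obtain ⟨b, hb, h⟩ := exists_of_mem_parts hS hB
    have hbi := (h i).1 hi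
    have hbj := (h j).1 hj
    have hpath := (hbi.2.symm.trans hS hbj.2).reflTransGen hS hbi.1 hbj.1 hlt.le
    rcases Relation.ReflTransGen.cases_head hpath with h0 | ⟨k, hk, hkj⟩
    · rw [h0] at hlt
      exact absurd hlt (lt_irrefl _)
    · have hkb := hk.bounds hS
      have hkB : k ∈ B := (h k).2 ⟨hkb.2.1, hbi.2.trans hS (Or.inl (.single hk))⟩
      have h1 := pos_le_of_reflTransGen hS hkj
      have h2 := hno k hkB
      rwa [nestingPos_injOn hkb.2.1 hbj.1 (by omega)] at hk
  · intro harc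
    obtain ⟨hi, hj, hlt⟩ := harc.bounds hS
    refine ⟨(arcPartition hS).part i, (arcPartition hS).part_mem.2 hi,
      (mem_part_arcPartition hS).2 ⟨hi, hi, Or.inl .refl⟩,
      (mem_part_arcPartition hS).2 ⟨hi, hj, Or.inl (.single harc)⟩, hlt, fun k hk hk' => ?_⟩
    obtain ⟨-, hks, hk⟩ := (mem_part_arcPartition hS).1 hk
    have hpath := hk.reflTransGen hS hi hks hk'.1.le
    rcases Relation.ReflTransGen.cases_head hpath with h0 | ⟨l, hl, hlk⟩
    · rw [h0] at hk'
      exact lt_irrefl _ hk'.1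
    · rw [hl.right_unique hS harc] at hlk
      have := pos_le_of_reflTransGen hS hlk
      omega

theorem arcSet_partitionOfSet (hS : IsNestingSet n S) : arcSet (partitionOfSet hS) = S := by
  ext x
  rw [mem_arcSet, isArc_partitionOfSet_iff]
  constructor
  · rintro ⟨hb, harc⟩
    rw [mem_boxes] at hb
    obtain ⟨y, hy, h1, h2⟩ := harc.baseArc hS (by omega)
    have hyb := hS.bounds y hy
    have h3 := nestingRow_injOn (n := n) (r := y.2) (s := x.2) (by omega) (by omega) h2
    rwa [Prod.ext (Int.ofNat_inj.1 h1) h3] at hy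
  · intro hx
    exact ⟨mem_boxes.2 (hS.bounds x hx), Or.inl ⟨x, hx, rfl, rfl⟩⟩

end Construction


/-! ### North-east chains as antichains of `SE`. -/

section ChainShape

/-- Mirsky's argument: the colours on a chain are distinct, so chains have at most `k` elements, and
the size of a longest chain strictly below `x` serves as the level of `x`. -/
theorem isLevelled_of_coloring {α : Type*} {r : α → α → Prop} [IsStrictOrder α r] {k : ℕ}
    {T : Finset α} (col : α → ℕ) (h1 : ∀ x ∈ T, col x < k)
    (h2 : ∀ x ∈ T, ∀ y ∈ T, r x y → col x ≠ col y) : IsLevelled r k T := by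
  classical
  let Z : α → Finset (Finset α) := fun x =>
    T.powerset.filter fun Z => (∀ z ∈ Z, r z x) ∧ ∀ z ∈ Z, ∀ w ∈ Z, z ≠ w → r z w ∨ r w z
  have hZ : ∀ x z, z ∈ Z x ↔
      z ⊆ T ∧ (∀ y ∈ z, r y x) ∧ ∀ y ∈ z, ∀ w ∈ z, y ≠ w → r y w ∨ r w y := fun x z => by
    simp only [Z, Finset.mem_filter, Finset.mem_powerset]
  have insert_chain : ∀ x, ∀ z ∈ Z x, ∀ y ∈ insert x z, ∀ w ∈ insert x z, y ≠ w →
      r y w ∨ r w y := by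
    intro x z hz y hy w hw hyw
    obtain ⟨-, hz1, hz2⟩ := (hZ x z).1 hz
    rcases Finset.mem_insert.1 hy with h | h <;> rcases Finset.mem_insert.1 hw with h' | h'
    · exact absurd (h.trans h'.symm) hyw
    · exact Or.inr (h ▸ hz1 w h')
    · exact Or.inl (h' ▸ hz1 y h)
    · exact hz2 y h w h' hyw
  have card_insert : ∀ x, ∀ z ∈ Z x, (insert x z).card = z.card + 1 := fun x z hz =>
    Finset.card_insert_of_notMem fun h => irrefl x (((hZ x z).1 hz).2.1 x h)
  have nonempty : ∀ x, (Z x).Nonempty := fun x => ⟨∅, (hZ x ∅).2 (by simp)⟩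
  refine ⟨fun x => (Z x).sup Finset.card, fun x hx => ?_, fun x hx y hy hxy => ?_⟩
  · obtain ⟨z, hz, hzc⟩ := Finset.exists_mem_eq_sup _ (nonempty x) Finset.card
    dsimp only
    rw [hzc, ← Nat.add_one_le_iff, ← card_insert x z hz]
    have hsub : insert x z ⊆ T := Finset.insert_subset hx ((hZ x z).1 hz).1
    calc (insert x z).card ≤ (Finset.range k).card := by
          refine Finset.card_le_card_of_injOn col (fun y hy => ?_) fun y hy w hw hyw => ?_
          · exact Finset.mem_coe.2 (Finset.mem_range.2 (h1 y (hsub hy)))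
          · by_contra hne
            rcases insert_chain x z hz y hy w hw hne with h | h
            · exact h2 y (hsub hy) w (hsub hw) h hyw
            · exact h2 w (hsub hw) y (hsub hy) h hyw.symm
      _ = k := Finset.card_range k
  · obtain ⟨z, hz, hzc⟩ := Finset.exists_mem_eq_sup _ (nonempty x) Finset.card
    dsimp only
    rw [hzc, ← Nat.add_one_le_iff, ← card_insert x z hz]
    refine Finset.le_sup (f := Finset.card) ((hZ y _).2 ⟨?_, ?_, insert_chain x z hz⟩)
    · exact Finset.insert_subset hx ((hZ x z).1 hz).1
    · intro w hw
      rcases Finset.mem_insert.1 hw with rfl | hw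
      · exact hxy
      · exact _root_.trans (((hZ x z).1 hz).2.1 w hw) hxy

theorem isUnionOfNEChains_iff {T : Finset (ℕ × ℕ)} (hT : IsPartialPerm T) (k : ℕ) :
    IsUnionOfNEChains k T ↔ IsLevelled SE k T := by
  classical
  constructor
  · rintro ⟨C, hC, rfl⟩
    have hcol : ∀ x, ∃ c : ℕ, x ∈ Finset.univ.biUnion C → ∃ i : Fin k, i.1 = c ∧ x ∈ C i := by
      intro x
      by_cases hx : x ∈ Finset.univ.biUnion C
      · obtain ⟨i, -, hi⟩ := Finset.mem_biUnion.1 hx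
        exact ⟨i, fun _ => ⟨i, rfl, hi⟩⟩
      · exact ⟨0, fun h => absurd h hx⟩
    choose col hcol using hcol
    refine isLevelled_of_coloring col (fun x hx => ?_) fun x hx y hy hxy hne => ?_
    · obtain ⟨i, hi, -⟩ := hcol x hx
      exact hi ▸ i.2
    · obtain ⟨i, hi, hxi⟩ := hcol x hx
      obtain ⟨j, hj, hyj⟩ := hcol y hy
      have hij : i = j := Fin.ext (by omega)
      subst hij
      have h := hC i (Finset.mem_coe.2 hxi) (Finset.mem_coe.2 hyj)
        (fun h => irrefl (r := SE) x (by rwa [← h] at hxy))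
      have h1 := hxy.1
      have h2 := hxy.2
      dsimp only at h
      omega
  · rintro ⟨f, hf, hfm⟩
    refine ⟨fun i => T.filter fun x => f x = i.1, fun i => ?_, ?_⟩
    · intro x hx y hy hne
      have hx := Finset.mem_filter.1 (Finset.mem_coe.1 hx)
      have hy := Finset.mem_filter.1 (Finset.mem_coe.1 hy)
      have h1 := hfm x hx.1 y hy.1
      have h2 := hfm y hy.1 x hx.1
      have h3 := hT x hx.1 y hy.1
      have h4 : x.1 ≠ y.1 := fun h => hne (h3.1 h)
      have h5 : x.2 ≠ y.2 := fun h => hne (h3.2 h)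
      unfold SE at h1 h2
      dsimp only
      omega
    · ext x
      simp only [Finset.mem_biUnion, Finset.mem_univ, true_and, Finset.mem_filter]
      exact ⟨fun h => ⟨⟨f x, hf x h⟩, h, rfl⟩, fun ⟨_, h, _⟩ => h⟩

theorem isChainShape_iff {U : Finset (ℕ × ℕ)} (hU : IsPartialPerm U) (μ : YoungDiagram) :
    IsChainShape (U : Set (ℕ × ℕ)) μ ↔ μ = shape SE U := by
  have hg : ∀ k, IsGreatest {m : ℕ | ∃ T : Finset (ℕ × ℕ), (T : Set (ℕ × ℕ)) ⊆ U ∧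
      IsUnionOfNEChains k T ∧ T.card = m} (maxLevelled SE k U) := by
    intro k
    constructor
    · obtain ⟨T, hT, hl, hc⟩ := exists_maxLevelled SE k U
      exact ⟨T, Finset.coe_subset.2 hT, (isUnionOfNEChains_iff (hU.mono hT) k).2 hl, hc⟩
    · rintro m ⟨T, hT, hl, rfl⟩
      have hT := Finset.coe_subset.1 hT
      exact ((isUnionOfNEChains_iff (hU.mono hT) k).1 hl).card_le_maxLevelled hT
  constructor
  · intro h
    refine youngDiagram_ext fun k => ?_
    have h1 := (h k).unique (hg k)
    have h2 := (h (k + 1)).unique (hg (k + 1))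
    have h3 := rowLen_shape_add (r := SE) k U
    rw [Finset.sum_range_succ] at h2
    omega
  · rintro rfl k
    rw [sum_rowLen_shape]
    exact hg k

end ChainShape

/-! ### From sets of boxes back to fillings. -/

section Fillings

/-- The boxes that contain ones. -/
def onesOf (F : Filling n) : Finset (ℕ × ℕ) :=
  (Finset.univ.filter fun b => F b = 1).image Subtype.val

theorem mem_onesOf {F : Filling n} {x : ℕ × ℕ} :
    x ∈ onesOf F ↔ ∃ h : x ∈ boxes n, F ⟨x, h⟩ = 1 := by
  simp [onesOf]

theorem onesInRegion_eq (F : Filling n) (c r : ℕ) :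
    onesInRegion F c (r + 1) = ((onesOf F).filter fun x => x.1 ≤ c ∧ r < x.2 : Finset (ℕ × ℕ)) := by
  ext x
  simp only [onesInRegion, Finset.coe_filter, mem_onesOf]
  constructor
  · rintro ⟨h1, h2, h3⟩
    exact ⟨h3, h1, h2⟩
  · rintro ⟨h3, h1, h2⟩
    exact ⟨h1, h2, h3⟩

theorem isBorderLabelling_iff {F : Filling n} (hF : IsPartialPerm (onesOf F))
    (L : PartitionSeq n) : IsBorderLabelling F L ↔ L = borderLabels n (onesOf F) := by
  have h : ∀ m, IsChainShape (onesInRegion F ((m.1 + 1) / 2) (m.1 / 2 + 1)) (L m) ↔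
      L m = borderLabels n (onesOf F) m := fun m => by
    rw [onesInRegion_eq, isChainShape_iff (hF.mono (Finset.filter_subset _ _))]
    rfl
  unfold IsBorderLabelling
  rw [funext_iff]
  exact forall_congr' h

theorem onesOf_nestingFilling (P : TypeCPartition n) : onesOf (nestingFilling n P) = arcSet P := by
  ext x
  rw [mem_onesOf, mem_arcSet]
  simp [nestingFilling]

theorem crossingRow_eq {x : ℕ × ℕ} (h : x ∈ boxes n) :
    crossingRow n x.2 = nestingRow n (flip n x).2 := by
  rw [mem_boxes] at h
  unfold crossingRow nestingRow flip
  by_cases hx : x.2 < n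
  · rw [if_pos hx, if_pos hx, if_pos hx]
  · rw [if_neg hx, if_neg hx]
    dsimp only
    rw [if_neg (by omega)]
    omega

theorem flip_mem_boxes {x : ℕ × ℕ} (h : x ∈ boxes n) : flip n x ∈ boxes n := by
  rw [mem_boxes] at h ⊢
  unfold flip
  split_ifs with h1
  · exact h
  · dsimp only
    omega

theorem onesOf_crossingFilling (P : TypeCPartition n) :
    onesOf (crossingFilling n P) = (arcSet P).image (flip n) := by
  ext x
  rw [mem_onesOf, Finset.mem_image]
  have h : (∃ h : x ∈ boxes n, crossingFilling n P ⟨x, h⟩ = 1) ↔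
      x ∈ boxes n ∧ IsArc P (x.1 : ℤ) (crossingRow n x.2) := by
    simp [crossingFilling]
  rw [h]
  constructor
  · rintro ⟨hx, harc⟩
    rw [crossingRow_eq hx, ← flip_fst (n := n) x] at harc
    exact ⟨flip n x, mem_arcSet.2 ⟨flip_mem_boxes hx, harc⟩, flip_flip (mem_boxes.1 hx).2.2.2⟩
  · rintro ⟨y, hy, rfl⟩
    obtain ⟨hyb, harc⟩ := mem_arcSet.1 hy
    have hb := flip_mem_boxes hyb
    refine ⟨hb, ?_⟩
    rw [crossingRow_eq hb, flip_flip (mem_boxes.1 hyb).2.2.2, flip_fst]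
    exact harc

/-- Common assembly of both parts: injectivity of the labels as a function of the partition gives
that of `fill` as well as that of the map from fillings to labels. -/
theorem injective_and_exists_equiv (fill : TypeCPartition n → Filling n) (C : YoungDiagram → Prop)
    (hperm : ∀ P, IsPartialPerm (onesOf (fill P)))
    (hpos : ∀ P, ∀ x ∈ onesOf (fill P), 1 ≤ x.1)
    (hC : ∀ P, C (cornerShape (onesOf (fill P)) n (n - 1)))
    (hinj : ∀ P P', borderLabels n (onesOf (fill P)) = borderLabels n (onesOf (fill P')) → P = P')
    (hsurj : ∀ L : PartitionSeq n, IsVacillating L → C (L.term (2 * n - 1)) →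
      ∃ P, borderLabels n (onesOf (fill P)) = L) :
    Function.Injective fill ∧
      ∃ Φ : {F : Filling n // ∃ P : TypeCPartition n, fill P = F} ≃
          {L : PartitionSeq n // IsVacillating L ∧ C (L.term (2 * n - 1))},
        ∀ (F : {F : Filling n // ∃ P : TypeCPartition n, fill P = F})
          (L : PartitionSeq n), IsBorderLabelling F.1 L ↔ L = (Φ F).1 := by
  refine ⟨fun P P' h => hinj P P' (by rw [h]), ?_⟩
  have hmem : ∀ F : {F : Filling n // ∃ P : TypeCPartition n, fill P = F},
      IsVacillating (borderLabels n (onesOf F.1)) ∧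
        C ((borderLabels n (onesOf F.1)).term (2 * n - 1)) := by
    rintro ⟨_, P, rfl⟩
    refine ⟨isVacillating_borderLabels (hpos P) (hperm P), ?_⟩
    rw [term_borderLabels_last (hpos P)]
    exact hC P
  refine ⟨Equiv.ofBijective (fun F => ⟨borderLabels n (onesOf F.1), hmem F⟩) ⟨?_, ?_⟩, ?_⟩
  · rintro ⟨_, P, rfl⟩ ⟨_, P', rfl⟩ h
    have := hinj P P' (congrArg Subtype.val h)
    subst this
    rfl
  · rintro ⟨L, hL, hCL⟩
    obtain ⟨P, hP⟩ := hsurj L hL hCL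
    exact ⟨⟨fill P, P, rfl⟩, Subtype.ext hP⟩
  · rintro ⟨_, P, rfl⟩ L
    exact isBorderLabelling_iff (hperm P) L

end Fillings

end GreeneGrowth

open GreeneGrowth in
theorem mainTheorem10 (n : ℕ) (hn : 1 ≤ n) :
    (Function.Injective (nestingFilling n) ∧
      ∃ Φ : {F : Filling n // ∃ P : TypeCPartition n, nestingFilling n P = F} ≃
          {L : PartitionSeq n // IsVacillating L ∧ AtMostOneOddColumn (L.term (2 * n - 1))},
        ∀ (F : {F : Filling n // ∃ P : TypeCPartition n, nestingFilling n P = F})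
          (L : PartitionSeq n), IsBorderLabelling F.1 L ↔ L = (Φ F).1) ∧
    (Function.Injective (crossingFilling n) ∧
      ∃ Φ : {F : Filling n // ∃ P : TypeCPartition n, crossingFilling n P = F} ≃
          {L : PartitionSeq n // IsVacillating L ∧ AtMostOneOddPart (L.term (2 * n - 1))},
        ∀ (F : {F : Filling n // ∃ P : TypeCPartition n, crossingFilling n P = F})
          (L : PartitionSeq n), IsBorderLabelling F.1 L ↔ L = (Φ F).1) := by
  have hN := isNestingSet_arcSet (n := n)
  constructor
  · refine injective_and_exists_equiv (nestingFilling n) AtMostOneOddColumn ?_ ?_ ?_ ?_ ?_ <;>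
      simp only [onesOf_nestingFilling]
    · exact fun P => (hN P).perm
    · exact fun P x hx => ((hN P).bounds x hx).1
    · exact fun P => (hN P).atMostOneOddColumn hn
    · exact fun P P' h => arcSet_injective ((hN P).eq_of_borderLabels_eq hn (hN P') h)
    · intro L hL hodd
      obtain ⟨S, hS, h⟩ := exists_nestingSet hn hL hodd
      exact ⟨partitionOfSet hS, by rw [arcSet_partitionOfSet, h]⟩
  · refine injective_and_exists_equiv (crossingFilling n) AtMostOneOddPart ?_ ?_ ?_ ?_ ?_ <;>
      simp only [onesOf_crossingFilling]
    · exact fun P => (hN P).perm_flip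
    · exact fun P x hx => ((hN P).bounds_flip x hx).1
    · exact fun P => (hN P).atMostOneOddPart hn
    · exact fun P P' h => arcSet_injective ((hN P).eq_of_borderLabels_flip_eq hn (hN P') h)
    · intro L hL hodd
      obtain ⟨S, hS, h⟩ := exists_nestingSet_flip hn hL hodd
      exact ⟨partitionOfSet hS, by rw [arcSet_partitionOfSet, h]⟩
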